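/- Notation. For $s\in[0,2]$ let $W^s_2=W^s_2(0,1)$ be the Sobolev space of complex-valued functions on $(0,1)$: the weak derivatives of order at most $\lfloor s\rfloor$ lie in $L_2(0,1)$ and, if $\sigma:=s-\lfloor s\rfloor>0$, the derivative $u$ of order $\lfloor s\rfloor$ satisfies $\int_0^1\!\int_0^1 |u(x)-u(y)|^2|x-y|^{-1-2\sigma}\,dx\,dy<\infty$. Put $$s_n(f)=\int_0^1 f(x)\sin(\pi n x)\,dx,\qquad c_n(f)=\int_0^1 f(x)\cos(\pi n x)\,dx,\qquad (Vf)(x)=(1-2x)f(x).$$ Theorem. Let $\alpha\in(0,1]$, $\gamma=\min\{3\alpha,1+\alpha\}$ and $f\in W^\alpha_2$. Consider the even entire functions $$F_{\mathrm c}(\lambda)=\cos\lambda+\int_0^1 f(x)\cos[\lambda(1-2x)]\,dx,\qquad F_{\mathrm s}(\lambda)=\frac{\sin\lambda}{\lambda}+\int_0^1 f(x)\,\frac{\sin[\lambda(1-2x)]}{\lambda}\,dx$$ (the latter extended by continuity to $\lambda=0$), and let $\Omega=\{z\in\mathbb C: -\pi/2<\arg z\le\pi/2\}\cup\{0\}$.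 The zeros in $\Omega$ of each of these functions can be arranged in an infinite sequence, in which a zero $z\ne0$ is repeated according to its multiplicity, the zero $z=0$ of order $2m$ is repeated $m$ times, and the terms are ordered by increasing real parts and, for equal real parts, by increasing imaginary parts. Let $\xi_1,\xi_3,\xi_5,\dots$ be this sequence for $F_{\mathrm c}$ and $\xi_2,\xi_4,\xi_6,\dots$ the one for $F_{\mathrm s}$, and define $\tilde\xi_n$ by $\xi_n=\frac{\pi n}{2}+\tilde\xi_n$, $n\in\mathbb N$. Then there is a function $g\in W^\gamma_2$ such that $$\tilde\xi_n=s_n(f)-s_n(f)\,c_n(Vf)+s_n(g)\qquad\text{for all } n\in\mathbb N=\{1,2,\dots\}.$$ In particular, there is a function $h\in W^\alpha_2$ such that $\tilde\xi_n=s_n(h)$ for all $n\in\mathbb N$. -/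

import Mathlib

open MeasureTheory Set

noncomputable section

namespace SobolevZeros

/-- `g ∈ L₂(0,1)` is the distributional derivative of `f ∈ L₂(0,1)` on `(0,1)`. -/
def IsWeakDeriv (f g : ℝ → ℂ) : Prop :=
  ∀ φ : ℝ → ℂ, ContDiff ℝ ((⊤ : ℕ∞) : WithTop ℕ∞) φ → HasCompactSupport φ →
    tsupport φ ⊆ Ioo (0 : ℝ) 1 →
    ∫ x in Ioo (0 : ℝ) 1, f x * deriv φ x = - ∫ x in Ioo (0 : ℝ) 1, g x * φ x

/-- Finiteness of the Sobolev–Slobodeckij seminorm of order `σ ∈ (0,1)` on `(0,1)`: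
`∬ |f x - f y|² / |x - y|^(1+2σ) dy dx < ∞`. -/
def FiniteSlobodeckij (σ : ℝ) (f : ℝ → ℂ) : Prop :=
  ∫⁻ x in Ioo (0 : ℝ) 1, ∫⁻ y in Ioo (0 : ℝ) 1,
    ENNReal.ofReal (‖f x - f y‖ ^ 2 / |x - y| ^ (1 + 2 * σ)) < ⊤

/-- `f` represents an element of the (complex-valued) Sobolev space `W^s_2(0,1)`, `s ≥ 0`: the weak
derivatives of order `≤ ⌊s⌋` lie in `L₂(0,1)`, and for non-integral `s` the one of order
`⌊s⌋` has a finite Slobodeckij seminorm of order `s - ⌊s⌋`. Here `D k` is the `k`-th weak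
derivative. Only the values of `f` on `(0,1)` matter. -/
def MemW (s : ℝ) (f : ℝ → ℂ) : Prop :=
  ∃ D : ℕ → ℝ → ℂ, D 0 = f ∧
    (∀ k ≤ ⌊s⌋₊, MemLp (D k) 2 (volume.restrict (Ioo (0 : ℝ) 1))) ∧
    (∀ k < ⌊s⌋₊, IsWeakDeriv (D k) (D (k + 1))) ∧
    (0 < Int.fract s → FiniteSlobodeckij (Int.fract s) (D ⌊s⌋₊))

/-- The `n`-th sine Fourier coefficient `s_n(f)`. -/
def sinCoeff (n : ℕ) (f : ℝ → ℂ) : ℂ :=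
  ∫ x in (0 : ℝ)..1, f x * (Real.sin (Real.pi * n * x) : ℂ)

/-- The `n`-th cosine Fourier coefficient `c_n(f)`. -/
def cosCoeff (n : ℕ) (f : ℝ → ℂ) : ℂ :=
  ∫ x in (0 : ℝ)..1, f x * (Real.cos (Real.pi * n * x) : ℂ)

/-- The operator `V` of multiplication by `1 - 2x`. -/
def V (f : ℝ → ℂ) : ℝ → ℂ := fun x => (1 - 2 * (x : ℂ)) * f x

/-- `F_c(λ) = cos λ + ∫₀¹ f(x) cos(λ(1-2x)) dx`. -/
def Fc (f : ℝ → ℂ) (z : ℂ) : ℂ :=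
  Complex.cos z + ∫ x in (0 : ℝ)..1, f x * Complex.cos (z * (1 - 2 * (x : ℂ)))

/-- `F_s(λ) = sin λ / λ + ∫₀¹ f(x) sin(λ(1-2x)) / λ dx`, with the removable singularity at
`λ = 0` filled in by continuity, so that `F_s` is an entire function. -/
def Fs (f : ℝ → ℂ) (z : ℂ) : ℂ :=
  if z = 0 then 1 + ∫ x in (0 : ℝ)..1, f x * (1 - 2 * (x : ℂ))
  else Complex.sin z / z +
    ∫ x in (0 : ℝ)..1, f x * (Complex.sin (z * (1 - 2 * (x : ℂ))) / z)

/-- The set `Ω = {z | -π/2 < arg z ≤ π/2} ∪ {0}`. -/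
def Omega : Set ℂ := {z | -(Real.pi / 2) < z.arg ∧ z.arg ≤ Real.pi / 2} ∪ {0}

/-- `a 0, a 1, …` lists exactly the zeros in `Ω` of the even entire function `F`: a zero
`z ≠ 0` is repeated according to its multiplicity, the zero `z = 0` of order `2m` is repeated
`m` times, and the list is ordered by increasing real and then, if equal, imaginary parts. -/
structure IsZeroList (F : ℂ → ℂ) (a : ℕ → ℂ) : Prop where
  mem : ∀ n, a n ∈ Omega
  mult : ∀ z ∈ Omega, z ≠ 0 → analyticOrderAt F z = {n | a n = z}.encard
  mult_zero : analyticOrderAt F 0 = 2 * {n | a n = 0}.encard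
  ordered : ∀ n, (a n).re < (a (n + 1)).re ∨
    ((a n).re = (a (n + 1)).re ∧ (a n).im ≤ (a (n + 1)).im)

/-- For `n ≥ 1`, `ξ (2n-1)` is the `n`-th zero of `F_c` and `ξ (2n)` the `n`-th zero of `F_s`
(the value `ξ 0` plays no role). -/
def IsZeroNumbering (f : ℝ → ℂ) (ξ : ℕ → ℂ) : Prop :=
  IsZeroList (Fc f) (fun n => ξ (2 * n + 1)) ∧ IsZeroList (Fs f) (fun n => ξ (2 * n + 2))

end SobolevZeros

end

/-!
The idea. Write `ξ n = π n / 2 + t`. The addition formulas turn both `F_c(ξ n) = 0` and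
`F_s(ξ n) = 0` into one equation for the displacement `t`,
`sin t = ∫₀¹ f(x) sin(π n x - t (1 - 2x)) dx` (`IsZeroNumbering.sin_eq`). Expanding it to second
order in `t`, and using `t → 0`, gives `t = s_n(f) - s_n(f) c_n(V f) + r_n` with a remainder `r_n`
that is cubic in the coefficients `s_n(f)`, `c_n(V f)`, `s_n(V² f)`
(`IsZeroNumbering.exists_remainder_le`). It remains to see that a sequence of this size is the
sequence of the sine coefficients of a function of class `W^γ_2`.

* *Direct estimate* (`MemW.exists_expCoeff_bound`, `Decays`). No boundary condition is imposed on
  `f`, so `s_n(f)` is in general not square summable with the weight `n^{2α}`; its square is the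
  sum of a term summable with this weight and of a term `O(n^{-(1+α)})` produced by the end points.
  For `α < 1` this follows from Parseval's identity for the increments `f(x + h) - f(x)`, where `h`
  runs over `(1/(2n), 1/n)`, and from a bound for the means of `f` over the intervals `(0, h)` and
  `(1 - h, 1)`; for `α = 1` it is an integration by parts. Cubes of such sequences are square
  summable with the weight `n^{2γ}` because `γ ≤ 3α` and `γ ≤ 1 + α`
  (`Decays.summable_pow_six`), and products of two with the weight `n^{2α}`
  (`Decays.summable_pow_four`).
* *Inverse estimate* (`exists_memW_sinCoeff_eq`). A sequence that is square summable with the weight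
  `n^{2s}`, `0 < s ≤ 2`, is the sequence of the sine coefficients of a function of class `W^s_2`:
  the restriction of an odd periodic function if `s < 1`, the first or second primitive of such an
  even or odd function if `s ≥ 1`.

The existence of the numbering, and `t → 0`, come from counting zeros. On the circles of radius
`π k`, respectively `π k + π / 2`, about the origin, the integral in the definition of each entire
function is negligible by a Riemann–Lebesgue lemma with the weight `e^{|Im z|}`
(`exists_norm_integral_exp_le`), so Rouché's theorem (`zeroCount_eq_of_norm_sub_lt`) gives the number
of zeros inside, and the same argument on small circles locates one zero near each large zero of the
sine or cosine. For an even function half of the zeros lie in `Ω`; `ZeroProfile` records the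
resulting distribution, and `ZeroProfile.exists_enum` and `ZeroProfile.tendsto_enum` derive the
ordered list and its asymptotics.
-/

noncomputable section

namespace SobolevZeros

section

open Metric Filter Topology

/-! ### Counting zeros of entire functions -/

/-- The number of zeros of `F` in the disc `|z - c| < R`, counted with multiplicity (a finite sum
whenever `F` is entire and not identically zero). -/
def zeroCount (F : ℂ → ℂ) (c : ℂ) (R : ℝ) : ℕ :=
  ∑ᶠ z ∈ ball c R, analyticOrderNatAt F z

lemma finite_zeros_ball {F : ℂ → ℂ} (hF : Differentiable ℂ F) (h0 : F ≠ 0) (c : ℂ) (R : ℝ) :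
    (ball c R ∩ {z | F z = 0}).Finite := by
  obtain ⟨x, hx⟩ := Function.ne_iff.mp h0
  have hA : AnalyticOnNhd ℂ F Set.univ := fun z _ => hF.analyticAt z
  have h1 := hA.preimage_zero_mem_codiscrete hx
  have h2 := (isCompact_closedBall c R).finite_sdiff_of_mem_codiscreteWithin
    (codiscreteWithin_mono (subset_univ _) h1)
  refine h2.subset ?_
  rintro z ⟨hz, hz0⟩
  exact ⟨ball_subset_closedBall hz, by simpa using hz0⟩

lemma order_ne_top {F : ℂ → ℂ} (hF : Differentiable ℂ F) (h0 : F ≠ 0) (z : ℂ) :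
    analyticOrderAt F z ≠ ⊤ := by
  rw [Ne, AnalyticOnNhd.analyticOrderAt_eq_top_iff_eq_zero z (fun w => hF.analyticAt w)]
  exact h0

lemma orderNat_ne_zero_iff {F : ℂ → ℂ} (hF : Differentiable ℂ F) (h0 : F ≠ 0) (z : ℂ) :
    analyticOrderNatAt F z ≠ 0 ↔ F z = 0 := by
  rw [← (hF.analyticAt z).analyticOrderAt_ne_zero, ← Nat.cast_analyticOrderNatAt
    (order_ne_top hF h0 z)]
  simp

lemma finite_support_order {F : ℂ → ℂ} (hF : Differentiable ℂ F) (h0 : F ≠ 0) (c : ℂ) (R : ℝ) :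
    (ball c R ∩ Function.support (analyticOrderNatAt F)).Finite := by
  refine (finite_zeros_ball hF h0 c R).subset ?_
  rintro z ⟨hz, hz0⟩
  exact ⟨hz, (orderNat_ne_zero_iff hF h0 z).1 hz0⟩

lemma zeroCount_mul {F G : ℂ → ℂ} (hF : Differentiable ℂ F) (hG : Differentiable ℂ G)
    (hF0 : F ≠ 0) (hG0 : G ≠ 0) (c : ℂ) (R : ℝ) :
    zeroCount (F * G) c R = zeroCount F c R + zeroCount G c R := by
  unfold zeroCount
  rw [← finsum_mem_add_distrib' (finite_support_order hF hF0 c R) (finite_support_order hG hG0 c R)]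
  refine finsum_mem_congr rfl fun z _ => ?_
  exact analyticOrderNatAt_mul (hF.analyticAt z) (hG.analyticAt z) (order_ne_top hF hF0 z)
    (order_ne_top hG hG0 z)

/-- If all zeros of `F` in the disc are simple, then `zeroCount` is their number. -/
lemma zeroCount_eq_ncard {F : ℂ → ℂ} (hF : Differentiable ℂ F)
    (h1 : ∀ z, F z = 0 → deriv F z ≠ 0) (c : ℂ) (R : ℝ) :
    zeroCount F c R = (ball c R ∩ {z | F z = 0}).ncard := by
  have h0 : F ≠ 0 := by
    rintro rfl
    exact h1 0 rfl (by simp)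
  unfold zeroCount
  have hfin := finite_zeros_ball hF h0 c R
  have h2 : ∑ᶠ z ∈ ball c R, analyticOrderNatAt F z
      = ∑ᶠ z ∈ (ball c R ∩ {z | F z = 0}), 1 := by
    rw [← finsum_mem_inter_support]
    refine finsum_mem_congr ?_ ?_
    · ext z
      simp only [mem_inter_iff, Function.mem_support, mem_ofPred_eq,
        orderNat_ne_zero_iff hF h0]
    · rintro z ⟨_, hz⟩
      rw [analyticOrderNatAt,
        (hF.analyticAt z).analyticOrderAt_eq_one_of_zero_deriv_ne_zero hz (h1 z hz)]
      rfl
  rw [h2, finsum_mem_eq_finite_toFinset_sum _ hfin, Set.ncard_eq_toFinset_card _ hfin]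
  simp

lemma zeroCount_sub_const {c w : ℂ} {R : ℝ} (hw : w ∈ ball c R) :
    zeroCount (fun z => z - w) c R = 1 := by
  rw [zeroCount_eq_ncard (by fun_prop) (by intro z _; simp), Set.ncard_eq_one]
  refine ⟨w, ?_⟩
  ext z
  simp only [mem_inter_iff, mem_ofPred_eq, mem_singleton_iff, sub_eq_zero]
  constructor
  · exact fun h => h.2
  · rintro rfl; exact ⟨hw, rfl⟩

/-- The argument principle on discs, for entire functions. -/
theorem circleIntegral_logDeriv {c : ℂ} {R : ℝ} (hR : 0 < R) (n : ℕ) : ∀ F : ℂ → ℂ,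
    Differentiable ℂ F → (∀ z ∈ sphere c R, F z ≠ 0) → zeroCount F c R = n →
    (∮ z in C(c, R), logDeriv F z) = 2 * Real.pi * Complex.I * n := by
  have hnz : ∀ F : ℂ → ℂ, (∀ z ∈ sphere c R, F z ≠ 0) → F ≠ 0 := by
    rintro F h rfl
    obtain ⟨x, hx⟩ : (sphere c R).Nonempty := (NormedSpace.sphere_nonempty).2 hR.le
    exact h x hx rfl
  induction n with
  | zero =>
    intro F hF hs hc
    have h0 := hnz F hs
    have hfin := finite_support_order hF h0 c R
    have hne : ∀ z ∈ closedBall c R, F z ≠ 0 := by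
      intro z hz
      rcases (mem_closedBall.1 hz).lt_or_eq with h | h
      · intro hz0
        have h1 : analyticOrderNatAt F z ≤ zeroCount F c R := by
          unfold zeroCount
          rw [← finsum_mem_inter_support, finsum_mem_eq_finite_toFinset_sum _ hfin]
          refine Finset.single_le_sum (f := analyticOrderNatAt F) (fun _ _ => Nat.zero_le _) ?_
          rw [Set.Finite.mem_toFinset]
          exact ⟨h, (orderNat_ne_zero_iff hF h0 z).2 hz0⟩
        exact (orderNat_ne_zero_iff hF h0 z).2 hz0 (by omega)
      · exact hs z h
    have hd : ∀ z ∈ closedBall c R, DifferentiableAt ℂ (logDeriv F) z := by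
      intro z hz
      exact ((hF.deriv z).div (hF z) (hne z hz))
    rw [Complex.circleIntegral_eq_zero_of_differentiable_on_off_countable hR.le countable_empty
      (fun z hz => (hd z hz).continuousAt.continuousWithinAt)
      (fun z hz => hd z (ball_subset_closedBall hz.1))]
    simp
  | succ n ih =>
    intro F hF hs hc
    have h0 := hnz F hs
    obtain ⟨w, hw, hw0⟩ : ∃ w ∈ ball c R, analyticOrderNatAt F w ≠ 0 := by
      by_contra! hcon
      have : zeroCount F c R = 0 := finsum_mem_eq_zero_of_forall_eq_zero hcon
      omega
    have hFw : F w = 0 := (orderNat_ne_zero_iff hF h0 w).1 hw0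
    have hG : Differentiable ℂ (dslope F w) := by
      rw [← differentiableOn_univ, Complex.differentiableOn_dslope univ_mem]
      exact hF.differentiableOn
    have hFG : F = (fun z => z - w) * dslope F w := by
      funext z
      have := sub_smul_dslope_of_zero hFw z
      simpa using this.symm
    have hGs : ∀ z ∈ sphere c R, dslope F w z ≠ 0 := by
      intro z hz h
      apply hs z hz
      rw [hFG]; simp [h]
    have hws : ∀ z ∈ sphere c R, z - w ≠ 0 := by
      intro z hz h
      rw [sub_eq_zero] at h
      subst h
      rw [mem_ball] at hw
      rw [mem_sphere] at hz
      exact absurd hz hw.ne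
    have hcG : zeroCount (dslope F w) c R = n := by
      have := zeroCount_mul (F := fun z => z - w) (G := dslope F w) (by fun_prop) hG
        (hnz _ hws) (hnz _ hGs) c R
      rw [← hFG, hc, zeroCount_sub_const hw] at this
      omega
    have hI := ih _ hG hGs hcG
    have hcongr : ∀ z ∈ sphere c R, logDeriv F z = (z - w)⁻¹ + logDeriv (dslope F w) z := by
      intro z hz
      conv_lhs => rw [hFG]
      have := logDeriv_mul (f := fun z => z - w) (g := dslope F w) z (hws z hz) (hGs z hz)
        (by fun_prop) (hG z)
      refine this.trans ?_
      simp [logDeriv]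
    rw [circleIntegral.integral_congr hR.le hcongr, circleIntegral.integral_add, hI,
      circleIntegral.integral_sub_inv_of_mem_ball hw]
    · push_cast; ring
    · refine ContinuousOn.circleIntegrable hR.le ?_
      exact ContinuousOn.inv₀ (by fun_prop) hws
    · refine ContinuousOn.circleIntegrable hR.le ?_
      intro z hz
      exact ((hG.deriv z).div (hG z) (hGs z hz)).continuousAt.continuousWithinAt

/-- Rouché's theorem on discs, for entire functions: on the circle `F / G` takes values in the disc
`|w - 1| < 1`, where the logarithm is holomorphic, so `F'/F - G'/G` has a primitive there. -/
theorem zeroCount_eq_of_norm_sub_lt {F G : ℂ → ℂ} (hF : Differentiable ℂ F)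
    (hG : Differentiable ℂ G) {c : ℂ} {R : ℝ} (hR : 0 < R)
    (h : ∀ z ∈ sphere c R, ‖F z - G z‖ < ‖G z‖) : zeroCount F c R = zeroCount G c R := by
  have hGs : ∀ z ∈ sphere c R, G z ≠ 0 := by
    intro z hz h0
    have := h z hz
    rw [h0, norm_zero] at this
    exact absurd this (not_lt.2 (norm_nonneg _))
  have hFs : ∀ z ∈ sphere c R, F z ≠ 0 := by
    intro z hz h0
    have := h z hz
    rw [h0, zero_sub, norm_neg] at this
    exact lt_irrefl _ this
  have hslit : ∀ z ∈ sphere c R, F z / G z ∈ Complex.slitPlane := by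
    intro z hz
    have h1 : ‖F z / G z - 1‖ < 1 := by
      rw [div_sub_one (hGs z hz), norm_div, div_lt_one (norm_pos_iff.2 (hGs z hz))]
      exact h z hz
    simpa using Complex.mem_slitPlane_of_norm_lt_one h1
  have hint : (∮ z in C(c, R), (logDeriv F z - logDeriv G z)) = 0 := by
    refine circleIntegral.integral_eq_zero_of_hasDerivWithinAt
      (f := fun z => Complex.log (F z / G z)) hR.le ?_
    intro z hz
    have h1 := (((hF z).hasDerivAt.div (hG z).hasDerivAt (hGs z hz)).clog (hslit z hz))
    refine h1.hasDerivWithinAt.congr_deriv ?_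
    have := hFs z hz
    have := hGs z hz
    simp only [logDeriv_apply, Pi.div_apply]
    field_simp
  have hcF : CircleIntegrable (logDeriv F) c R := by
    refine ContinuousOn.circleIntegrable hR.le fun z hz => ?_
    exact ((hF.deriv z).div (hF z) (hFs z hz)).continuousAt.continuousWithinAt
  have hcG : CircleIntegrable (logDeriv G) c R := by
    refine ContinuousOn.circleIntegrable hR.le fun z hz => ?_
    exact ((hG.deriv z).div (hG z) (hGs z hz)).continuousAt.continuousWithinAt
  rw [circleIntegral.integral_sub hcF hcG, circleIntegral_logDeriv hR _ F hF hFs rfl,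
    circleIntegral_logDeriv hR _ G hG hGs rfl, sub_eq_zero] at hint
  have h2 : (2 * Real.pi * Complex.I : ℂ) ≠ 0 := by simp [Real.pi_ne_zero]
  exact_mod_cast mul_left_cancel₀ h2 hint

end

section

open Metric Filter Topology

/-! ### Ordered lists of zeros -/

/-- A multiplicity function `m` on `ℂ`, supported in `Ω`, whose mass is arranged like the points
`b + π k + π / 2`: for large `k` the disc of radius `b + π k` carries mass exactly `k`, and there
are points of the support arbitrarily close to `b + π k + π / 2` as `k → ∞`. -/
structure ZeroProfile (m : ℂ → ℕ) (b : ℝ) : Prop where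
  nonneg : 0 ≤ b
  fin : ∀ R : ℝ, (ball (0 : ℂ) R ∩ Function.support m).Finite
  supp : ∀ z, m z ≠ 0 → z ∈ Omega
  count : ∃ K : ℕ, ∀ k ≥ K, ∑ᶠ z ∈ ball (0 : ℂ) (b + Real.pi * k), m z = k
  near : ∀ ε > 0, ∃ K : ℕ, ∀ k ≥ K,
    ∃ z ∈ ball (((b + Real.pi * k + Real.pi / 2 : ℝ)) : ℂ) ε, m z ≠ 0

/-- `a` enumerates the points of `Ω` with multiplicities `m`, in lexicographic order. -/
structure IsEnum (m : ℂ → ℕ) (a : ℕ → ℂ) : Prop where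
  mem : ∀ n, a n ∈ Omega
  mult : ∀ z ∈ Omega, {n | a n = z}.encard = m z
  ordered : ∀ n, (a n).re < (a (n + 1)).re ∨
    ((a n).re = (a (n + 1)).re ∧ (a n).im ≤ (a (n + 1)).im)

/-- The alternative `c < 0` spares the applications, where `0 ≤ c`, a separate hypothesis. -/
lemma mem_ball_re_bounds {z : ℂ} {c ε : ℝ} (hz : z ∈ ball (c : ℂ) ε) :
    c - ε < z.re ∧ ‖z‖ < c + ε ∨ c < 0 := by
  by_cases hc : c < 0
  · exact Or.inr hc
  left
  rw [mem_ball, dist_eq_norm] at hz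
  have h1 : |(z - c).re| ≤ ‖z - c‖ := Complex.abs_re_le_norm _
  have h2 : ‖z‖ ≤ ‖z - c‖ + ‖(c : ℂ)‖ := by
    simpa using norm_add_le (z - c) (c : ℂ)
  rw [Complex.norm_real, Real.norm_eq_abs, abs_of_nonneg (not_lt.1 hc)] at h2
  rw [Complex.sub_re, Complex.ofReal_re] at h1
  have := (abs_le.1 h1).1
  exact ⟨by linarith, by linarith⟩

namespace ZeroProfile

variable {m : ℂ → ℕ} {b : ℝ}

/-- In each far annulus `b + π k ≤ |z| < b + π (k + 1)` the support of `m` is a single point of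
multiplicity one, close to `b + π k + π / 2`. -/
lemma exists_tail (h : ZeroProfile m b) {ε : ℝ} (hε : 0 < ε) (hε2 : ε ≤ 1) :
    ∃ (K : ℕ) (z : ℕ → ℂ), (∀ k ≥ K, ∑ᶠ w ∈ ball (0 : ℂ) (b + Real.pi * k), m w = k) ∧
      ∀ k ≥ K, m (z k) = 1 ∧ b + Real.pi * k < (z k).re ∧ b + Real.pi * k ≤ ‖z k‖ ∧
      ‖z k‖ < b + Real.pi * (k + 1) ∧ ‖z k - (b + Real.pi * k + Real.pi / 2 : ℝ)‖ < ε ∧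
      ∀ w, m w ≠ 0 → b + Real.pi * k ≤ ‖w‖ → ‖w‖ < b + Real.pi * (k + 1) → w = z k := by
  classical
  obtain ⟨K1, hK1⟩ := h.count
  obtain ⟨K2, hK2⟩ := h.near ε hε
  choose! z hz using hK2
  refine ⟨max K1 K2, z, fun k hk => hK1 k (le_trans (le_max_left _ _) hk), fun k hk => ?_⟩
  obtain ⟨hz1, hz2⟩ := hz k (le_trans (le_max_right _ _) hk)
  have hc1 := hK1 k (le_trans (le_max_left _ _) hk)
  have hc2 := hK1 (k + 1) (by have := le_trans (le_max_left K1 K2) hk; omega)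
  have hpi := Real.pi_gt_three
  have hb := h.nonneg
  have hk0 : (0 : ℝ) ≤ Real.pi * k := by positivity
  have hre : b + Real.pi * k < (z k).re ∧ ‖z k‖ < b + Real.pi * (k + 1) := by
    rcases mem_ball_re_bounds hz1 with h1 | h1
    · exact ⟨by linarith [h1.1], by linarith [h1.2]⟩
    · linarith
  have hnorm : b + Real.pi * k ≤ ‖z k‖ := hre.1.le.trans (Complex.re_le_norm _)
  -- the mass of the annulus is one
  rw [← finsum_mem_inter_support, finsum_mem_eq_finite_toFinset_sum _ (h.fin _)] at hc1 hc2
  have hsub : (h.fin (b + Real.pi * k)).toFinset ⊆ (h.fin (b + Real.pi * (k + 1 : ℕ))).toFinset := by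
    intro w hw
    simp only [Set.Finite.mem_toFinset, mem_inter_iff, mem_ball_zero_iff] at hw ⊢
    refine ⟨hw.1.trans ?_, hw.2⟩
    push_cast; nlinarith
  have hsd := Finset.sum_sdiff (f := m) hsub
  rw [hc1, hc2] at hsd
  have hmem : ∀ w, m w ≠ 0 → b + Real.pi * k ≤ ‖w‖ → ‖w‖ < b + Real.pi * (k + 1) →
      w ∈ (h.fin (b + Real.pi * (k + 1 : ℕ))).toFinset \ (h.fin (b + Real.pi * k)).toFinset := by
    intro w h1 h2 h3
    simp only [Finset.mem_sdiff, Set.Finite.mem_toFinset, mem_inter_iff, mem_ball_zero_iff,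
      Function.mem_support]
    refine ⟨⟨by push_cast; exact h3, h1⟩, fun h4 => absurd h4.1 (not_lt.2 h2)⟩
  have hzm := hmem (z k) hz2 hnorm hre.2
  have hle := Finset.single_le_sum (f := m) (fun _ _ => Nat.zero_le _) hzm
  refine ⟨by omega, hre.1, hnorm, hre.2, by simpa [dist_eq_norm] using hz1, ?_⟩
  intro w h1 h2 h3
  by_contra hne
  have h4 := Finset.sum_le_sum_of_subset (f := m)
    (Finset.insert_subset (hmem w h1 h2 h3) (Finset.singleton_subset_iff.2 hzm))
  rw [Finset.sum_pair hne] at h4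
  omega

lemma exists_annulus {K : ℕ} {r : ℝ} (hr : b + Real.pi * K ≤ r) :
    ∃ k ≥ K, b + Real.pi * k ≤ r ∧ r < b + Real.pi * (k + 1) := by
  have hpi := Real.pi_pos
  have h0 : 0 ≤ (r - b) / Real.pi := by
    apply div_nonneg _ hpi.le
    have : 0 ≤ Real.pi * K := by positivity
    linarith
  refine ⟨⌊(r - b) / Real.pi⌋₊, ?_, ?_, ?_⟩
  · apply Nat.le_floor
    rw [le_div_iff₀ hpi]; linarith
  · have := Nat.floor_le h0
    rw [le_div_iff₀ hpi] at this
    linarith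
  · have := Nat.lt_floor_add_one ((r - b) / Real.pi)
    rw [div_lt_iff₀ hpi] at this
    linarith

lemma monotone_re {a : ℕ → ℂ} (ha : IsEnum m a) : Monotone fun n => (a n).re := by
  refine monotone_nat_of_le_succ fun n => ?_
  rcases ha.ordered n with h | h
  · exact h.le
  · exact h.1.le

lemma mult_ne_zero {a : ℕ → ℂ} (ha : IsEnum m a) (n : ℕ) : m (a n) ≠ 0 := by
  intro h0
  have h1 := ha.mult _ (ha.mem n)
  rw [h0, Nat.cast_zero, encard_eq_zero] at h1
  have : n ∈ {i | a i = a n} := rfl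
  rw [h1] at this
  exact this

/-- The number of terms of an enumeration in a disc is the mass of the disc. -/
lemma encard_ball {a : ℕ → ℂ} (h : ZeroProfile m b) (ha : IsEnum m a) (R : ℝ) :
    {n | a n ∈ ball (0 : ℂ) R}.encard = (∑ᶠ w ∈ ball (0 : ℂ) R, m w : ℕ) := by
  classical
  rw [← finsum_mem_inter_support, finsum_mem_eq_finite_toFinset_sum _ (h.fin _)]
  have hU : {n | a n ∈ ball (0 : ℂ) R} = ⋃ w ∈ (h.fin R).toFinset, {n | a n = w} := by
    ext n
    simp only [mem_ofPred_eq, mem_iUnion, Set.Finite.mem_toFinset, mem_inter_iff,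
      Function.mem_support, exists_prop]
    constructor
    · exact fun hn => ⟨a n, ⟨hn, mult_ne_zero ha n⟩, rfl⟩
    · rintro ⟨w, ⟨hw, _⟩, rfl⟩; exact hw
  have hom : ∀ w ∈ (h.fin R).toFinset, {n | a n = w}.encard = m w := by
    intro w hw
    rw [Set.Finite.mem_toFinset] at hw
    exact ha.mult w (h.supp w hw.2)
  have hf : ∀ w ∈ (h.fin R).toFinset, {n | a n = w}.Finite := by
    intro w hw
    rw [← encard_lt_top_iff, hom w hw]
    exact ENat.natCast_lt_top _
  have hfin : {n | a n ∈ ball (0 : ℂ) R}.Finite := by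
    rw [hU]
    exact Set.Finite.biUnion (Finset.finite_toSet _) hf
  rw [hfin.encard_eq_coe_toFinset_card,
    Finset.card_eq_sum_card_fiberwise (f := a) (t := (h.fin R).toFinset)]
  · congr 1
    refine Finset.sum_congr rfl fun w hw => ?_
    have h1 := hom w hw
    rw [(hf w hw).encard_eq_coe_toFinset_card] at h1
    rw [← Nat.cast_inj (R := ℕ∞), ← h1]
    congr 2
    ext n
    simp only [Finset.mem_filter, Set.Finite.mem_toFinset, mem_ofPred_eq, and_iff_right_iff_imp]
    rintro rfl
    exact ((Set.Finite.mem_toFinset _).1 hw).1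
  · intro n hn
    simp only [Finset.mem_coe, Set.Finite.mem_toFinset, mem_ofPred_eq, mem_inter_iff] at hn ⊢
    exact ⟨hn, mult_ne_zero ha n⟩

/-- The terms of every enumeration are asymptotic to `b + π k + π / 2`. -/
theorem tendsto_enum (h : ZeroProfile m b) {a : ℕ → ℂ} (ha : IsEnum m a) :
    Tendsto (fun k : ℕ => a k - (b + Real.pi * k + Real.pi / 2 : ℝ)) atTop (𝓝 0) := by
  rw [Metric.tendsto_atTop]
  intro ε hε
  obtain ⟨K, z, hK, hz⟩ := h.exists_tail (ε := min ε 1) (by positivity) (min_le_right _ _)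
  have hpi := Real.pi_pos
  have key : ∀ k ≥ K, ∀ n, a n ∈ ball (0 : ℂ) (b + Real.pi * k) ↔ n < k := by
    intro k hk
    have hlow : ∀ n i, i ≤ n → a n ∈ ball (0 : ℂ) (b + Real.pi * k) →
        a i ∈ ball (0 : ℂ) (b + Real.pi * k) := by
      intro n i hin hn
      by_contra hi
      rw [mem_ball_zero_iff] at hn hi
      obtain ⟨j, hj, h1, h2⟩ := exists_annulus (not_lt.1 hi)
      have hj' := hz j (hk.trans hj)
      have := hj'.2.2.2.2.2 (a i) (mult_ne_zero ha i) h1 h2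
      have h3 : (a i).re ≤ (a n).re := monotone_re ha hin
      have h4 := Complex.re_le_norm (a n)
      have h5 := hj'.2.1
      rw [this] at h3
      have h6 : (k : ℝ) ≤ j := by exact_mod_cast hj
      nlinarith
    have hc := encard_ball h ha (b + Real.pi * k)
    rw [hK k hk] at hc
    -- an initial segment of `ℕ` with `k` elements is `{0, …, k - 1}`
    intro n
    constructor
    · intro hn
      have h1 : ((Finset.range (n + 1) : Finset ℕ) : Set ℕ) ⊆
          {n | a n ∈ ball (0 : ℂ) (b + Real.pi * k)} := by
        intro i hi
        exact hlow n i (by simpa [Nat.lt_succ_iff] using hi) hn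
      have h2 := encard_le_encard h1
      rw [hc, encard_coe_eq_coe_finsetCard, Finset.card_range] at h2
      have h3 : n + 1 ≤ k := by exact_mod_cast h2
      omega
    · intro hn
      by_contra hcon
      have h1 : {n | a n ∈ ball (0 : ℂ) (b + Real.pi * k)} ⊆
          ((Finset.range n : Finset ℕ) : Set ℕ) := by
        intro i hi
        by_contra hi2
        exact hcon (hlow i n (by simpa using hi2) hi)
      have h2 := encard_le_encard h1
      rw [hc, encard_coe_eq_coe_finsetCard, Finset.card_range] at h2
      have h3 : k ≤ n := by exact_mod_cast h2
      omega
  refine ⟨K, fun k hk => ?_⟩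
  have h1 : ¬ (a k ∈ ball (0 : ℂ) (b + Real.pi * k)) := by
    rw [key k hk k]; omega
  have h2 : a k ∈ ball (0 : ℂ) (b + Real.pi * (k + 1 : ℕ)) := by
    rw [key (k + 1) (by omega) k]; omega
  rw [mem_ball_zero_iff] at h1 h2
  push_cast at h2
  have h3 := (hz k hk).2.2.2.2.2 (a k) (mult_ne_zero ha k) (not_lt.1 h1) h2
  rw [h3, dist_zero_right]
  exact (hz k hk).2.2.2.2.1.trans_le (min_le_left _ _)

/-- Every finitely supported multiplicity function has a lexicographically ordered enumeration. -/
lemma exists_sorted (s : Finset ℂ) (m : ℂ → ℕ) {K : ℕ} (hK : ∑ w ∈ s, m w = K) :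
    ∃ a : Fin K → ℂ,
    (∀ i j, i < j → (a i).re < (a j).re ∨ ((a i).re = (a j).re ∧ (a i).im ≤ (a j).im)) ∧
    (∀ i, a i ∈ s) ∧ ∀ w ∈ s, {i | a i = w}.encard = m w := by
  classical
  subst hK
  let e : ℂ ≃ Lex (ℝ × ℝ) := Complex.equivRealProd.trans toLex
  let M : Multiset (Lex (ℝ × ℝ)) := ∑ w ∈ s, Multiset.replicate (m w) (e w)
  let l := M.sort (· ≤ ·)
  have hl : (l : Multiset _) = M := Multiset.sort_eq _ _
  have hlen : l.length = ∑ w ∈ s, m w := by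
    rw [← Multiset.coe_card, hl]
    simp [M, Multiset.card_sum]
  have hsort : l.Pairwise (· ≤ ·) := Multiset.pairwise_sort _ _
  refine ⟨fun i => e.symm (l.get (Fin.cast hlen.symm i)), ?_, ?_, ?_⟩
  · intro i j hij
    have := List.pairwise_iff_get.1 hsort (Fin.cast hlen.symm i) (Fin.cast hlen.symm j)
      (by simpa using hij)
    rw [Prod.Lex.le_iff] at this
    exact this
  · intro i
    have h1 : l.get (Fin.cast hlen.symm i) ∈ M := by
      rw [← hl, Multiset.mem_coe]
      exact List.get_mem _ _
    simp only [M, Multiset.mem_sum, Multiset.mem_replicate] at h1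
    obtain ⟨w, hw, _, h2⟩ := h1
    have h3 : e.symm (l.get (Fin.cast hlen.symm i)) = w := by rw [h2, Equiv.symm_apply_apply]
    change e.symm (l.get (Fin.cast hlen.symm i)) ∈ s
    rwa [h3]
  · intro w hw
    have h1 : M.count (e w) = m w := by
      simp only [M, Multiset.count_sum', Multiset.count_replicate, e.injective.eq_iff]
      rw [Finset.sum_eq_single_of_mem w hw]
      · simp
      · intro x _ hx; simp [hx]
    have h2 : {i : Fin (∑ w ∈ s, m w) | e.symm (l.get (Fin.cast hlen.symm i)) = w}
        = ((Finset.univ.filter fun i => e w = l.get (Fin.cast hlen.symm i) : Finset _) : Set _) := by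
      ext i
      simp only [mem_ofPred_eq, Finset.coe_filter, Finset.mem_univ, true_and, Equiv.symm_apply_eq]
      exact eq_comm
    rw [h2, encard_coe_eq_coe_finsetCard, Nat.cast_inj, ← h1, ← hl]
    have h3 : (l : Multiset _) = Multiset.map (fun i : Fin (∑ w ∈ s, m w) =>
        l.get (Fin.cast hlen.symm i)) Finset.univ.val := by
      rw [Fin.univ_val_map]
      congr 1
      refine List.ext_get (by simp [hlen]) ?_
      intro n h1 h2
      simp
    conv_rhs => rw [h3, Multiset.count_map]
    rfl

/-- The finitely many points inside a large disc are sorted; beyond it there is one point in each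
annulus, with increasing real parts. -/
theorem exists_enum (h : ZeroProfile m b) : ∃ a, IsEnum m a := by
  classical
  obtain ⟨K, z, hK, hz⟩ := h.exists_tail (ε := 1) one_pos le_rfl
  have hKK := hK K le_rfl
  rw [← finsum_mem_inter_support, finsum_mem_eq_finite_toFinset_sum _ (h.fin _)] at hKK
  obtain ⟨p, hp1, hp2, hp3⟩ := exists_sorted (h.fin (b + Real.pi * K)).toFinset m hKK
  have hp2' : ∀ i, ‖p i‖ < b + Real.pi * K ∧ m (p i) ≠ 0 := by
    intro i
    have := (Set.Finite.mem_toFinset _).1 (hp2 i)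
    exact ⟨by simpa using this.1, this.2⟩
  have hpi := Real.pi_pos
  let a : ℕ → ℂ := fun n => if hn : n < K then p ⟨n, hn⟩ else z n
  have ha1 : ∀ (n : ℕ) (hn : n < K), a n = p ⟨n, hn⟩ := fun n hn => dif_pos hn
  have ha2 : ∀ n : ℕ, K ≤ n → a n = z n := fun n hn => dif_neg (not_lt.2 hn)
  refine ⟨a, ?_, ?_, ?_⟩
  · intro n
    rcases lt_or_ge n K with hn | hn
    · rw [ha1 n hn]; exact h.supp _ (hp2' _).2
    · rw [ha2 n hn]; exact h.supp _ (by rw [(hz n hn).1]; exact one_ne_zero)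
  · intro w _
    by_cases hw0 : m w = 0
    · rw [hw0, Nat.cast_zero, encard_eq_zero, eq_empty_iff_forall_notMem]
      intro n hn
      rw [mem_ofPred_eq] at hn
      rcases lt_or_ge n K with hnK | hnK
      · rw [ha1 n hnK] at hn
        exact (hp2' ⟨n, hnK⟩).2 (hn ▸ hw0)
      · rw [ha2 n hnK] at hn
        have := (hz n hnK).1
        rw [hn, hw0] at this
        exact zero_ne_one this
    rcases lt_or_ge ‖w‖ (b + Real.pi * K) with hw | hw
    · have hws : w ∈ (h.fin (b + Real.pi * K)).toFinset := by
        rw [Set.Finite.mem_toFinset]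
        exact ⟨by simpa using hw, hw0⟩
      rw [← hp3 w hws, ← Fin.val_injective.encard_image]
      congr 1
      ext n
      simp only [mem_ofPred_eq, mem_image]
      constructor
      · intro hn
        rcases lt_or_ge n K with hnK | hnK
        · exact ⟨⟨n, hnK⟩, by rw [← ha1 n hnK, hn], rfl⟩
        · exfalso
          rw [ha2 n hnK] at hn
          have h1 := (hz n hnK).2.2.1
          rw [hn] at h1
          have : (K : ℝ) ≤ n := by exact_mod_cast hnK
          nlinarith
      · rintro ⟨i, hi, rfl⟩
        rw [ha1 _ i.2]; exact hi
    · obtain ⟨k, hk, h1, h2⟩ := exists_annulus hw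
      have hwk := (hz k hk).2.2.2.2.2 w hw0 h1 h2
      rw [hwk, (hz k hk).1, Nat.cast_one, encard_eq_one]
      refine ⟨k, ?_⟩
      ext n
      simp only [mem_ofPred_eq, mem_singleton_iff]
      constructor
      · intro hn
        rcases lt_or_ge n K with hnK | hnK
        · exfalso
          rw [ha1 n hnK, ← hwk] at hn
          have := (hp2' ⟨n, hnK⟩).1
          rw [hn] at this
          linarith
        · rw [ha2 n hnK] at hn
          have e1 := (hz n hnK).2.2
          have e2 := (hz k hk).2.2
          rw [hn] at e1
          have f1 : (n : ℝ) < k + 1 := by nlinarith [e1.1, e2.2.1]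
          have f2 : (k : ℝ) < n + 1 := by nlinarith [e2.1, e1.2.1]
          have f3 : n < k + 1 := by exact_mod_cast f1
          have f4 : k < n + 1 := by exact_mod_cast f2
          omega
      · rintro rfl
        exact ha2 n hk
  · intro n
    rcases lt_or_ge (n + 1) K with hn | hn
    · rw [ha1 n (by omega), ha1 (n + 1) hn]
      exact hp1 _ _ (by simp [Fin.lt_def])
    · rw [ha2 (n + 1) hn]
      left
      have h1 := (hz (n + 1) hn).2.1
      push_cast at h1
      rcases lt_or_ge n K with hnK | hnK
      · rw [ha1 n hnK]
        have h2 := (hp2' ⟨n, hnK⟩).1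
        have h3 := Complex.re_le_norm (p ⟨n, hnK⟩)
        have : (K : ℝ) ≤ n + 1 := by exact_mod_cast hn
        nlinarith
      · rw [ha2 n hnK]
        have h2 := (hz n hnK).2.2.2.1
        have h3 := Complex.re_le_norm (z n)
        nlinarith

end ZeroProfile

end

section

open Metric Filter Topology

/-! ### Perturbations of the sine -/

lemma norm_sin_add_int_mul_pi (w : ℂ) (j : ℤ) : ‖Complex.sin (w + j * Real.pi)‖ = ‖Complex.sin w‖ := by
  rw [Complex.sin_add, Complex.sin_int_mul_pi, mul_zero, add_zero, norm_mul]
  have h1 : Complex.cos (j * Real.pi) = ((Real.cos (j * Real.pi) : ℝ) : ℂ) := by push_cast; rfl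
  rw [h1, Complex.norm_real, Real.norm_eq_abs, Real.abs_cos_int_mul_pi, mul_one]

/-- Away from its zeros, `|sin z|` is comparable to `e^{|Im z|}`. -/
lemma exists_le_norm_sin {δ : ℝ} (hδ : 0 < δ) : ∃ c > 0, ∀ z : ℂ,
    (∀ j : ℤ, δ ≤ ‖z - j * Real.pi‖) → c * Real.exp |z.im| ≤ ‖Complex.sin z‖ := by
  have hpi := Real.pi_pos
  refine ⟨min ((1 - Real.exp (-δ)) / 2) (δ / Real.pi * Real.exp (-(δ / 2))), ?_, ?_⟩
  · have : Real.exp (-δ) < 1 := by rw [Real.exp_lt_one_iff]; linarith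
    apply lt_min
    · linarith
    · positivity
  intro z hz
  set j := round (z.re / Real.pi) with hj
  set w := z - j * Real.pi with hw
  have hzw : ‖Complex.sin z‖ = ‖Complex.sin w‖ := by
    rw [← norm_sin_add_int_mul_pi w j, hw, sub_add_cancel]
  have him : z.im = w.im := by simp [hw]
  have hre : |w.re| ≤ Real.pi / 2 := by
    have h1 := abs_sub_round (z.re / Real.pi)
    have h2 : w.re = (z.re / Real.pi - j) * Real.pi := by
      simp only [hw, Complex.sub_re, Complex.mul_re, Complex.intCast_re, Complex.ofReal_re,
        Complex.intCast_im, Complex.ofReal_im]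
      field_simp
      ring
    rw [h2, abs_mul, abs_of_pos hpi]
    nlinarith
  rw [hzw, him]
  have hexp : (0 : ℝ) < Real.exp |w.im| := Real.exp_pos _
  rcases le_or_gt (δ / 2) |w.im| with hv | hv
  · -- far from the real axis one of the two exponentials dominates
    have hn : ∀ u : ℂ, 2 * ‖Complex.sin u‖ ≥ Real.exp u.im - Real.exp (-u.im) := by
      intro u
      have h1 := Complex.two_sin u
      have h2 : ‖Complex.exp (-u * Complex.I) - Complex.exp (u * Complex.I)‖ = 2 * ‖Complex.sin u‖ := by
        have := congrArg norm h1
        rw [norm_mul, norm_mul, Complex.norm_I, mul_one] at this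
        simpa using this.symm
      have h3 := norm_sub_norm_le (Complex.exp (-u * Complex.I)) (Complex.exp (u * Complex.I))
      rw [h2, Complex.norm_exp, Complex.norm_exp] at h3
      simpa using h3
    have h4 : Real.exp |w.im| - Real.exp (-|w.im|) ≤ 2 * ‖Complex.sin w‖ := by
      rcases abs_cases w.im with ⟨h, _⟩ | ⟨h, _⟩
      · rw [h]; exact hn w
      · rw [h]; simpa using hn (-w)
    have h5 : Real.exp (-|w.im|) ≤ Real.exp (-δ) * Real.exp |w.im| := by
      rw [← Real.exp_add]
      exact Real.exp_le_exp.2 (by linarith)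
    calc _ ≤ (1 - Real.exp (-δ)) / 2 * Real.exp |w.im| := by gcongr; exact min_le_left _ _
      _ ≤ _ := by linarith
  · have h1 : δ / 2 ≤ |w.re| := by
      have := hz j
      have h2 := Complex.norm_le_abs_re_add_abs_im w
      linarith
    have h2 := Real.mul_abs_le_abs_sin hre
    have h3 : |Real.sin w.re| ≤ ‖Complex.sin w‖ := by
      refine le_trans ?_ (Complex.abs_re_le_norm _)
      have h4 : (Complex.sin w).re = Real.sin w.re * Real.cosh w.im := by
        conv_lhs => rw [← Complex.re_add_im w, Complex.sin_add_mul_I]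
        rw [← Complex.ofReal_sin, ← Complex.ofReal_cos, ← Complex.ofReal_cosh,
          ← Complex.ofReal_sinh]
        simp only [Complex.add_re, Complex.mul_re, Complex.ofReal_re, Complex.ofReal_im,
          Complex.I_re, Complex.I_im, Complex.mul_im]
        ring
      rw [h4, abs_mul]
      have := Real.one_le_cosh w.im
      rw [abs_of_pos (lt_of_lt_of_le one_pos this)]
      exact le_mul_of_one_le_right (abs_nonneg _) this
    have h5 : Real.exp (-(δ / 2)) * Real.exp |w.im| ≤ 1 := by
      rw [← Real.exp_add, Real.exp_le_one_iff]; linarith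
    calc _ ≤ δ / Real.pi * Real.exp (-(δ / 2)) * Real.exp |w.im| := by
            gcongr; exact min_le_right _ _
      _ = δ / Real.pi * (Real.exp (-(δ / 2)) * Real.exp |w.im|) := by ring
      _ ≤ δ / Real.pi * 1 := by gcongr
      _ = 2 / Real.pi * (δ / 2) := by ring
      _ ≤ 2 / Real.pi * |w.re| := by gcongr
      _ ≤ _ := h2.trans h3

lemma norm_exp_I_mul_le (z : ℂ) {x : ℝ} (hx : x ∈ Icc (0 : ℝ) 1) :
    ‖Complex.exp (Complex.I * (z * (1 - 2 * (x : ℂ))))‖ ≤ Real.exp |z.im| := by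
  rw [Complex.norm_exp]
  apply Real.exp_le_exp.2
  have h1 : (Complex.I * (z * (1 - 2 * (x : ℂ)))).re = -z.im * (1 - 2 * x) := by
    simp [Complex.mul_re, Complex.mul_im]
  rw [h1]
  refine (le_abs_self _).trans ?_
  rw [abs_mul, abs_neg]
  have : |1 - 2 * x| ≤ 1 := by rw [abs_le]; constructor <;> linarith [hx.1, hx.2]
  exact mul_le_of_le_one_right (abs_nonneg _) this

/-- The Riemann–Lebesgue lemma, uniformly in the complex plane. -/
lemma exists_norm_integral_exp_le {f : ℝ → ℂ} (hf : IntervalIntegrable f volume 0 1) {η : ℝ}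
    (hη : 0 < η) : ∃ R : ℝ, ∀ z : ℂ, R ≤ ‖z‖ →
    ‖∫ x in (0 : ℝ)..1, f x * Complex.exp (Complex.I * (z * (1 - 2 * (x : ℂ))))‖
      ≤ η * Real.exp |z.im| := by
  set μ : Measure ℝ := volume.restrict (Ioc (0 : ℝ) 1) with hμ
  have hfi : Integrable f μ := (intervalIntegrable_iff_integrableOn_Ioc_of_le zero_le_one).1 hf
  -- approximate by a Schwartz function in `L¹(0, 1)`
  obtain ⟨g, hg⟩ : ∃ g : SchwartzMap ℝ ℂ, ∫ x in (0 : ℝ)..1, ‖f x - g x‖ ≤ η / 2 := by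
    have hd := SchwartzMap.denseRange_toLpCLM (E := ℝ) (F := ℂ) (p := 1) ENNReal.one_ne_top (μ := μ)
    obtain ⟨g, hg⟩ := hd.exists_dist_lt hfi.toL1 (half_pos hη)
    refine ⟨g, ?_⟩
    rw [L1.dist_eq_integral_dist] at hg
    refine le_of_eq_of_le ?_ hg.le
    rw [intervalIntegral.integral_of_le zero_le_one]
    refine integral_congr_ae ?_
    filter_upwards [hfi.coeFn_toL1, SchwartzMap.coeFn_toLp g 1 μ] with x h1 h2
    rw [h1, dist_eq_norm]
    congr 2
    exact h2.symm
  have hgc : Continuous g := g.continuous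
  have hgd : ∀ x : ℝ, HasDerivAt g (deriv g x) x := fun x => g.differentiableAt.hasDerivAt
  have hgc' : Continuous (deriv g) := (g.smooth 1).continuous_deriv le_rfl
  set C : ℝ := ‖g 0‖ + ‖g 1‖ + ∫ x in (0 : ℝ)..1, ‖deriv g x‖ with hC
  have hC0 : 0 ≤ C := by
    have : 0 ≤ ∫ x in (0 : ℝ)..1, ‖deriv g x‖ :=
      intervalIntegral.integral_nonneg zero_le_one fun _ _ => norm_nonneg _
    positivity
  refine ⟨C / η + 1, fun z hz => ?_⟩
  have hz0 : 0 < ‖z‖ := lt_of_lt_of_le (by positivity) hz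
  have hz1 : z ≠ 0 := norm_pos_iff.1 hz0
  set e : ℝ → ℂ := fun x => Complex.exp (Complex.I * (z * (1 - 2 * (x : ℂ)))) with he
  have hec : Continuous e := by fun_prop
  have hsplit : ∫ x in (0 : ℝ)..1, f x * e x
      = (∫ x in (0 : ℝ)..1, (f x - g x) * e x) + ∫ x in (0 : ℝ)..1, g x * e x := by
    rw [← intervalIntegral.integral_add]
    · congr 1; ext x; ring
    · exact (hf.sub (hgc.intervalIntegrable _ _)).mul_continuousOn hec.continuousOn
    · exact (hgc.mul hec).intervalIntegrable _ _
  have h1 : ‖∫ x in (0 : ℝ)..1, (f x - g x) * e x‖ ≤ η / 2 * Real.exp |z.im| := by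
    calc _ ≤ ∫ x in (0 : ℝ)..1, ‖f x - g x‖ * Real.exp |z.im| := by
            refine intervalIntegral.norm_integral_le_of_norm_le zero_le_one ?_ ?_
            · refine ae_of_all _ fun x hx => ?_
              rw [norm_mul]
              gcongr
              exact norm_exp_I_mul_le z ⟨hx.1.le, hx.2⟩
            · exact (hf.sub (hgc.intervalIntegrable _ _)).norm.mul_const _
      _ = (∫ x in (0 : ℝ)..1, ‖f x - g x‖) * Real.exp |z.im| :=
            intervalIntegral.integral_mul_const _ _
      _ ≤ _ := by gcongr
  have h2 : ‖∫ x in (0 : ℝ)..1, g x * e x‖ ≤ η / 2 * Real.exp |z.im| := by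
    have hI : (-2 * Complex.I * z) ≠ 0 := by simp [hz1]
    set k : ℂ := (-2 * Complex.I * z)⁻¹ with hk
    have hkn : ‖k‖ = (2 * ‖z‖)⁻¹ := by simp [hk]
    have hv : ∀ x ∈ uIcc (0 : ℝ) 1, HasDerivAt (fun y : ℝ => k * e y) (e x) x := by
      intro x _
      have h3 : HasDerivAt (fun y : ℝ => Complex.I * (z * (1 - 2 * (y : ℂ))))
          (Complex.I * (z * (-(2 * 1)))) x := by
        have h4 : HasDerivAt (fun y : ℝ => (y : ℂ)) 1 x := Complex.ofRealCLM.hasDerivAt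
        exact (((h4.const_mul 2).const_sub 1).const_mul z).const_mul Complex.I
      refine ((h3.cexp).const_mul k).congr_deriv ?_
      rw [hk]
      change _ * (e x * _) = e x
      field_simp
    rw [intervalIntegral.integral_mul_deriv_eq_deriv_mul (fun x _ => hgd x) hv
      (hgc'.intervalIntegrable _ _) (hec.intervalIntegrable _ _)]
    have hB : ∀ x ∈ Icc (0 : ℝ) 1, ‖k * e x‖ ≤ (2 * ‖z‖)⁻¹ * Real.exp |z.im| := by
      intro x hx
      rw [norm_mul, hkn]
      gcongr
      exact norm_exp_I_mul_le z hx
    have h3 : ‖∫ x in (0 : ℝ)..1, deriv g x * (k * e x)‖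
        ≤ (∫ x in (0 : ℝ)..1, ‖deriv g x‖) * ((2 * ‖z‖)⁻¹ * Real.exp |z.im|) := by
      rw [← intervalIntegral.integral_mul_const]
      refine intervalIntegral.norm_integral_le_of_norm_le zero_le_one ?_ ?_
      · refine ae_of_all _ fun x hx => ?_
        rw [norm_mul]
        gcongr
        exact hB x ⟨hx.1.le, hx.2⟩
      · exact (hgc'.norm.mul continuous_const).intervalIntegrable _ _
    calc _ ≤ ‖g 1 * (k * e 1)‖ + ‖g 0 * (k * e 0)‖
          + ‖∫ x in (0 : ℝ)..1, deriv g x * (k * e x)‖ :=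
            (norm_sub_le _ _).trans (by gcongr; exact norm_sub_le _ _)
      _ ≤ ‖g 1‖ * ((2 * ‖z‖)⁻¹ * Real.exp |z.im|) + ‖g 0‖ * ((2 * ‖z‖)⁻¹ * Real.exp |z.im|)
          + (∫ x in (0 : ℝ)..1, ‖deriv g x‖) * ((2 * ‖z‖)⁻¹ * Real.exp |z.im|) := by
            rw [norm_mul (g 1), norm_mul (g 0)]
            gcongr
            · exact hB 1 (by simp)
            · exact hB 0 (by simp)
      _ = C * (2 * ‖z‖)⁻¹ * Real.exp |z.im| := by rw [hC]; ring
      _ ≤ _ := by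
            gcongr
            rw [← div_eq_mul_inv, div_le_iff₀ (by positivity)]
            have : C / η ≤ ‖z‖ := by linarith
            rw [div_le_iff₀ hη] at this
            linarith
  rw [hsplit]
  calc _ ≤ _ := norm_add_le _ _
    _ ≤ _ := by linarith

/-- `H` is a perturbation of `sin (z + φ)` of lower order than `e^{|Im z|}`. -/
def IsSineLike (φ : ℝ) (H : ℂ → ℂ) : Prop :=
  Differentiable ℂ H ∧ ∀ η > 0, ∃ R : ℝ, ∀ z : ℂ, R ≤ ‖z‖ →
    ‖H z - Complex.sin (z + φ)‖ ≤ η * Real.exp |z.im|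

namespace IsSineLike

variable {φ : ℝ} {H : ℂ → ℂ}

/-- Rouché's theorem applies on circles that stay away from the zeros `π j - φ`. -/
lemma zeroCount_eq (h : IsSineLike φ H) {δ : ℝ} (hδ : 0 < δ) : ∃ R : ℝ, ∀ (c : ℂ) (r : ℝ), 0 < r →
    (∀ z ∈ sphere c r, R ≤ ‖z‖ ∧ ∀ j : ℤ, δ ≤ ‖z + φ - j * Real.pi‖) →
    zeroCount H c r = zeroCount (fun z => Complex.sin (z + φ)) c r := by
  obtain ⟨a, ha, hsin⟩ := exists_le_norm_sin hδ
  obtain ⟨R, hR⟩ := h.2 (a / 2) (by positivity)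
  refine ⟨R, fun c r hr hz => ?_⟩
  refine zeroCount_eq_of_norm_sub_lt h.1 (by fun_prop) hr fun z hzs => ?_
  have h1 := hR z (hz z hzs).1
  have h2 := hsin (z + φ) (hz z hzs).2
  have h3 : (z + φ).im = z.im := by simp
  rw [h3] at h2
  have := Real.exp_pos |z.im|
  nlinarith

lemma ne_zero (h : IsSineLike φ H) : H ≠ 0 := by
  rintro rfl
  obtain ⟨a, ha, hsin⟩ := exists_le_norm_sin one_pos
  obtain ⟨R, hR⟩ := h.2 (a / 2) (by positivity)
  set y : ℝ := max R 1 with hy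
  have hy1 : 1 ≤ y := le_max_right _ _
  have hn : ‖(y : ℂ) * Complex.I‖ = y := by
    simp [abs_of_nonneg (zero_le_one.trans hy1)]
  have h1 := hR (y * Complex.I) (by rw [hn]; exact le_max_left _ _)
  have h2 := hsin (y * Complex.I + φ) (by
    intro j
    refine le_trans ?_ (Complex.abs_im_le_norm _)
    simpa using hy1.trans (le_abs_self _))
  simp only [Pi.zero_apply, zero_sub, norm_neg] at h1
  have h3 : ((y : ℂ) * Complex.I + φ).im = ((y : ℂ) * Complex.I).im := by simp
  rw [h3] at h2
  have := Real.exp_pos |((y : ℂ) * Complex.I).im|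
  nlinarith

lemma deriv_sin_shift (z : ℂ) (hz : Complex.sin (z + φ) = 0) :
    deriv (fun z : ℂ => Complex.sin (z + φ)) z ≠ 0 := by
  have h1 : HasDerivAt (fun z : ℂ => Complex.sin (z + φ)) (Complex.cos (z + φ) * 1) z :=
    ((hasDerivAt_id z).add_const (φ : ℂ)).csin
  rw [h1.deriv, mul_one]
  intro h0
  have := Complex.sin_sq_add_cos_sq (z + φ)
  rw [hz, h0] at this
  norm_num at this

/-- `H` has zeros close to the far positive zeros of `sin (z + φ)`. -/
lemma exists_zero_near (h : IsSineLike φ H) {ε : ℝ} (hε : 0 < ε) : ∃ K : ℕ, ∀ k ≥ K,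
    ∃ z ∈ ball (((Real.pi * k - φ : ℝ)) : ℂ) ε, H z = 0 := by
  wlog hε1 : ε ≤ 1 generalizing ε
  · obtain ⟨K, hK⟩ := this one_pos le_rfl
    refine ⟨K, fun k hk => ?_⟩
    obtain ⟨z, hz, hz0⟩ := hK k hk
    exact ⟨z, ball_subset_ball (not_le.1 hε1).le hz, hz0⟩
  obtain ⟨R, hR⟩ := h.zeroCount_eq hε
  have hpi := Real.pi_gt_three
  refine ⟨⌈R + 1 + |φ|⌉₊, fun k hk => ?_⟩
  have hk1 : R + 1 + |φ| ≤ k := (Nat.le_ceil _).trans (by exact_mod_cast hk)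
  have h1 := hR ((Real.pi * k - φ : ℝ) : ℂ) ε hε (by
    intro z hz
    rw [mem_sphere, dist_eq_norm] at hz
    constructor
    · have h2 : ‖((Real.pi * k - φ : ℝ) : ℂ)‖ ≤ ‖z - ((Real.pi * k - φ : ℝ) : ℂ)‖ + ‖z‖ := by
        rw [← norm_neg (z - _)]
        simpa using norm_add_le (-(z - ((Real.pi * k - φ : ℝ) : ℂ))) z
      rw [hz, Complex.norm_real, Real.norm_eq_abs] at h2
      have h3 := le_abs_self (Real.pi * k - φ)
      have h4 := le_abs_self φ
      have h5 : (0 : ℝ) ≤ k := Nat.cast_nonneg _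
      nlinarith
    · intro j
      by_cases hj : j = k
      · subst hj
        refine le_of_eq ?_
        rw [← hz]
        congr 1
        push_cast
        ring
      · have h2 : Real.pi ≤ ‖((j * Real.pi - k * Real.pi : ℝ) : ℂ)‖ := by
          rw [Complex.norm_real, Real.norm_eq_abs, ← sub_mul, abs_mul,
            abs_of_pos Real.pi_pos]
          have h3 : (1 : ℤ) ≤ |j - k| := Int.one_le_abs (sub_ne_zero.2 hj)
          have h4 : (1 : ℝ) ≤ |(j : ℝ) - k| := by exact_mod_cast h3
          nlinarith
        have h3 : ((j * Real.pi - k * Real.pi : ℝ) : ℂ) = (z - ((Real.pi * k - φ : ℝ) : ℂ))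
            - (z + φ - j * Real.pi) := by push_cast; ring
        have h4 := norm_sub_le (z - ((Real.pi * k - φ : ℝ) : ℂ)) (z + φ - j * Real.pi)
        rw [← h3, hz] at h4
        linarith)
  have h2 : zeroCount (fun z => Complex.sin (z + φ)) ((Real.pi * k - φ : ℝ) : ℂ) ε ≠ 0 := by
    rw [zeroCount_eq_ncard (by fun_prop) deriv_sin_shift]
    refine ncard_ne_zero_of_mem (a := ((Real.pi * k - φ : ℝ) : ℂ)) ?_
      (finite_zeros_ball (by fun_prop) ?_ _ _)
    · refine ⟨mem_ball_self hε, ?_⟩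
      rw [mem_ofPred_eq]
      have : ((Real.pi * k - φ : ℝ) : ℂ) + φ = ((k : ℤ) : ℂ) * Real.pi := by push_cast; ring
      rw [this, Complex.sin_int_mul_pi]
    · intro h0
      have h5 := congrFun h0 ((Real.pi / 2 - φ : ℝ) : ℂ)
      simp at h5
  rw [← h1] at h2
  by_contra! hcon
  exact h2 (finsum_mem_eq_zero_of_forall_eq_zero fun z hz => by
    by_contra h3
    exact hcon z hz ((orderNat_ne_zero_iff h.1 h.ne_zero z).1 h3))

/-- On large circles about the origin that stay away from the zeros of `sin (z + φ)`, the function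
`H` has as many zeros inside as there are integers `j` with `|π j - φ| < r`. -/
lemma zeroCount_origin (h : IsSineLike φ H) : ∃ R : ℝ, ∀ r > R,
    (∀ j : ℤ, 1 ≤ abs (r - |Real.pi * j - φ|)) →
    zeroCount H 0 r = {j : ℤ | |Real.pi * j - φ| < r}.ncard := by
  obtain ⟨R, hR⟩ := h.zeroCount_eq one_pos
  refine ⟨max R 0, fun r hr hj => ?_⟩
  have hr0 : 0 < r := lt_of_le_of_lt (le_max_right _ _) hr
  rw [hR 0 r hr0, zeroCount_eq_ncard (by fun_prop) deriv_sin_shift]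
  · have hinj : Function.Injective fun j : ℤ => ((Real.pi * j - φ : ℝ) : ℂ) := by
      intro i j hij
      have h1 : Real.pi * i - φ = Real.pi * j - φ := Complex.ofReal_injective hij
      have h2 : Real.pi * i = Real.pi * j := by linarith
      exact_mod_cast mul_left_cancel₀ Real.pi_ne_zero h2
    rw [← ncard_image_of_injective _ hinj]
    congr 1
    ext z
    simp only [mem_inter_iff, mem_ball_zero_iff, mem_ofPred_eq, mem_image, Complex.sin_eq_zero_iff]
    constructor
    · rintro ⟨h1, j, h2⟩
      have h3 : z = ((Real.pi * j - φ : ℝ) : ℂ) := by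
        push_cast
        rw [eq_sub_iff_add_eq, h2, mul_comm]
      refine ⟨j, ?_, h3.symm⟩
      rwa [h3, Complex.norm_real, Real.norm_eq_abs] at h1
    · rintro ⟨j, h1, rfl⟩
      refine ⟨by rwa [Complex.norm_real, Real.norm_eq_abs], j, by push_cast; ring⟩
  · intro z hz
    rw [mem_sphere_zero_iff_norm] at hz
    refine ⟨by rw [hz]; exact ((le_max_left _ _).trans_lt hr).le, fun j => (hj j).trans ?_⟩
    have h1 := abs_norm_sub_norm_le z ((Real.pi * j - φ : ℝ) : ℂ)
    rw [hz, Complex.norm_real, Real.norm_eq_abs] at h1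
    refine h1.trans (le_of_eq ?_)
    congr 1
    push_cast
    ring

end IsSineLike

end

section

open Metric Filter Topology

/-! ### Zeros of even entire functions in the half-plane `Ω` -/

lemma mem_Omega_iff {z : ℂ} : z ∈ Omega ↔ 0 < z.re ∨ (z.re = 0 ∧ 0 ≤ z.im) := by
  rcases eq_or_ne z 0 with rfl | hz
  · simp [Omega]
  simp only [Omega, mem_union, mem_ofPred_eq, mem_singleton_iff, hz, or_false,
    Complex.neg_pi_div_two_lt_arg_iff, Complex.arg_le_pi_div_two_iff]
  constructor
  · rintro ⟨h1, h2⟩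
    rcases lt_trichotomy z.re 0 with h | h | h
    · rcases h1 with h1 | h1
      · linarith
      · rcases h2 with h2 | h2 <;> linarith
    · right
      refine ⟨h, ?_⟩
      rcases h1 with h1 | h1 <;> linarith
    · exact Or.inl h
  · rintro (h | ⟨h1, h2⟩)
    · exact ⟨Or.inl h, Or.inl h.le⟩
    · exact ⟨Or.inr h2, Or.inl h1.ge⟩

lemma zero_mem_Omega : (0 : ℂ) ∈ Omega := by simp [mem_Omega_iff]

lemma neg_mem_Omega_iff {z : ℂ} (hz : z ≠ 0) : -z ∈ Omega ↔ z ∉ Omega := by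
  rw [mem_Omega_iff, mem_Omega_iff]
  simp only [Complex.neg_re, Complex.neg_im]
  constructor
  · rintro (h | ⟨h1, h2⟩) (h3 | ⟨h3, h4⟩)
    · linarith
    · linarith
    · linarith
    · exact hz (Complex.ext h3 (by simp; linarith))
  · intro h
    push Not at h
    rcases lt_or_eq_of_le h.1 with h1 | h1
    · left; linarith
    · right
      exact ⟨by linarith, by linarith [h.2 h1]⟩

open Classical in
/-- The multiplicities prescribed by `IsZeroList`: the order of `F` at the nonzero points of `Ω`,
and half of it at the origin. -/
def halfOrder (F : ℂ → ℂ) (z : ℂ) : ℕ :=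
  if z ∈ Omega then (if z = 0 then analyticOrderNatAt F z / 2 else analyticOrderNatAt F z) else 0

section Even

variable {F : ℂ → ℂ} (hF : Differentiable ℂ F) (h0 : F ≠ 0) (heven : ∀ z, F (-z) = F z)

include heven

lemma orderNat_neg (z : ℂ) : analyticOrderNatAt F (-z) = analyticOrderNatAt F z := by
  have h1 : F ∘ (fun z => -z) = F := funext heven
  have h2 := analyticOrderAt_comp_of_deriv_ne_zero (f := F) (g := fun z : ℂ => -z) (z₀ := z)
    (by fun_prop) (by simp)
  rw [h1] at h2
  rw [analyticOrderNatAt, analyticOrderNatAt, h2]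

include hF h0

/-- The leading coefficient at the origin would have to vanish if the order were odd. -/
lemma even_orderNat_zero : Even (analyticOrderNatAt F 0) := by
  obtain ⟨g, hg, hg0, hFg⟩ := ((hF.analyticAt 0).analyticOrderAt_eq_natCast
    (n := analyticOrderNatAt F 0)).1 (Nat.cast_analyticOrderNatAt (order_ne_top hF h0 0)).symm
  set n := analyticOrderNatAt F 0
  by_contra hodd
  rw [Nat.not_even_iff_odd] at hodd
  have hneg : Tendsto (fun z : ℂ => -z) (𝓝 0) (𝓝 0) := by
    simpa using (continuous_neg (G := ℂ)).tendsto 0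
  have h1 : ∀ᶠ z in 𝓝[≠] (0 : ℂ), g z + g (-z) = 0 := by
    have h2 := (hFg.and (hneg.eventually hFg))
    filter_upwards [h2.filter_mono nhdsWithin_le_nhds, self_mem_nhdsWithin] with z hz hz0
    have h3 := heven z
    rw [hz.1, hz.2] at h3
    simp only [sub_zero, smul_eq_mul, hodd.neg_pow] at h3
    have h4 : z ^ n * (g z + g (-z)) = 0 := by linear_combination -h3
    exact (mul_eq_zero.1 h4).resolve_left (pow_ne_zero _ hz0)
  have h2 : Tendsto (fun z => g z + g (-z)) (𝓝[≠] 0) (𝓝 (g 0 + g 0)) :=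
    (hg.continuousAt.tendsto.add (hg.continuousAt.tendsto.comp hneg)).mono_left nhdsWithin_le_nhds
  have h3 := tendsto_nhds_unique h2 ((tendsto_congr' h1).2 tendsto_const_nhds)
  rw [← two_mul] at h3
  exact hg0 ((mul_eq_zero.1 h3).resolve_left two_ne_zero)

lemma orderNat_eq_add (z : ℂ) :
    analyticOrderNatAt F z = halfOrder F z + halfOrder F (-z) := by
  classical
  rcases eq_or_ne z 0 with rfl | hz
  · obtain ⟨p, hp⟩ := even_orderNat_zero hF h0 heven
    simp only [halfOrder, neg_zero, zero_mem_Omega, if_true]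
    omega
  · have h1 := neg_mem_Omega_iff hz
    by_cases h2 : z ∈ Omega
    · simp [halfOrder, h1, h2, hz]
    · simp [halfOrder, h1, h2, hz, orderNat_neg heven]

lemma halfOrder_ne_zero_iff {z : ℂ} : halfOrder F z ≠ 0 ↔ z ∈ Omega ∧ F z = 0 := by
  classical
  by_cases h2 : z ∈ Omega
  · rcases eq_or_ne z 0 with rfl | hz
    · obtain ⟨p, hp⟩ := even_orderNat_zero hF h0 heven
      rw [← orderNat_ne_zero_iff hF h0]
      simp only [halfOrder, h2, if_true, true_and]
      omega
    · rw [← orderNat_ne_zero_iff hF h0]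
      simp [halfOrder, h2, hz]
  · simp [halfOrder, h2]

lemma finite_support_halfOrder (R : ℝ) :
    (ball (0 : ℂ) R ∩ Function.support (halfOrder F)).Finite := by
  refine (finite_zeros_ball hF h0 0 R).subset ?_
  rintro z ⟨h1, h2⟩
  exact ⟨h1, ((halfOrder_ne_zero_iff hF h0 heven).1 h2).2⟩

lemma zeroCount_eq_two_mul (R : ℝ) :
    zeroCount F 0 R = 2 * ∑ᶠ z ∈ ball (0 : ℂ) R, halfOrder F z := by
  have h1 : ∑ᶠ z ∈ ball (0 : ℂ) R, halfOrder F (-z) = ∑ᶠ z ∈ ball (0 : ℂ) R, halfOrder F z := by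
    refine finsum_mem_eq_of_bijOn (fun z => -z) ⟨?_, neg_injective.injOn, ?_⟩ fun _ _ => rfl
    · intro z hz; simpa using hz
    · intro z hz; exact ⟨-z, by simpa using hz, neg_neg z⟩
  have hfin := finite_support_halfOrder hF h0 heven R
  have hfin' : (ball (0 : ℂ) R ∩ Function.support fun z => halfOrder F (-z)).Finite := by
    refine (hfin.image (fun z => -z)).subset ?_
    rintro z ⟨hz, hz2⟩
    exact ⟨-z, ⟨by simpa using hz, hz2⟩, neg_neg z⟩
  rw [zeroCount, finsum_mem_congr rfl fun z _ => orderNat_eq_add hF h0 heven z,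
    finsum_mem_add_distrib' hfin hfin', h1, two_mul]

lemma isZeroList_iff {a : ℕ → ℂ} : IsZeroList F a ↔ IsEnum (halfOrder F) a := by
  classical
  have h2 : analyticOrderAt F 0 = 2 * (halfOrder F 0 : ℕ∞) := by
    rw [← Nat.cast_analyticOrderNatAt (order_ne_top hF h0 0),
      orderNat_eq_add hF h0 heven 0, neg_zero]
    push_cast
    rw [two_mul]
  have h3 : ∀ z ∈ Omega, z ≠ 0 → analyticOrderAt F z = (halfOrder F z : ℕ∞) := by
    intro z hz hz0
    rw [← Nat.cast_analyticOrderNatAt (order_ne_top hF h0 z)]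
    simp [halfOrder, hz, hz0]
  constructor
  · intro h
    refine ⟨h.mem, fun z hz => ?_, h.ordered⟩
    rcases eq_or_ne z 0 with rfl | hz0
    · have h4 := h.mult_zero
      rw [h2] at h4
      exact (ENat.mul_right_strictMono (a := 2) two_ne_zero (by simp) |>.injective h4).symm
    · rw [← h3 z hz hz0, h.mult z hz hz0]
  · intro h
    refine ⟨h.mem, fun z hz hz0 => ?_, ?_, h.ordered⟩
    · rw [h3 z hz hz0, h.mult z hz]
    · rw [h2, h.mult 0 zero_mem_Omega]

end Even

/-! ### The functions `F_c` and `F_s` -/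

/-- The odd entire function `λ F_s(λ)`. -/
def lamFs (f : ℝ → ℂ) (z : ℂ) : ℂ :=
  Complex.sin z + ∫ x in (0 : ℝ)..1, f x * Complex.sin (z * (1 - 2 * (x : ℂ)))

section Functions

variable {f : ℝ → ℂ} (hf : IntervalIntegrable f volume 0 1)

include hf

lemma hasDerivAt_integral_comp {k : ℂ → ℂ} (hk : Differentiable ℂ k) (z : ℂ) :
    HasDerivAt (fun z : ℂ => ∫ x in (0 : ℝ)..1, f x * k (z * (1 - 2 * (x : ℂ))))
      (∫ x in (0 : ℝ)..1, f x * (deriv k (z * (1 - 2 * (x : ℂ))) * (1 - 2 * (x : ℂ)))) z := by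
  have hdc : Continuous (deriv k) := hk.deriv.continuous
  obtain ⟨C, hC⟩ := (isCompact_closedBall (0 : ℂ) (‖z‖ + 1)).exists_bound_of_continuousOn
    hdc.continuousOn
  have hkc : ∀ w : ℂ, Continuous fun x : ℝ => k (w * (1 - 2 * (x : ℂ))) := fun w =>
    hk.continuous.comp (by fun_prop)
  have hfm : AEStronglyMeasurable f (volume.restrict (uIoc 0 1)) :=
    (intervalIntegrable_iff.1 hf).aestronglyMeasurable
  have hone : ∀ x ∈ uIoc (0 : ℝ) 1, ‖(1 - 2 * (x : ℂ))‖ ≤ 1 := by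
    intro x hx
    rw [uIoc_of_le zero_le_one] at hx
    have : (1 - 2 * (x : ℂ)) = ((1 - 2 * x : ℝ) : ℂ) := by push_cast; ring
    rw [this, Complex.norm_real, Real.norm_eq_abs, abs_le]
    constructor <;> linarith [hx.1, hx.2]
  refine (intervalIntegral.hasDerivAt_integral_of_dominated_loc_of_deriv_le
    (bound := fun x => ‖f x‖ * C) (F := fun z x => f x * k (z * (1 - 2 * (x : ℂ))))
    (F' := fun z x => f x * (deriv k (z * (1 - 2 * (x : ℂ))) * (1 - 2 * (x : ℂ))))
    (s := ball z 1) (ball_mem_nhds z one_pos) ?_ ?_ ?_ ?_ ?_ ?_).2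
  · exact Eventually.of_forall fun w => hfm.mul (hkc w).aestronglyMeasurable
  · exact hf.mul_continuousOn (hkc z).continuousOn
  · refine hfm.mul (Continuous.aestronglyMeasurable ?_)
    exact (hdc.comp (by fun_prop)).mul (by fun_prop)
  · refine ae_of_all _ fun x hx w hw => ?_
    rw [norm_mul, norm_mul]
    gcongr
    have h1 := hone x hx
    have h2 : ‖w‖ ≤ ‖z‖ + 1 := by
      rw [mem_ball, dist_eq_norm] at hw
      have := norm_add_le (w - z) z
      rw [sub_add_cancel] at this
      linarith
    have h3 := hC (w * (1 - 2 * (x : ℂ))) (by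
      rw [mem_closedBall_zero_iff, norm_mul]
      exact (mul_le_of_le_one_right (norm_nonneg _) h1).trans h2)
    exact (mul_le_of_le_one_right (norm_nonneg _) h1).trans h3
  · exact hf.norm.mul_const C
  · refine ae_of_all _ fun x _ w _ => ?_
    have h1 : HasDerivAt (fun w : ℂ => w * (1 - 2 * (x : ℂ))) (1 * (1 - 2 * (x : ℂ))) w :=
      (hasDerivAt_id w).mul_const _
    have h2 := (hk (w * (1 - 2 * (x : ℂ)))).hasDerivAt.comp w h1
    rw [one_mul] at h2
    exact h2.const_mul (f x)

lemma differentiable_Fc : Differentiable ℂ (Fc f) := fun z =>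
  Complex.differentiable_cos.differentiableAt.add
    (hasDerivAt_integral_comp hf Complex.differentiable_cos z).differentiableAt

lemma differentiable_lamFs : Differentiable ℂ (lamFs f) := fun z =>
  Complex.differentiable_sin.differentiableAt.add
    (hasDerivAt_integral_comp hf Complex.differentiable_sin z).differentiableAt

/-- The value of `F_s` at the origin is the one that makes it entire. -/
lemma Fs_eq_dslope : Fs f = dslope (lamFs f) 0 := by
  funext z
  have h0 : lamFs f 0 = 0 := by simp [lamFs]
  rcases eq_or_ne z 0 with rfl | hz
  · have h1 := ((Complex.hasDerivAt_sin 0).add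
      (hasDerivAt_integral_comp hf Complex.differentiable_sin 0)).deriv
    have h2 : deriv (lamFs f) 0 = _ := h1
    rw [dslope_same, h2]
    simp [Fs]
  · rw [dslope_of_ne _ hz, slope_def_field, h0, sub_zero, sub_zero, lamFs, Fs, if_neg hz, add_div,
      ← intervalIntegral.integral_div]
    simp_rw [mul_div_assoc]

lemma differentiable_Fs : Differentiable ℂ (Fs f) := by
  rw [Fs_eq_dslope hf, ← differentiableOn_univ, Complex.differentiableOn_dslope univ_mem]
  exact (differentiable_lamFs hf).differentiableOn

lemma lamFs_eq_mul : lamFs f = (fun z => z - 0) * Fs f := by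
  funext z
  have h0 : lamFs f 0 = 0 := by simp [lamFs]
  have := sub_smul_dslope_of_zero h0 z
  rw [Fs_eq_dslope hf]
  simpa using this.symm

omit hf in
lemma Fc_neg (z : ℂ) : Fc f (-z) = Fc f z := by simp [Fc]

omit hf in
lemma Fs_neg (z : ℂ) : Fs f (-z) = Fs f z := by
  rcases eq_or_ne z 0 with rfl | hz
  · simp
  · simp [Fs, hz]

lemma exists_norm_integral_trig_le {η : ℝ} (hη : 0 < η) : ∃ R : ℝ, ∀ z : ℂ, R ≤ ‖z‖ →
    ‖∫ x in (0 : ℝ)..1, f x * Complex.cos (z * (1 - 2 * (x : ℂ)))‖ ≤ η * Real.exp |z.im| ∧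
    ‖∫ x in (0 : ℝ)..1, f x * Complex.sin (z * (1 - 2 * (x : ℂ)))‖ ≤ η * Real.exp |z.im| := by
  obtain ⟨R, hR⟩ := exists_norm_integral_exp_le hf hη
  refine ⟨R, fun z hz => ?_⟩
  have h1 := hR z hz
  have h2 := hR (-z) (by rwa [norm_neg])
  rw [Complex.neg_im, abs_neg] at h2
  set A := ∫ x in (0 : ℝ)..1, f x * Complex.exp (Complex.I * (z * (1 - 2 * (x : ℂ))))
  set B := ∫ x in (0 : ℝ)..1, f x * Complex.exp (Complex.I * (-z * (1 - 2 * (x : ℂ))))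
  have hi : ∀ w : ℂ, IntervalIntegrable
      (fun x : ℝ => f x * Complex.exp (Complex.I * (w * (1 - 2 * (x : ℂ))))) volume 0 1 := fun w =>
    hf.mul_continuousOn (Continuous.continuousOn (by fun_prop))
  have hc : ∫ x in (0 : ℝ)..1, f x * Complex.cos (z * (1 - 2 * (x : ℂ))) = (A + B) / 2 := by
    rw [← intervalIntegral.integral_add (hi _) (hi _), ← intervalIntegral.integral_div]
    congr 1; ext x
    rw [Complex.cos]
    ring_nf
  have hs : ∫ x in (0 : ℝ)..1, f x * Complex.sin (z * (1 - 2 * (x : ℂ)))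
      = (B - A) * (Complex.I / 2) := by
    rw [← intervalIntegral.integral_sub (hi _) (hi _), ← intervalIntegral.integral_mul_const]
    congr 1; ext x
    rw [Complex.sin]
    ring_nf
  constructor
  · rw [hc, norm_div, Complex.norm_ofNat]
    have := norm_add_le A B
    linarith
  · rw [hs, norm_mul, norm_div, Complex.norm_I, Complex.norm_ofNat]
    have := norm_sub_le B A
    linarith

lemma isSineLike_Fc : IsSineLike (Real.pi / 2) (Fc f) := by
  refine ⟨differentiable_Fc hf, fun η hη => ?_⟩
  obtain ⟨R, hR⟩ := exists_norm_integral_trig_le hf hη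
  refine ⟨R, fun z hz => ?_⟩
  have := (hR z hz).1
  rwa [Fc, Complex.ofReal_div, Complex.ofReal_ofNat, Complex.sin_add_pi_div_two, add_sub_cancel_left]

lemma isSineLike_lamFs : IsSineLike 0 (lamFs f) := by
  refine ⟨differentiable_lamFs hf, fun η hη => ?_⟩
  obtain ⟨R, hR⟩ := exists_norm_integral_trig_le hf hη
  refine ⟨R, fun z hz => ?_⟩
  have := (hR z hz).2
  rwa [lamFs, Complex.ofReal_zero, add_zero, add_sub_cancel_left]

lemma Fs_ne_zero : Fs f ≠ 0 := by
  intro h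
  have := (isSineLike_lamFs hf).ne_zero
  rw [lamFs_eq_mul hf, h, mul_zero] at this
  exact this rfl

/-- The circle of radius `π k` encloses the `2k` zeros of `cos` at `±π / 2, …, ±(π k - π / 2)`. -/
lemma zeroProfile_Fc : ZeroProfile (halfOrder (Fc f)) 0 := by
  have hd := differentiable_Fc hf
  have hS := isSineLike_Fc hf
  have h0 := hS.ne_zero
  have hpi := Real.pi_gt_three
  refine ⟨le_rfl, finite_support_halfOrder hd h0 Fc_neg,
    fun z hz => ((halfOrder_ne_zero_iff hd h0 Fc_neg).1 hz).1, ?_, ?_⟩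
  · obtain ⟨R, hR⟩ := hS.zeroCount_origin
    refine ⟨⌈R⌉₊ + 1, fun k hk => ?_⟩
    have hk1 : R + 1 ≤ k := by
      have h1 := Nat.le_ceil R
      have h2 : ((⌈R⌉₊ + 1 : ℕ) : ℝ) ≤ k := by exact_mod_cast hk
      push_cast at h2; linarith
    have hk0 : (0 : ℝ) ≤ k := Nat.cast_nonneg _
    have h1 := hR (0 + Real.pi * k) (by nlinarith) (by
      intro j
      have e : |Real.pi * j - Real.pi / 2| = Real.pi * |(j : ℝ) - 1 / 2| := by
        rw [← abs_of_pos Real.pi_pos, ← abs_mul, abs_of_pos Real.pi_pos]; ring_nf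
      rw [e, zero_add, ← mul_sub, abs_mul, abs_of_pos Real.pi_pos]
      have h2 : 1 / 2 ≤ abs ((k : ℝ) - |(j : ℝ) - 1 / 2|) := by
        -- a half-integer has distance at least `1 / 2` from every integer
        rcases le_or_gt j 0 with h | h
        · have hj : (j : ℝ) ≤ 0 := by exact_mod_cast h
          rw [abs_of_nonpos (a := (j : ℝ) - 1 / 2) (by linarith)]
          rcases le_or_gt ((k : ℤ) + j) 0 with h3 | h3
          · have : (k : ℝ) + j ≤ 0 := by exact_mod_cast h3
            rw [le_abs]; right; linarith
          · have : (1 : ℝ) ≤ (k : ℝ) + j := by exact_mod_cast h3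
            rw [le_abs]; left; linarith
        · have hj : (1 : ℝ) ≤ j := by exact_mod_cast h
          rw [abs_of_nonneg (a := (j : ℝ) - 1 / 2) (by linarith)]
          rcases le_or_gt j k with h3 | h3
          · have : (j : ℝ) ≤ k := by exact_mod_cast h3
            rw [le_abs]; left; linarith
          · have : (k : ℝ) + 1 ≤ j := by exact_mod_cast h3
            rw [le_abs]; right; linarith
      nlinarith)
    have h2 : {j : ℤ | |Real.pi * j - Real.pi / 2| < 0 + Real.pi * k}
        = ((Finset.Icc (-(k : ℤ) + 1) k : Finset ℤ) : Set ℤ) := by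
      ext j
      rw [mem_ofPred_eq, Finset.coe_Icc, mem_Icc, zero_add, abs_lt]
      constructor
      · rintro ⟨h3, h4⟩
        have h5 : (-(k : ℝ) : ℝ) < j := by nlinarith
        have h6 : (j : ℝ) < k + 1 := by nlinarith
        have h5' : -(k : ℤ) < j := by exact_mod_cast h5
        have h6' : j < k + 1 := by exact_mod_cast h6
        omega
      · rintro ⟨h3, h4⟩
        have h5 : (-(k : ℝ) + 1 : ℝ) ≤ j := by exact_mod_cast h3
        have h6 : (j : ℝ) ≤ k := by exact_mod_cast h4
        constructor <;> nlinarith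
    rw [h2, ncard_coe_finset, Int.card_Icc, zeroCount_eq_two_mul hd h0 Fc_neg] at h1
    omega
  · intro ε hε
    obtain ⟨K, hK⟩ := hS.exists_zero_near (ε := min ε 1) (by positivity)
    refine ⟨K, fun k hk => ?_⟩
    obtain ⟨z, hz, hz0⟩ := hK (k + 1) (by omega)
    have e : Real.pi * ((k + 1 : ℕ) : ℝ) - Real.pi / 2 = 0 + Real.pi * k + Real.pi / 2 := by
      push_cast; ring
    rw [e] at hz
    refine ⟨z, ball_subset_ball (min_le_left _ _) hz, (halfOrder_ne_zero_iff hd h0 Fc_neg).2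
      ⟨mem_Omega_iff.2 (Or.inl ?_), hz0⟩⟩
    have hk0 : (0 : ℝ) ≤ Real.pi * k := by positivity
    rcases mem_ball_re_bounds hz with h | h
    · have := min_le_right ε 1
      linarith [h.1]
    · linarith

/-- The circle of radius `π k + π / 2` encloses the `2k + 1` zeros of `sin` at `0, ±π, …, ±π k`; the
zero of `λ F_s(λ)` due to the factor `λ` has to be discounted. -/
lemma zeroProfile_Fs : ZeroProfile (halfOrder (Fs f)) (Real.pi / 2) := by
  have hd := differentiable_Fs hf
  have hS := isSineLike_lamFs hf
  have h0 := Fs_ne_zero hf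
  have hpi := Real.pi_gt_three
  refine ⟨by positivity, finite_support_halfOrder hd h0 Fs_neg,
    fun z hz => ((halfOrder_ne_zero_iff hd h0 Fs_neg).1 hz).1, ?_, ?_⟩
  · obtain ⟨R, hR⟩ := hS.zeroCount_origin
    refine ⟨⌈R⌉₊ + 1, fun k hk => ?_⟩
    have hk1 : R + 1 ≤ k := by
      have h1 := Nat.le_ceil R
      have h2 : ((⌈R⌉₊ + 1 : ℕ) : ℝ) ≤ k := by exact_mod_cast hk
      push_cast at h2; linarith
    have hk0 : (0 : ℝ) ≤ k := Nat.cast_nonneg _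
    have h1 := hR (Real.pi / 2 + Real.pi * k) (by nlinarith) (by
      intro j
      have e : |Real.pi * j - 0| = Real.pi * |(j : ℝ)| := by
        rw [sub_zero, abs_mul, abs_of_pos Real.pi_pos]
      have e2 : Real.pi / 2 + Real.pi * k - Real.pi * |(j : ℝ)|
          = Real.pi * ((k : ℝ) + 1 / 2 - |(j : ℝ)|) := by ring
      rw [e, e2, abs_mul, abs_of_pos Real.pi_pos]
      have h2 : 1 / 2 ≤ abs ((k : ℝ) + 1 / 2 - |(j : ℝ)|) := by
        rcases le_or_gt |j| k with h3 | h3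
        · have : |(j : ℝ)| ≤ k := by exact_mod_cast h3
          rw [le_abs]; left; linarith
        · have : (k : ℝ) + 1 ≤ |(j : ℝ)| := by exact_mod_cast h3
          rw [le_abs]; right; linarith
      nlinarith)
    have h2 : {j : ℤ | |Real.pi * j - 0| < Real.pi / 2 + Real.pi * k}
        = ((Finset.Icc (-(k : ℤ)) k : Finset ℤ) : Set ℤ) := by
      ext j
      rw [mem_ofPred_eq, Finset.coe_Icc, mem_Icc, sub_zero, abs_lt]
      constructor
      · rintro ⟨h3, h4⟩
        have h5 : (-(k : ℝ) - 1 : ℝ) < j := by nlinarith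
        have h6 : (j : ℝ) < k + 1 := by nlinarith
        have h5' : -(k : ℤ) - 1 < j := by exact_mod_cast h5
        have h6' : j < k + 1 := by exact_mod_cast h6
        omega
      · rintro ⟨h3, h4⟩
        have h5 : (-(k : ℝ) : ℝ) ≤ j := by exact_mod_cast h3
        have h6 : (j : ℝ) ≤ k := by exact_mod_cast h4
        constructor <;> nlinarith
    have h3 : zeroCount (lamFs f) 0 (Real.pi / 2 + Real.pi * k)
        = 1 + zeroCount (Fs f) 0 (Real.pi / 2 + Real.pi * k) := by
      rw [lamFs_eq_mul hf, zeroCount_mul (by fun_prop) hd ?_ h0, zeroCount_sub_const]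
      · exact mem_ball_self (by positivity)
      · intro h
        have := congrFun h 1
        norm_num at this
    rw [h3, h2, ncard_coe_finset, Int.card_Icc, zeroCount_eq_two_mul hd h0 Fs_neg] at h1
    omega
  · intro ε hε
    obtain ⟨K, hK⟩ := hS.exists_zero_near (ε := min ε 1) (by positivity)
    refine ⟨K, fun k hk => ?_⟩
    obtain ⟨z, hz, hz0⟩ := hK (k + 1) (by omega)
    have e : Real.pi * ((k + 1 : ℕ) : ℝ) - 0 = Real.pi / 2 + Real.pi * k + Real.pi / 2 := by
      push_cast; ring
    rw [e] at hz
    have hk0 : (0 : ℝ) ≤ Real.pi * k := by positivity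
    have hre : 0 < z.re := by
      rcases mem_ball_re_bounds hz with h | h
      · have := min_le_right ε 1
        linarith [h.1]
      · linarith
    refine ⟨z, ball_subset_ball (min_le_left _ _) hz, (halfOrder_ne_zero_iff hd h0 Fs_neg).2
      ⟨mem_Omega_iff.2 (Or.inl hre), ?_⟩⟩
    rw [lamFs_eq_mul hf] at hz0
    have hz1 : z - 0 ≠ 0 := by
      rw [sub_zero]; rintro rfl; simp at hre
    exact (mul_eq_zero.1 hz0).resolve_left hz1

/-- The zeros of `F_c` and of `F_s` can be numbered. -/
theorem exists_isZeroNumbering : ∃ ξ, IsZeroNumbering f ξ := by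
  obtain ⟨a, ha⟩ := (zeroProfile_Fc hf).exists_enum
  obtain ⟨b, hb⟩ := (zeroProfile_Fs hf).exists_enum
  refine ⟨fun n => if n % 2 = 1 then a (n / 2) else b (n / 2 - 1), ?_, ?_⟩
  · rw [isZeroList_iff (differentiable_Fc hf) (isSineLike_Fc hf).ne_zero Fc_neg]
    convert ha using 2 with n
    have h1 : (2 * n + 1) % 2 = 1 := by omega
    have h2 : (2 * n + 1) / 2 = n := by omega
    simp [h1, h2]
  · rw [isZeroList_iff (differentiable_Fs hf) (Fs_ne_zero hf) Fs_neg]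
    convert hb using 2 with n
    have h1 : (2 * n + 2) % 2 ≠ 1 := by omega
    have h2 : (2 * n + 2) / 2 - 1 = n := by omega
    simp

/-- Every numbering satisfies `ξ_n = π n / 2 + o(1)`, and the `ξ_n` are zeros of `F_c` for odd `n`
and of `λ F_s(λ)` for even `n`. -/
theorem IsZeroNumbering.tendsto {ξ : ℕ → ℂ} (hξ : IsZeroNumbering f ξ) :
    Tendsto (fun n : ℕ => ξ n - (Real.pi : ℂ) * n / 2) atTop (𝓝 0) ∧
    (∀ k, Fc f (ξ (2 * k + 1)) = 0) ∧ ∀ k, lamFs f (ξ (2 * k + 2)) = 0 := by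
  have hc := (isZeroList_iff (differentiable_Fc hf) (isSineLike_Fc hf).ne_zero Fc_neg).1 hξ.1
  have hs := (isZeroList_iff (differentiable_Fs hf) (Fs_ne_zero hf) Fs_neg).1 hξ.2
  have tc := (zeroProfile_Fc hf).tendsto_enum hc
  have ts := (zeroProfile_Fs hf).tendsto_enum hs
  refine ⟨?_, fun k => ?_, fun k => ?_⟩
  · rw [Metric.tendsto_atTop] at tc ts ⊢
    intro ε hε
    obtain ⟨N1, h1⟩ := tc ε hε
    obtain ⟨N2, h2⟩ := ts ε hε
    refine ⟨2 * (N1 + N2) + 2, fun n hn => ?_⟩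
    rcases Nat.even_or_odd' n with ⟨k, rfl | rfl⟩
    · obtain ⟨j, rfl⟩ : ∃ j, k = j + 1 := ⟨k - 1, by omega⟩
      have := h2 j (by omega)
      refine lt_of_eq_of_lt ?_ this
      congr 2
      push_cast; ring
    · have := h1 k (by omega)
      refine lt_of_eq_of_lt ?_ this
      congr 2
      push_cast; ring
  · exact ((halfOrder_ne_zero_iff (differentiable_Fc hf) (isSineLike_Fc hf).ne_zero Fc_neg).1
      (ZeroProfile.mult_ne_zero hc k)).2
  · rw [lamFs_eq_mul hf, Pi.mul_apply, ((halfOrder_ne_zero_iff (differentiable_Fs hf)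
      (Fs_ne_zero hf) Fs_neg).1 (ZeroProfile.mult_ne_zero hs k)).2, mul_zero]

end Functions

end

section

open Filter Topology ENNReal

/-! ### The Slobodeckij seminorm -/

lemma FiniteSlobodeckij.congr {σ : ℝ} {f g : ℝ → ℂ} (hf : FiniteSlobodeckij σ f)
    (h : f =ᵐ[volume.restrict (Ioo (0 : ℝ) 1)] g) : FiniteSlobodeckij σ g := by
  unfold FiniteSlobodeckij at *
  refine lt_of_eq_of_lt ?_ hf
  refine lintegral_congr_ae ?_
  filter_upwards [h] with x hx
  refine lintegral_congr_ae ?_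
  filter_upwards [h] with y hy
  rw [hx, hy]

/-- Comparison of seminorms through a bound of the integrands, with an integrable error `r`. -/
lemma FiniteSlobodeckij.of_le {σ : ℝ} {f g : ℝ → ℂ} (hf : FiniteSlobodeckij σ f)
    (hfm : AEStronglyMeasurable f (volume.restrict (Ioo (0 : ℝ) 1))) {C : ℝ}
    {r : ℝ → ℝ → ℝ≥0∞}
    (hr : ∫⁻ x in Ioo (0 : ℝ) 1, ∫⁻ y in Ioo (0 : ℝ) 1, r x y < ⊤)
    (h : ∀ x ∈ Ioo (0 : ℝ) 1, ∀ y ∈ Ioo (0 : ℝ) 1,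
      ENNReal.ofReal (‖g x - g y‖ ^ 2 / |x - y| ^ (1 + 2 * σ)) ≤
      ENNReal.ofReal C * ENNReal.ofReal (‖f x - f y‖ ^ 2 / |x - y| ^ (1 + 2 * σ)) + r x y) :
    FiniteSlobodeckij σ g := by
  -- it is enough to treat a measurable representative of `f`
  set f' := hfm.mk f with hf'
  have hff' : f =ᵐ[volume.restrict (Ioo (0 : ℝ) 1)] f' := hfm.ae_eq_mk
  have hm : Measurable f' := hfm.stronglyMeasurable_mk.measurable
  have hK : Measurable fun p : ℝ × ℝ =>
      ENNReal.ofReal (‖f' p.1 - f' p.2‖ ^ 2 / |p.1 - p.2| ^ (1 + 2 * σ)) := by fun_prop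
  unfold FiniteSlobodeckij at *
  have hf2 := FiniteSlobodeckij.congr hf hff'
  unfold FiniteSlobodeckij at hf2
  have hle : ∫⁻ x in Ioo (0 : ℝ) 1, ∫⁻ y in Ioo (0 : ℝ) 1,
      ENNReal.ofReal (‖g x - g y‖ ^ 2 / |x - y| ^ (1 + 2 * σ)) ≤
      ∫⁻ x in Ioo (0 : ℝ) 1, ((ENNReal.ofReal C * ∫⁻ y in Ioo (0 : ℝ) 1,
        ENNReal.ofReal (‖f' x - f' y‖ ^ 2 / |x - y| ^ (1 + 2 * σ)))
        + ∫⁻ y in Ioo (0 : ℝ) 1, r x y) := by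
    refine lintegral_mono_ae ?_
    filter_upwards [hff', ae_restrict_mem measurableSet_Ioo] with x hx hxm
    have hKx : Measurable fun y : ℝ =>
        ENNReal.ofReal (‖f' x - f' y‖ ^ 2 / |x - y| ^ (1 + 2 * σ)) := by fun_prop
    rw [← lintegral_const_mul _ hKx, ← lintegral_add_left (hKx.const_mul _)]
    refine lintegral_mono_ae ?_
    filter_upwards [hff', ae_restrict_mem measurableSet_Ioo] with y hy hym
    rw [← hx, ← hy]
    exact h x hxm y hym
  refine hle.trans_lt ?_
  have hKi : Measurable fun x : ℝ => ∫⁻ y in Ioo (0 : ℝ) 1,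
      ENNReal.ofReal (‖f' x - f' y‖ ^ 2 / |x - y| ^ (1 + 2 * σ)) := hK.lintegral_prod_right'
  rw [lintegral_add_left (hKi.const_mul _), lintegral_const_mul _ hKi]
  exact ENNReal.add_lt_top.2 ⟨ENNReal.mul_lt_top ENNReal.ofReal_lt_top hf2, hr⟩

lemma FiniteSlobodeckij.const_mul {σ : ℝ} {f : ℝ → ℂ} (c : ℂ) (hf : FiniteSlobodeckij σ f)
    (hfm : AEStronglyMeasurable f (volume.restrict (Ioo (0 : ℝ) 1))) :
    FiniteSlobodeckij σ fun x => c * f x := by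
  refine hf.of_le hfm (C := ‖c‖ ^ 2) (r := fun _ _ => 0) (by simp) ?_
  intro x _ y _
  rw [add_zero, ← ENNReal.ofReal_mul (by positivity), ← mul_sub, norm_mul, mul_pow, mul_div_assoc]

lemma FiniteSlobodeckij.add {σ : ℝ} {f g : ℝ → ℂ} (hf : FiniteSlobodeckij σ f)
    (hg : FiniteSlobodeckij σ g)
    (hfm : AEStronglyMeasurable f (volume.restrict (Ioo (0 : ℝ) 1)))
    (hgm : AEStronglyMeasurable g (volume.restrict (Ioo (0 : ℝ) 1))) :
    FiniteSlobodeckij σ fun x => f x + g x := by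
  have hg2 := hg.const_mul 2 hgm
  refine hf.of_le hfm (C := 2) (r := fun x y =>
    ENNReal.ofReal (‖2 * g x - 2 * g y‖ ^ 2 / |x - y| ^ (1 + 2 * σ))) hg2 ?_
  intro x _ y _
  rw [← ENNReal.ofReal_mul (by norm_num), ← ENNReal.ofReal_add (by positivity) (by positivity)]
  apply ENNReal.ofReal_le_ofReal
  rw [← mul_div_assoc, ← add_div]
  gcongr
  have h1 : f x + g x - (f y + g y) = (f x - f y) + (g x - g y) := by ring
  have h2 := norm_add_le (f x - f y) (g x - g y)
  rw [h1, ← mul_sub, norm_mul, Complex.norm_ofNat]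
  nlinarith [norm_nonneg (f x - f y + (g x - g y)), norm_nonneg (f x - f y), norm_nonneg (g x - g y),
    sq_nonneg (‖f x - f y‖ - ‖g x - g y‖)]

lemma lintegral_reflect (u : ℝ → ℝ≥0∞) :
    ∫⁻ x in Ioo (0 : ℝ) 1, u (1 - x) = ∫⁻ x in Ioo (0 : ℝ) 1, u x := by
  rw [← lintegral_indicator measurableSet_Ioo, ← lintegral_indicator measurableSet_Ioo,
    ← lintegral_sub_left_eq_self _ (1 : ℝ)]
  refine lintegral_congr fun x => ?_
  have h1 : 1 - x ∈ Ioo (0 : ℝ) 1 ↔ x ∈ Ioo (0 : ℝ) 1 := by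
    simp only [mem_Ioo]
    constructor <;> rintro ⟨h1, h2⟩ <;> constructor <;> linarith
  by_cases hx : x ∈ Ioo (0 : ℝ) 1
  · rw [indicator_of_mem hx, indicator_of_mem (h1.2 hx), _root_.sub_sub_cancel]
  · rw [indicator_of_notMem hx, indicator_of_notMem fun h => hx (h1.1 h)]

lemma FiniteSlobodeckij.reflect {σ : ℝ} {f : ℝ → ℂ} (hf : FiniteSlobodeckij σ f) :
    FiniteSlobodeckij σ fun x => f (1 - x) := by
  unfold FiniteSlobodeckij at *
  refine lt_of_eq_of_lt ?_ hf
  rw [← lintegral_reflect]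
  refine lintegral_congr fun x => ?_
  rw [← lintegral_reflect]
  refine lintegral_congr fun y => ?_
  have e : |1 - x - (1 - y)| = |x - y| := by rw [← abs_neg]; ring_nf
  simp only [_root_.sub_sub_cancel, e]

/-- The seminorm as an integral over the increments `f (x + h) - f x`. -/
lemma slobodeckij_eq_increments (σ : ℝ) {f : ℝ → ℂ} (hf : Measurable f) :
    ∫⁻ x in Ioo (0 : ℝ) 1, ∫⁻ y in Ioo (0 : ℝ) 1,
      ENNReal.ofReal (‖f x - f y‖ ^ 2 / |x - y| ^ (1 + 2 * σ)) =
    ∫⁻ h : ℝ, ∫⁻ x in Ioo (0 : ℝ) 1 ∩ {x | x + h ∈ Ioo (0 : ℝ) 1},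
      ENNReal.ofReal (‖f (x + h) - f x‖ ^ 2 / |h| ^ (1 + 2 * σ)) := by
  set K : ℝ × ℝ → ℝ≥0∞ := (Ioo (0 : ℝ) 1 ×ˢ Ioo (0 : ℝ) 1).indicator fun p =>
    ENNReal.ofReal (‖f p.1 - f p.2‖ ^ 2 / |p.1 - p.2| ^ (1 + 2 * σ)) with hK
  have hKm : Measurable K :=
    Measurable.indicator (by fun_prop) (measurableSet_Ioo.prod measurableSet_Ioo)
  have h1 : ∫⁻ x in Ioo (0 : ℝ) 1, ∫⁻ y in Ioo (0 : ℝ) 1,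
      ENNReal.ofReal (‖f x - f y‖ ^ 2 / |x - y| ^ (1 + 2 * σ)) = ∫⁻ x, ∫⁻ y, K (x, y) := by
    rw [← lintegral_indicator measurableSet_Ioo]
    refine lintegral_congr fun x => ?_
    by_cases hx : x ∈ Ioo (0 : ℝ) 1
    · rw [indicator_of_mem hx, ← lintegral_indicator measurableSet_Ioo]
      refine lintegral_congr fun y => ?_
      by_cases hy : y ∈ Ioo (0 : ℝ) 1
      · rw [indicator_of_mem hy, hK, indicator_of_mem (mk_mem_prod hx hy)]
      · rw [indicator_of_notMem hy, hK, indicator_of_notMem fun h => hy h.2]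
    · rw [indicator_of_notMem hx]
      have : ∀ y, K (x, y) = 0 := fun y => indicator_of_notMem (fun h => hx h.1) _
      simp [this]
  rw [h1]
  calc ∫⁻ x, ∫⁻ y, K (x, y) = ∫⁻ x, ∫⁻ h, K (x, x + h) := by
        refine lintegral_congr fun x => ?_
        exact (lintegral_add_left_eq_self (fun y => K (x, y)) x).symm
    _ = ∫⁻ h, ∫⁻ x, K (x, x + h) := by
        refine lintegral_lintegral_swap (f := fun x h => K (x, x + h)) ?_
        exact (hKm.comp (by fun_prop : Measurable fun p : ℝ × ℝ => (p.1, p.1 + p.2))).aemeasurable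
    _ = _ := by
        refine lintegral_congr fun h => ?_
        have hms : MeasurableSet (Ioo (0 : ℝ) 1 ∩ {x | x + h ∈ Ioo (0 : ℝ) 1}) :=
          measurableSet_Ioo.inter ((measurable_id.add_const h) measurableSet_Ioo)
        rw [← lintegral_indicator hms]
        refine lintegral_congr fun x => ?_
        by_cases hx : x ∈ Ioo (0 : ℝ) 1 ∩ {x | x + h ∈ Ioo (0 : ℝ) 1}
        · have hx2 : (x, x + h) ∈ Ioo (0 : ℝ) 1 ×ˢ Ioo (0 : ℝ) 1 := ⟨hx.1, hx.2⟩
          rw [indicator_of_mem hx, hK, indicator_of_mem hx2]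
          simp only [sub_add_cancel_left, abs_neg]
          rw [norm_sub_rev]
        · rw [indicator_of_notMem hx, hK, indicator_of_notMem fun h => hx ⟨h.1, h.2⟩]

/-! ### Boundary terms -/

/-- Comparison of the averages of `|f|` over `(0, h)` and `(0, 2h)`. -/
lemma lintegral_average_le {α : ℝ} (hα : 0 < α) {f : ℝ → ℂ} (hm : Measurable f) {h : ℝ} (hh : 0 < h)
    (hh2 : 2 * h ≤ 1) :
    ENNReal.ofReal (2 * h) * ∫⁻ x in Ioo 0 h, ‖f x‖ₑ ≤
      ENNReal.ofReal h * (∫⁻ x in Ioo 0 (2 * h), ‖f x‖ₑ) + (ENNReal.ofReal (2 * h ^ (3 / 2 + α))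
        + ENNReal.ofReal ((2 * h) ^ (1 + 2 * α) * h ^ (1 / 2 - α)) *
        ∫⁻ x in Ioo (0 : ℝ) 1, ∫⁻ y in Ioo (0 : ℝ) 1,
          ENNReal.ofReal (‖f x - f y‖ ^ 2 / |x - y| ^ (1 + 2 * α))) := by
  set q : ℝ → ℝ → ℝ≥0∞ := fun x y =>
    ENNReal.ofReal (‖f x - f y‖ ^ 2 / |x - y| ^ (1 + 2 * α)) with hq
  set B := ENNReal.ofReal ((2 * h) ^ (1 + 2 * α) * h ^ (1 / 2 - α)) with hB
  set L := ENNReal.ofReal (h ^ (α - 1 / 2)) with hL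
  have hqm : Measurable fun p : ℝ × ℝ => q p.1 p.2 := by fun_prop
  have hqx : ∀ x, Measurable (q x) := fun x => by fun_prop
  -- Young's inequality with a weight chosen so that both error terms scale alike
  have hpt : ∀ x ∈ Ioo 0 h, ∀ y ∈ Ioo 0 (2 * h), ‖f x‖ₑ ≤ ‖f y‖ₑ + (L + B * q x y) := by
    intro x hx y hy
    have h1 : ‖f x‖ₑ ≤ ‖f y‖ₑ + ‖f x - f y‖ₑ := by
      have := enorm_add_le (f y) (f x - f y)
      rwa [add_sub_cancel] at this
    refine h1.trans (add_le_add le_rfl ?_)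
    rw [hL, hB, hq, ← ENNReal.ofReal_mul (by positivity), ← ENNReal.ofReal_add (by positivity)
      (by positivity), ← ofReal_norm]
    apply ENNReal.ofReal_le_ofReal
    rcases eq_or_ne x y with rfl | hxy
    · rw [sub_self, norm_zero]; positivity
    have hd : 0 < |x - y| := abs_pos.2 (sub_ne_zero.2 hxy)
    have hd2 : |x - y| ≤ 2 * h := by
      rw [abs_le]; constructor <;> linarith [hx.1, hx.2, hy.1, hy.2]
    have hp : |x - y| ^ (1 + 2 * α) ≤ (2 * h) ^ (1 + 2 * α) :=
      Real.rpow_le_rpow hd.le hd2 (by linarith)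
    have hpp : 0 < |x - y| ^ (1 + 2 * α) := Real.rpow_pos_of_pos hd _
    set d := ‖f x - f y‖
    set l := h ^ (α - 1 / 2)
    have hl : 0 < l := Real.rpow_pos_of_pos hh _
    have hl' : h ^ (1 / 2 - α) = l⁻¹ := by
      rw [← Real.rpow_neg hh.le]; congr 1; ring
    rw [hl']
    have e1 : d ^ 2 ≤ (2 * h) ^ (1 + 2 * α) * (d ^ 2 / |x - y| ^ (1 + 2 * α)) := by
      rw [mul_div_assoc', le_div_iff₀ hpp, mul_comm]
      gcongr
    have e2 : d ≤ l + l⁻¹ * d ^ 2 := by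
      have : 0 ≤ l⁻¹ * ((d - l) ^ 2 + d * l) := by positivity
      have e3 : l⁻¹ * ((d - l) ^ 2 + d * l) = l⁻¹ * d ^ 2 + l - d := by field_simp; ring
      linarith
    calc d ≤ l + l⁻¹ * d ^ 2 := e2
      _ ≤ l + l⁻¹ * ((2 * h) ^ (1 + 2 * α) * (d ^ 2 / |x - y| ^ (1 + 2 * α))) := by gcongr
      _ = _ := by ring
  have hfm : Measurable fun x => ‖f x‖ₑ := hm.enorm
  have h1 : ENNReal.ofReal (2 * h) * ∫⁻ x in Ioo 0 h, ‖f x‖ₑ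
      = ∫⁻ x in Ioo 0 h, ∫⁻ _ in Ioo 0 (2 * h), ‖f x‖ₑ := by
    rw [← lintegral_const_mul _ hfm]
    refine lintegral_congr fun x => ?_
    rw [setLIntegral_const, Real.volume_Ioo, sub_zero, mul_comm]
  have h2 : ∫⁻ x in Ioo 0 h, ∫⁻ _ in Ioo 0 (2 * h), ‖f x‖ₑ ≤
      ∫⁻ x in Ioo 0 h, ((∫⁻ y in Ioo 0 (2 * h), ‖f y‖ₑ) +
        (L * ENNReal.ofReal (2 * h) + B * ∫⁻ y in Ioo (0 : ℝ) 1, q x y)) := by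
    refine setLIntegral_mono' measurableSet_Ioo fun x hx => ?_
    calc _ ≤ ∫⁻ y in Ioo 0 (2 * h), (‖f y‖ₑ + (L + B * q x y)) :=
          setLIntegral_mono' measurableSet_Ioo fun y hy => hpt x hx y hy
      _ = (∫⁻ y in Ioo 0 (2 * h), ‖f y‖ₑ) +
          (L * ENNReal.ofReal (2 * h) + B * ∫⁻ y in Ioo 0 (2 * h), q x y) := by
          rw [lintegral_add_left hfm, lintegral_add_left measurable_const, setLIntegral_const,
            Real.volume_Ioo, sub_zero, lintegral_const_mul _ (hqx x)]
      _ ≤ _ := by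
          gcongr
  have hQm : Measurable fun x => ∫⁻ y in Ioo (0 : ℝ) 1, q x y := hqm.lintegral_prod_right'
  rw [h1]
  refine h2.trans ?_
  rw [lintegral_add_left measurable_const, lintegral_add_left measurable_const,
    setLIntegral_const, setLIntegral_const, Real.volume_Ioo, sub_zero, lintegral_const_mul _ hQm,
    mul_comm (ENNReal.ofReal h)]
  gcongr
  · rw [hL, ← ENNReal.ofReal_mul (by positivity), ← ENNReal.ofReal_mul (by positivity)]
    apply ENNReal.ofReal_le_ofReal
    refine le_of_eq ?_
    have : h ^ (3 / 2 + α) = h ^ (α - 1 / 2) * h * h := by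
      rw [show 3 / 2 + α = (α - 1 / 2) + 1 + 1 by ring, Real.rpow_add hh, Real.rpow_add hh,
        Real.rpow_one]
    rw [this]; ring
  · linarith

/-- `∫₀ʰ |f| = O(h^{(1 + α) / 2})` for `f` of finite Slobodeckij seminorm. -/
lemma exists_integral_norm_le {α : ℝ} (hα : 0 < α) (hα1 : α < 1) {f : ℝ → ℂ} (hm : Measurable f)
    (hf : FiniteSlobodeckij α f) (hi : IntegrableOn f (Ioo (0 : ℝ) 1)) :
    ∃ C : ℝ, 0 ≤ C ∧ ∀ h : ℝ, 0 < h → h ≤ 1 →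
      ∫ x in Ioo 0 h, ‖f x‖ ≤ C * h ^ ((1 + α) / 2) := by
  set S : ℝ := (∫⁻ x in Ioo (0 : ℝ) 1, ∫⁻ y in Ioo (0 : ℝ) 1,
    ENNReal.ofReal (‖f x - f y‖ ^ 2 / |x - y| ^ (1 + 2 * α))).toReal with hS
  have hS0 : 0 ≤ S := ENNReal.toReal_nonneg
  have hSe := ENNReal.ofReal_toReal (ne_of_lt hf)
  rw [← hS] at hSe
  set M : ℝ → ℝ := fun h => ∫ x in Ioo 0 h, ‖f x‖ with hM
  have hint : ∀ h ≤ 1, IntegrableOn f (Ioo (0 : ℝ) h) := fun h hh =>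
    hi.mono_set (Ioo_subset_Ioo_right hh)
  have hMe : ∀ h ≤ 1, ∫⁻ x in Ioo 0 h, ‖f x‖ₑ = ENNReal.ofReal (M h) := fun h hh =>
    (ofReal_integral_norm_eq_lintegral_enorm (hint h hh)).symm
  have hM0 : ∀ h, 0 ≤ M h := fun h => integral_nonneg fun _ => norm_nonneg _
  set β := (1 + α) / 2 with hβ
  set D : ℝ := 1 + 2 ^ (2 * α) * S with hD
  have hD0 : 0 ≤ D := by positivity
  -- one doubling step
  have hstep : ∀ h, 0 < h → 2 * h ≤ 1 → M h ≤ M (2 * h) / 2 + D * h ^ β := by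
    intro h hh hh2
    have h1 := lintegral_average_le hα hm hh hh2
    rw [hMe h (by linarith), hMe (2 * h) hh2, ← hSe, ← ENNReal.ofReal_mul (by positivity),
      ← ENNReal.ofReal_mul (by positivity), ← ENNReal.ofReal_mul (by positivity),
      ← ENNReal.ofReal_add (by positivity) (by positivity),
      ← ENNReal.ofReal_add (mul_nonneg hh.le (hM0 _)) (by positivity),
      ENNReal.ofReal_le_ofReal_iff (add_nonneg (mul_nonneg hh.le (hM0 _)) (by positivity))] at h1
    have e1 : h ^ (3 / 2 + α) = h * h ^ (1 / 2 + α) := by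
      rw [show 3 / 2 + α = 1 + (1 / 2 + α) by ring, Real.rpow_add hh, Real.rpow_one]
    have e2 : (2 * h) ^ (1 + 2 * α) * h ^ (1 / 2 - α) = 2 * 2 ^ (2 * α) * (h * h ^ (1 / 2 + α)) := by
      rw [Real.mul_rpow two_pos.le hh.le, Real.rpow_add two_pos, Real.rpow_one, mul_assoc,
        ← Real.rpow_add hh, show 1 + 2 * α + (1 / 2 - α) = 1 + (1 / 2 + α) by ring,
        Real.rpow_add hh, Real.rpow_one]
    rw [e1, e2] at h1
    have h3 : h * (2 * M h) ≤ h * (M (2 * h) + (2 * D) * h ^ (1 / 2 + α)) := by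
      rw [hD]; linarith
    have h4 := le_of_mul_le_mul_left h3 hh
    have h5 : h ^ (1 / 2 + α) ≤ h ^ β :=
      Real.rpow_le_rpow_of_exponent_ge hh (by linarith) (by rw [hβ]; linarith)
    have h6 : D * h ^ (1 / 2 + α) ≤ D * h ^ β := by gcongr
    linarith
  have h2β : (2 : ℝ) ^ β < 2 := by
    conv_rhs => rw [← Real.rpow_one 2]
    exact Real.rpow_lt_rpow_of_exponent_lt one_lt_two (by rw [hβ]; linarith)
  set K : ℝ := max (2 * M 1) (D / (1 - 2 ^ β / 2)) with hK
  have hK0 : 0 ≤ K := le_max_of_le_left (by have := hM0 1; linarith)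
  have hKD : D ≤ K * (1 - 2 ^ β / 2) := by
    rw [← div_le_iff₀ (by linarith)]; exact le_max_right _ _
  have hind : ∀ n : ℕ, ∀ h : ℝ, (1 / 2) ^ (n + 1) < h → h ≤ 1 → M h ≤ K * h ^ β := by
    intro n
    induction n with
    | zero =>
      intro h hh hh1
      have h0 : (0 : ℝ) < h := lt_trans (by norm_num) hh
      have e1 : M h ≤ M 1 := setIntegral_mono_set hi.norm
        (ae_of_all _ fun _ => norm_nonneg _) (Ioo_subset_Ioo_right hh1).eventuallyLE
      have e2 : h ≤ h ^ β := by
        conv_lhs => rw [← Real.rpow_one h]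
        exact Real.rpow_le_rpow_of_exponent_ge h0 hh1 (by rw [hβ]; linarith)
      have e3 : 2 * M 1 ≤ K := le_max_left _ _
      have e4 : (1 : ℝ) / 2 ≤ h ^ β := by
        have : (1 : ℝ) / 2 < h := by simpa using hh
        linarith
      have := hM0 1
      nlinarith
    | succ n ih =>
      intro h hh hh1
      rcases le_or_gt (2 * h) 1 with h2 | h2
      · have h0 : (0 : ℝ) < h := lt_trans (by positivity) hh
        have e1 := ih (2 * h) (by rw [pow_succ] at hh; linarith) h2
        have e2 := hstep h h0 h2
        rw [Real.mul_rpow two_pos.le h0.le] at e1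
        have hp : 0 < h ^ β := Real.rpow_pos_of_pos h0 _
        nlinarith
      · refine ih h ?_ hh1
        have : (1 / 2 : ℝ) ^ (n + 1) ≤ (1 / 2) ^ 1 :=
          pow_le_pow_of_le_one (by norm_num) (by norm_num) (by omega)
        rw [pow_one] at this
        linarith
  refine ⟨K, hK0, fun h hh hh1 => ?_⟩
  obtain ⟨n, hn⟩ := exists_pow_lt_of_lt_one hh (by norm_num : (1 / 2 : ℝ) < 1)
  refine hind n h (lt_of_le_of_lt ?_ hn) hh1
  exact pow_le_pow_of_le_one (by norm_num) (by norm_num) (by omega)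

end

section

open Filter Topology ENNReal

/-! ### Decay of the Fourier coefficients -/

/-- The coefficient `∫₀¹ f(x) e^{iπnx} dx`. -/
def expCoeff (n : ℤ) (f : ℝ → ℂ) : ℂ :=
  ∫ x in (0 : ℝ)..1, f x * Complex.exp (Real.pi * n * x * Complex.I)

lemma norm_exp_pi_mul_I (n : ℤ) (x : ℝ) : ‖Complex.exp (Real.pi * n * x * Complex.I)‖ = 1 := by
  have := Complex.norm_exp_ofReal_mul_I (Real.pi * n * x)
  push_cast at this
  exact this

/-- The Fourier coefficients on an interval of length two, written with exponentials. -/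
lemma fourierCoeffOn_two {a b : ℝ} (hab : a < b) (h2 : b - a = 2) (G : ℝ → ℂ) (n : ℤ) :
    fourierCoeffOn hab G n
      = 1 / 2 * ∫ x in a..b, G x * Complex.exp (Real.pi * (-n : ℤ) * x * Complex.I) := by
  rw [fourierCoeffOn_eq_integral, h2, Complex.real_smul]
  congr 1
  · norm_num
  · refine intervalIntegral.integral_congr fun x _ => ?_
    simp only [smul_eq_mul]
    rw [fourier_coe_apply, mul_comm]
    have e : 2 * (Real.pi : ℂ) * Complex.I * (-n : ℤ) * x / (2 : ℝ)
        = Real.pi * (-n : ℤ) * x * Complex.I := by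
      push_cast; ring
    rw [e]

lemma tsum_sq_coeff {a b : ℝ} (hab : a < b) (h2 : b - a = 2) {G : ℝ → ℂ}
    (hG : MemLp G 2 (volume.restrict (Ioc a b))) :
    ∑' n : ℤ, ENNReal.ofReal (‖fourierCoeffOn hab G n‖ ^ 2)
      = ENNReal.ofReal (1 / 2) * ∫⁻ x in Ioc a b, ENNReal.ofReal (‖G x‖ ^ 2) := by
  have h := hasSum_sq_fourierCoeffOn hab hG
  rw [← ENNReal.ofReal_tsum_of_nonneg (fun _ => by positivity) h.summable, h.tsum_eq, h2,
    smul_eq_mul, ENNReal.ofReal_mul (by norm_num), intervalIntegral.integral_of_le hab.le,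
    ofReal_integral_eq_lintegral_ofReal hG.integrable_norm_pow' (ae_of_all _ fun _ => by positivity)]
  norm_num

/-- Multiplication by `e^{iπnh} - 1` of a coefficient of `f` amounts to passing to the increments
of `f`, up to boundary terms. -/
lemma norm_expCoeff_le_increment {f : ℝ → ℂ} (hi : Integrable f) {h : ℝ} (h0 : 0 < h)
    (h1 : h < 1) (n : ℤ) (hc : Real.cos (Real.pi * n * h) ≤ 0) :
    ‖expCoeff n f‖ ≤ ‖∫ x in (0 : ℝ)..(1 - h), (f (x + h) - f x) *
        Complex.exp (Real.pi * n * x * Complex.I)‖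
      + (∫ x in Ioo 0 h, ‖f x‖) + ∫ x in Ioo (1 - h) 1, ‖f x‖ := by
  set e : ℝ → ℂ := fun x => Complex.exp (Real.pi * n * x * Complex.I) with he
  have hec : Continuous e := by fun_prop
  have hen : ∀ x, ‖e x‖ = 1 := norm_exp_pi_mul_I n
  have hfe : ∀ a b, IntervalIntegrable (fun x => f x * e x) volume a b := fun a b =>
    (hi.intervalIntegrable).mul_continuousOn hec.continuousOn
  set ω : ℂ := e (-h) with hω
  have hadd : ∀ x, e (x - h) = ω * e x := by
    intro x
    simp only [hω, he]
    rw [← Complex.exp_add]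
    push_cast
    ring_nf
  have hwn : ‖ω‖ = 1 := hen _
  have hshift : ∫ x in (0 : ℝ)..(1 - h), f (x + h) * e x
      = ω * ∫ x in h..1, f x * e x := by
    have h2 := intervalIntegral.integral_comp_add_right (a := 0) (b := 1 - h)
      (fun y => f y * e (y - h)) h
    simp only [add_sub_cancel_right, zero_add, sub_add_cancel] at h2
    rw [h2, ← intervalIntegral.integral_const_mul]
    refine intervalIntegral.integral_congr fun x _ => ?_
    simp only [hadd]
    ring
  have hsp1 : ∫ x in h..1, f x * e x = expCoeff n f - ∫ x in (0 : ℝ)..h, f x * e x := by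
    rw [eq_sub_iff_add_eq, add_comm]
    exact intervalIntegral.integral_add_adjacent_intervals (hfe _ _) (hfe _ _)
  have hsp2 : ∫ x in (0 : ℝ)..(1 - h), f x * e x
      = expCoeff n f - ∫ x in (1 - h)..1, f x * e x := by
    rw [eq_sub_iff_add_eq]
    exact intervalIntegral.integral_add_adjacent_intervals (hfe _ _) (hfe _ _)
  have hfe' : IntervalIntegrable (fun x => f (x + h) * e x) volume 0 (1 - h) :=
    ((hi.comp_add_right h).intervalIntegrable).mul_continuousOn hec.continuousOn
  have hmain : (ω - 1) * expCoeff n f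
      = (∫ x in (0 : ℝ)..(1 - h), (f (x + h) - f x) * e x)
        + ω * (∫ x in (0 : ℝ)..h, f x * e x) - ∫ x in (1 - h)..1, f x * e x := by
    simp_rw [sub_mul]
    rw [intervalIntegral.integral_sub hfe' (hfe _ _), hshift, hsp1, hsp2]
    ring
  have hb : ∀ a b : ℝ, a ≤ b → ‖∫ x in a..b, f x * e x‖ ≤ ∫ x in Ioo a b, ‖f x‖ := by
    intro a b hab
    rw [intervalIntegral.integral_of_le hab, integral_Ioc_eq_integral_Ioo]
    refine (norm_integral_le_integral_norm _).trans (le_of_eq ?_)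
    congr 1
    ext x
    rw [norm_mul, hen, mul_one]
  have hω1 : 1 ≤ ‖ω - 1‖ := by
    have h3 : (ω - 1).re = Real.cos (Real.pi * n * h) - 1 := by
      have h4 : ω = Complex.exp (((-(Real.pi * n * h) : ℝ) : ℂ) * Complex.I) := by
        rw [hω, he]; push_cast; ring_nf
      rw [Complex.sub_re, Complex.one_re, h4, Complex.exp_ofReal_mul_I_re, Real.cos_neg]
    have h5 := Complex.abs_re_le_norm (ω - 1)
    rw [h3, abs_of_nonpos (by linarith)] at h5
    linarith
  calc ‖expCoeff n f‖ ≤ ‖ω - 1‖ * ‖expCoeff n f‖ := le_mul_of_one_le_left (norm_nonneg _) hω1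
    _ = ‖(ω - 1) * expCoeff n f‖ := (norm_mul _ _).symm
    _ ≤ _ := by
        rw [hmain]
        refine (norm_sub_le _ _).trans (add_le_add ((norm_add_le _ _).trans (add_le_add le_rfl ?_))
          (hb _ _ (by linarith)))
        rw [norm_mul, hwn, one_mul]
        exact hb _ _ h0.le

/-- For `f` of finite Slobodeckij seminorm, `|∫₀¹ f(x) e^{iπnx} dx|²` is the sum of a term summable
with the weight `|n|^{2α}` and of a term `O(|n|^{-(1 + α)})` coming from the end points. -/
lemma exists_expCoeff_bound_aux {α : ℝ} (hα : 0 < α) (hα1 : α < 1) {f : ℝ → ℂ} (hm : Measurable f)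
    (hf : FiniteSlobodeckij α f) (h2 : MemLp f 2) (hi : Integrable f) :
    ∃ (A : ℤ → ℝ) (C : ℝ), (∀ n, 0 ≤ A n) ∧ Summable (fun n : ℤ => |(n : ℝ)| ^ (2 * α) * A n) ∧
      ∀ n ≠ 0, ‖expCoeff (-n) f‖ ^ 2 ≤ A n + C * |(n : ℝ)| ^ (-(1 + α)) := by
  obtain ⟨C0, hC0, hM0⟩ := exists_integral_norm_le hα hα1 hm hf hi.integrableOn
  obtain ⟨C1, hC1, hM1⟩ := exists_integral_norm_le hα hα1 (f := fun x => f (1 - x))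
    (hm.comp (by fun_prop)) hf.reflect (hi.comp_sub_left 1).integrableOn
  have hM1' : ∀ h : ℝ, 0 < h → h ≤ 1 →
      ∫ x in Ioo (1 - h) 1, ‖f x‖ ≤ C1 * h ^ ((1 + α) / 2) := by
    intro h hh hh1
    refine le_of_eq_of_le ?_ (hM1 h hh hh1)
    rw [← integral_Ioc_eq_integral_Ioo, ← integral_Ioc_eq_integral_Ioo,
      ← intervalIntegral.integral_of_le (by linarith), ← intervalIntegral.integral_of_le hh.le,
      intervalIntegral.integral_comp_sub_left (fun x => ‖f x‖), sub_zero]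
  set C := C0 + C1 with hC
  have hCn : 0 ≤ C := by positivity
  set D := 2 * C ^ 2 with hD
  set G : ℝ → ℝ → ℂ := fun h => (Ioo 0 (1 - h)).indicator fun x => f (x + h) - f x with hG
  have hGm : ∀ h, MemLp (G h) 2 (volume.restrict (Ioc 0 2)) := by
    intro h
    refine MemLp.restrict _ (MemLp.indicator measurableSet_Ioo ?_)
    exact (h2.comp_measurePreserving (measurePreserving_add_right volume h)).sub h2
  set g : ℝ → ℤ → ℝ := fun h n => ‖fourierCoeffOn (zero_lt_two (α := ℝ)) (G h) n‖ with hg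
  have hgs : ∀ h, ∑' n : ℤ, ENNReal.ofReal (g h n ^ 2)
      = ENNReal.ofReal (1 / 2) * ∫⁻ x in Ioc 0 2, ENNReal.ofReal (‖G h x‖ ^ 2) :=
    fun h => tsum_sq_coeff _ (by norm_num) (hGm h)
  set A : ℤ → ℝ := fun n => max 0 (‖expCoeff (-n) f‖ ^ 2 - D * |(n : ℝ)| ^ (-(1 + α))) with hA
  have hA0 : ∀ n, 0 ≤ A n := fun n => le_max_left _ _
  -- the window of increments adapted to the frequency `n`
  set w : ℤ → Set ℝ := fun n => Ioo (1 / (2 * |(n : ℝ)|)) (1 / |(n : ℝ)|) with hw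
  have hwin : ∀ n ≠ 0, w n ⊆ Ioo 0 1 := by
    intro n hn x hx
    have h3 : (1 : ℝ) ≤ |(n : ℝ)| := by exact_mod_cast Int.one_le_abs hn
    exact ⟨lt_trans (by positivity) hx.1, hx.2.trans_le (by rw [div_le_one (by linarith)]; exact h3)⟩
  have hkey : ∀ n ≠ 0, ∀ h ∈ w n, A n ≤ 8 * g h n ^ 2 := by
    intro n hn h hh
    obtain ⟨hh0, hh1⟩ := hwin n hn hh
    have h3 : (1 : ℝ) ≤ |(n : ℝ)| := by exact_mod_cast Int.one_le_abs hn
    have hpi := Real.pi_pos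
    have hcos : Real.cos (Real.pi * (-n : ℤ) * h) ≤ 0 := by
      rw [← Real.cos_abs]
      have e1 : |Real.pi * ((-n : ℤ) : ℝ) * h| = Real.pi * (|(n : ℝ)| * h) := by
        rw [abs_mul, abs_mul, abs_of_pos hpi, abs_of_pos hh0]
        push_cast
        rw [abs_neg]; ring
      have e2 : 1 / 2 < |(n : ℝ)| * h := by
        have := hh.1
        rw [div_lt_iff₀ (by positivity)] at this
        linarith
      have e3 : |(n : ℝ)| * h < 1 := by
        have := hh.2
        rw [lt_div_iff₀ (by positivity)] at this
        linarith
      rw [e1]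
      apply Real.cos_nonpos_of_pi_div_two_le_of_le <;> nlinarith
    have h4 := norm_expCoeff_le_increment hi hh0 hh1 (-n) hcos
    have h5 : ‖∫ x in (0 : ℝ)..(1 - h), (f (x + h) - f x) *
        Complex.exp (Real.pi * (-n : ℤ) * x * Complex.I)‖ = 2 * g h n := by
      rw [hg]
      simp only
      rw [fourierCoeffOn_two _ (by norm_num), norm_mul, intervalIntegral.integral_of_le zero_le_two,
        intervalIntegral.integral_of_le (by linarith), integral_Ioc_eq_integral_Ioo]
      have e1 : ∀ x, G h x * Complex.exp (Real.pi * (-n : ℤ) * x * Complex.I)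
          = (Ioo 0 (1 - h)).indicator (fun x => (f (x + h) - f x) *
            Complex.exp (Real.pi * (-n : ℤ) * x * Complex.I)) x := by
        intro x
        by_cases hx : x ∈ Ioo 0 (1 - h)
        · simp only [hG, indicator_of_mem hx]
        · simp only [hG, indicator_of_notMem hx, zero_mul]
      simp_rw [e1]
      rw [setIntegral_indicator measurableSet_Ioo, inter_eq_self_of_subset_right]
      · norm_num
        ring
      · intro x hx; exact ⟨hx.1, by linarith [hx.2]⟩
    rw [h5] at h4
    have h6 := hM0 h hh0 hh1.le
    have h7 := hM1' h hh0 hh1.le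
    have h8 : (h ^ ((1 + α) / 2)) ^ 2 ≤ |(n : ℝ)| ^ (-(1 + α)) := by
      rw [← Real.rpow_natCast, ← Real.rpow_mul hh0.le, Real.rpow_neg (by positivity),
        ← Real.inv_rpow (by positivity)]
      rw [show (1 + α) / 2 * ((2 : ℕ) : ℝ) = 1 + α by push_cast; ring]
      refine Real.rpow_le_rpow hh0.le ?_ (by linarith)
      rw [← one_div]
      exact hh.2.le
    set p := h ^ ((1 + α) / 2)
    have h9 : ‖expCoeff (-n) f‖ ≤ 2 * g h n + C * p := by rw [hC]; linarith
    have hgn : 0 ≤ g h n := norm_nonneg _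
    have hp : 0 ≤ p := by positivity
    have h10 : ‖expCoeff (-n) f‖ ^ 2 ≤ (2 * g h n + C * p) ^ 2 := by gcongr
    refine max_le (by positivity) ?_
    have h11 : D * p ^ 2 ≤ D * |(n : ℝ)| ^ (-(1 + α)) := by gcongr
    rw [hD] at h11 ⊢
    nlinarith [sq_nonneg (2 * g h n - C * p)]
  have hlast : ∀ n : ℤ, n ≠ 0 → ‖expCoeff (-n) f‖ ^ 2 ≤ A n + D * |(n : ℝ)| ^ (-(1 + α)) :=
    fun n _ => sub_le_iff_le_add.1 (le_max_right _ _)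
  refine ⟨A, D, hA0, ?_, hlast⟩
  -- summability
  have hpos : ∀ n : ℤ, 0 ≤ |(n : ℝ)| ^ (2 * α) * A n := fun n =>
    mul_nonneg (by positivity) (hA0 n)
  have hwm : ∀ n, MeasurableSet (w n) := fun n => measurableSet_Ioo
  have hterm : ∀ n : ℤ, ENNReal.ofReal (1 / 2) * ENNReal.ofReal (|(n : ℝ)| ^ (2 * α) * A n)
      ≤ ∫⁻ h in Ioo 0 1, (w n).indicator (fun h =>
        ENNReal.ofReal (A n) * ENNReal.ofReal (h ^ (-(1 + 2 * α)))) h := by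
    intro n
    rcases eq_or_ne n 0 with rfl | hn
    · simp [Real.zero_rpow (by linarith : 2 * α ≠ 0)]
    have h3 : (1 : ℝ) ≤ |(n : ℝ)| := by exact_mod_cast Int.one_le_abs hn
    have h3' : 0 < |(n : ℝ)| := by linarith
    rw [lintegral_indicator (hwm n), Measure.restrict_restrict (hwm n),
      inter_eq_self_of_subset_left (hwin n hn)]
    calc _ = ENNReal.ofReal (A n) * ENNReal.ofReal (|(n : ℝ)| ^ (1 + 2 * α)) * volume (w n) := by
          rw [hw, Real.volume_Ioo, ← ENNReal.ofReal_mul (by norm_num), ← ENNReal.ofReal_mul (hA0 n),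
            ← ENNReal.ofReal_mul (mul_nonneg (hA0 n) (by positivity))]
          congr 1
          rw [Real.rpow_add h3', Real.rpow_one]
          field_simp
          ring
      _ = ∫⁻ _ in w n, ENNReal.ofReal (A n) * ENNReal.ofReal (|(n : ℝ)| ^ (1 + 2 * α)) :=
          (setLIntegral_const _ _).symm
      _ ≤ _ := by
          refine setLIntegral_mono' (hwm n) fun h hh => ?_
          have hh0 := (hwin n hn hh).1
          gcongr
          rw [Real.rpow_neg hh0.le, ← Real.inv_rpow hh0.le]
          refine Real.rpow_le_rpow h3'.le ?_ (by linarith)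
          rw [le_inv_comm₀ h3' hh0, ← one_div]
          exact hh.2.le
  have hsum : ∑' n : ℤ, ENNReal.ofReal (1 / 2) * ENNReal.ofReal (|(n : ℝ)| ^ (2 * α) * A n)
      < ⊤ := by
    calc _ ≤ ∑' n : ℤ, ∫⁻ h in Ioo 0 1, (w n).indicator (fun h =>
            ENNReal.ofReal (A n) * ENNReal.ofReal (h ^ (-(1 + 2 * α)))) h :=
          ENNReal.tsum_le_tsum hterm
      _ = ∫⁻ h in Ioo 0 1, ∑' n : ℤ, (w n).indicator (fun h =>
            ENNReal.ofReal (A n) * ENNReal.ofReal (h ^ (-(1 + 2 * α)))) h := by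
          rw [lintegral_tsum]
          intro n
          exact (Measurable.indicator (by fun_prop) (hwm n)).aemeasurable
      _ ≤ ∫⁻ h in Ioo (0 : ℝ) 1, 4 * ∫⁻ x in Ioo (0 : ℝ) 1 ∩ {x | x + h ∈ Ioo (0 : ℝ) 1},
            ENNReal.ofReal (‖f (x + h) - f x‖ ^ 2 / |h| ^ (1 + 2 * α)) := by
          refine setLIntegral_mono' measurableSet_Ioo fun h hh => ?_
          have hset : Ioo (0 : ℝ) 1 ∩ {x | x + h ∈ Ioo (0 : ℝ) 1} = Ioo 0 (1 - h) := by
            ext x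
            simp only [mem_inter_iff, mem_Ioo, mem_ofPred_eq]
            constructor
            · rintro ⟨⟨a, b⟩, c, d⟩; exact ⟨a, by linarith⟩
            · rintro ⟨a, b⟩; have := hh.1; exact ⟨⟨a, by linarith⟩, by linarith, by linarith⟩
          have hGx : ∀ x, ENNReal.ofReal (‖G h x‖ ^ 2) = (Ioo 0 (1 - h)).indicator (fun x =>
              ENNReal.ofReal (‖f (x + h) - f x‖ ^ 2)) x := by
            intro x
            by_cases hx : x ∈ Ioo 0 (1 - h)
            · simp only [hG, indicator_of_mem hx]
            · simp only [hG, indicator_of_notMem hx]; simp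
          have hGint : ∫⁻ x in Ioc 0 2, ENNReal.ofReal (‖G h x‖ ^ 2)
              = ∫⁻ x in Ioo 0 (1 - h), ENNReal.ofReal (‖f (x + h) - f x‖ ^ 2) := by
            simp_rw [hGx]
            rw [lintegral_indicator measurableSet_Ioo, Measure.restrict_restrict measurableSet_Ioo,
              inter_eq_self_of_subset_left]
            intro x hx; exact ⟨hx.1, by linarith [hx.2, hh.1]⟩
          have hfm2 : Measurable fun x => ENNReal.ofReal (‖f (x + h) - f x‖ ^ 2) := by fun_prop
          have hh0 : 0 < h := hh.1
          calc _ ≤ ∑' n : ℤ, ENNReal.ofReal (h ^ (-(1 + 2 * α))) * (ENNReal.ofReal 8 *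
                ENNReal.ofReal (g h n ^ 2)) := by
                refine ENNReal.tsum_le_tsum fun n => ?_
                by_cases hhn : h ∈ w n
                · have hn0 : n ≠ 0 := by
                    rintro rfl
                    simp [hw] at hhn
                  have hk : ENNReal.ofReal (A n) ≤ ENNReal.ofReal 8 * ENNReal.ofReal (g h n ^ 2) := by
                    rw [← ENNReal.ofReal_mul (by norm_num)]
                    exact ENNReal.ofReal_le_ofReal (hkey n hn0 h hhn)
                  rw [indicator_of_mem hhn, mul_comm]
                  gcongr
                · rw [indicator_of_notMem hhn]; exact zero_le
            _ = ENNReal.ofReal (h ^ (-(1 + 2 * α))) * (ENNReal.ofReal 8 * (ENNReal.ofReal (1 / 2) *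
                  ∫⁻ x in Ioo 0 (1 - h), ENNReal.ofReal (‖f (x + h) - f x‖ ^ 2))) := by
                rw [ENNReal.tsum_mul_left, ENNReal.tsum_mul_left, hgs, hGint]
            _ = 4 * ∫⁻ x in Ioo 0 (1 - h), ENNReal.ofReal (h ^ (-(1 + 2 * α))) *
                  ENNReal.ofReal (‖f (x + h) - f x‖ ^ 2) := by
                rw [lintegral_const_mul _ hfm2, ← mul_assoc (ENNReal.ofReal 8),
                  ← ENNReal.ofReal_mul (by norm_num)]
                norm_num
                ring
            _ = _ := by
                rw [hset]
                congr 1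
                refine lintegral_congr fun x => ?_
                rw [← ENNReal.ofReal_mul (by positivity), Real.rpow_neg hh0.le, abs_of_pos hh0]
                congr 1
                field_simp
      _ ≤ ∫⁻ h : ℝ, 4 * ∫⁻ x in Ioo (0 : ℝ) 1 ∩ {x | x + h ∈ Ioo (0 : ℝ) 1},
            ENNReal.ofReal (‖f (x + h) - f x‖ ^ 2 / |h| ^ (1 + 2 * α)) :=
          setLIntegral_le_lintegral _ _
      _ = 4 * ∫⁻ h : ℝ, ∫⁻ x in Ioo (0 : ℝ) 1 ∩ {x | x + h ∈ Ioo (0 : ℝ) 1},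
            ENNReal.ofReal (‖f (x + h) - f x‖ ^ 2 / |h| ^ (1 + 2 * α)) :=
          lintegral_const_mul' _ _ (by norm_num)
      _ < ⊤ := by
          rw [← slobodeckij_eq_increments α hm]
          exact ENNReal.mul_lt_top (by norm_num) hf
  rw [ENNReal.tsum_mul_left] at hsum
  have hne : ∑' n : ℤ, ENNReal.ofReal (|(n : ℝ)| ^ (2 * α) * A n) ≠ ⊤ := by
    intro h
    rw [h, ENNReal.mul_top (by norm_num)] at hsum
    exact lt_irrefl _ hsum
  have := ENNReal.summable_toReal hne
  simpa only [ENNReal.toReal_ofReal (hpos _)] using this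

end

section

open Filter Topology

/-! ### Functions with a weak derivative -/

/-- Integration by parts against a primitive. -/
lemma integral_primitive_mul_deriv {v : ℝ → ℂ} (hv : IntervalIntegrable v volume 0 1)
    {u u' : ℝ → ℂ} (hu : ∀ x, HasDerivAt u (u' x) x) (hu' : Continuous u') :
    ∫ x in (0 : ℝ)..1, (∫ t in (0 : ℝ)..x, v t) * u' x
      = (∫ x in (0 : ℝ)..1, v x) * u 1 - ∫ x in (0 : ℝ)..1, v x * u x := by
  set μ : Measure ℝ := volume.restrict (Ioc (0 : ℝ) 1) with hμ
  have hvi : Integrable v μ := (intervalIntegrable_iff_integrableOn_Ioc_of_le zero_le_one).1 hv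
  have hui : Integrable u' μ :=
    (intervalIntegrable_iff_integrableOn_Ioc_of_le zero_le_one).1 (hu'.intervalIntegrable _ _)
  have huc : Continuous u := continuous_iff_continuousAt.2 fun x => (hu x).continuousAt
  set k : ℝ → ℝ → ℂ := fun x t => {p : ℝ × ℝ | p.2 ≤ p.1}.indicator (fun p => u' p.1 * v p.2) (x, t)
    with hk
  have hms : MeasurableSet {p : ℝ × ℝ | p.2 ≤ p.1} := measurableSet_le measurable_snd measurable_fst
  have hki : Integrable (Function.uncurry k) (μ.prod μ) := (hui.mul_prod hvi).indicator hms
  have h1 : ∀ x ∈ Ioc (0 : ℝ) 1, (∫ t in (0 : ℝ)..x, v t) * u' x = ∫ t, k x t ∂μ := by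
    intro x hx
    have e : ∀ t, k x t = (Iic x).indicator (fun t => v t * u' x) t := by
      intro t
      by_cases ht : t ≤ x
      · simp only [hk]
        rw [indicator_of_mem (show (x, t) ∈ {p : ℝ × ℝ | p.2 ≤ p.1} from ht),
          indicator_of_mem (show t ∈ Iic x from ht), mul_comm]
      · simp only [hk]
        rw [indicator_of_notMem (show (x, t) ∉ {p : ℝ × ℝ | p.2 ≤ p.1} from ht),
          indicator_of_notMem (show t ∉ Iic x from ht)]
    simp_rw [e]
    rw [integral_indicator measurableSet_Iic, hμ, Measure.restrict_restrict measurableSet_Iic,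
      intervalIntegral.integral_of_le hx.1.le, ← integral_mul_const]
    congr 2
    ext t
    simp only [mem_Ioc, mem_inter_iff, mem_Iic]
    constructor
    · rintro ⟨a, b⟩; exact ⟨b, a, b.trans hx.2⟩
    · rintro ⟨a, b, c⟩; exact ⟨b, a⟩
  have h2 : ∀ t ∈ Ioc (0 : ℝ) 1, ∫ x, k x t ∂μ = v t * u 1 - v t * u t := by
    intro t ht
    have e : ∀ x, k x t = (Ici t).indicator (fun x => v t * u' x) x := by
      intro x
      by_cases hx : t ≤ x
      · simp only [hk]
        rw [indicator_of_mem (show (x, t) ∈ {p : ℝ × ℝ | p.2 ≤ p.1} from hx),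
          indicator_of_mem (show x ∈ Ici t from hx), mul_comm]
      · simp only [hk]
        rw [indicator_of_notMem (show (x, t) ∉ {p : ℝ × ℝ | p.2 ≤ p.1} from hx),
          indicator_of_notMem (show x ∉ Ici t from hx)]
    simp_rw [e]
    rw [integral_indicator measurableSet_Ici, hμ, Measure.restrict_restrict measurableSet_Ici,
      integral_const_mul]
    have e2 : Ici t ∩ Ioc 0 1 = Icc t 1 := by
      ext x
      simp only [mem_Ioc, mem_inter_iff, mem_Ici, mem_Icc]
      constructor
      · rintro ⟨a, b, c⟩; exact ⟨a, c⟩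
      · rintro ⟨a, b⟩; exact ⟨a, ht.1.trans_le a, b⟩
    rw [e2, integral_Icc_eq_integral_Ioc, ← intervalIntegral.integral_of_le ht.2,
      intervalIntegral.integral_eq_sub_of_hasDerivAt (fun x _ => hu x)
        (hu'.intervalIntegrable _ _)]
    ring
  rw [intervalIntegral.integral_of_le zero_le_one, setIntegral_congr_fun measurableSet_Ioc h1,
    integral_integral_swap hki, setIntegral_congr_fun measurableSet_Ioc h2,
    ← intervalIntegral.integral_of_le zero_le_one, intervalIntegral.integral_sub,
    intervalIntegral.integral_mul_const]
  · exact hv.mul_const _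
  · exact hv.mul_continuousOn huc.continuousOn

lemma tsupport_eq_zero_of_notMem {φ : ℝ → ℂ} {x : ℝ} (hs : tsupport φ ⊆ Ioo (0 : ℝ) 1)
    (hx : x ∉ Ioo (0 : ℝ) 1) : φ x = 0 := image_eq_zero_of_notMem_tsupport fun h => hx (hs h)

/-- The primitive of an integrable function has that function as its weak derivative. -/
lemma isWeakDeriv_primitive {v : ℝ → ℂ} (hv : IntervalIntegrable v volume 0 1) (c : ℂ) :
    IsWeakDeriv (fun x => c + ∫ t in (0 : ℝ)..x, v t) v := by
  intro φ hφ _ hs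
  have h1 : φ 1 = 0 := tsupport_eq_zero_of_notMem hs (by simp)
  have h0 : φ 0 = 0 := tsupport_eq_zero_of_notMem hs (by simp)
  have hd : ∀ x, HasDerivAt φ (deriv φ x) x := fun x =>
    (hφ.differentiable (by simp) x).hasDerivAt
  have hc : Continuous (deriv φ) := hφ.continuous_deriv (by simp)
  have hpc : ContinuousOn (fun x => ∫ t in (0 : ℝ)..x, v t) (uIcc 0 1) :=
    intervalIntegral.continuousOn_primitive_interval
      (by rw [uIcc_of_le zero_le_one]
          exact (intervalIntegrable_iff_integrableOn_Icc_of_le zero_le_one).1 hv)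
  rw [← integral_Ioc_eq_integral_Ioo, ← integral_Ioc_eq_integral_Ioo,
    ← intervalIntegral.integral_of_le zero_le_one, ← intervalIntegral.integral_of_le zero_le_one]
  simp_rw [add_mul]
  rw [intervalIntegral.integral_add, integral_primitive_mul_deriv hv hd hc,
    intervalIntegral.integral_const_mul,
    intervalIntegral.integral_eq_sub_of_hasDerivAt (fun x _ => hd x) (hc.intervalIntegrable _ _),
    h0, h1]
  · ring
  · exact (continuous_const.mul hc).intervalIntegrable _ _
  · exact (hpc.mul hc.continuousOn).intervalIntegrable

/-- A smooth function supported in a compact subset of `(0, 1)` and of mean zero is the derivative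
of such a function. -/
lemma exists_primitive_compactSupport {θ : ℝ → ℝ} (hθ : ContDiff ℝ ((⊤ : ℕ∞) : WithTop ℕ∞) θ)
    (hc : HasCompactSupport θ) (hs : tsupport θ ⊆ Ioo (0 : ℝ) 1)
    (h0 : ∫ x in (0 : ℝ)..1, θ x = 0) :
    ∃ φ : ℝ → ℂ, ContDiff ℝ ((⊤ : ℕ∞) : WithTop ℕ∞) φ ∧ HasCompactSupport φ ∧
      tsupport φ ⊆ Ioo (0 : ℝ) 1 ∧ ∀ x, deriv φ x = θ x := by
  obtain ⟨a, b, ha, hb, hK⟩ : ∃ a b : ℝ, 0 < a ∧ b < 1 ∧ tsupport θ ⊆ Icc a b := by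
    rcases (tsupport θ).eq_empty_or_nonempty with h | h
    · exact ⟨1 / 2, 1 / 2, by norm_num, by norm_num, by rw [h]; exact empty_subset _⟩
    · exact ⟨sInf (tsupport θ), sSup (tsupport θ), (hs (IsCompact.sInf_mem hc h)).1,
        (hs (IsCompact.sSup_mem hc h)).2, fun x hx =>
          ⟨csInf_le (IsCompact.bddBelow hc) hx, le_csSup (IsCompact.bddAbove hc) hx⟩⟩
  have hz : ∀ x, x ∉ Icc a b → θ x = 0 := fun x hx =>
    image_eq_zero_of_notMem_tsupport fun h => hx (hK h)
  set P : ℝ → ℝ := fun x => ∫ t in (0 : ℝ)..x, θ t with hP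
  have hPd : ∀ x, HasDerivAt P (θ x) x := fun x =>
    (hθ.continuous.integral_hasStrictDerivAt 0 x).hasDerivAt
  have hPs : ContDiff ℝ ((⊤ : ℕ∞) : WithTop ℕ∞) P := by
    rw [contDiff_infty_iff_deriv]
    refine ⟨fun x => (hPd x).differentiableAt, ?_⟩
    rwa [show deriv P = θ from funext fun x => (hPd x).deriv]
  have hP0 : ∀ x, x ∉ Icc a b → P x = 0 := by
    intro x hx
    by_cases hxa : x < a
    · refine intervalIntegral.integral_zero_ae (ae_of_all _ fun t ht => hz t fun h => ?_)
      have h1 := ht.2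
      have h2 : max 0 x < a := max_lt ha hxa
      linarith [h.1]
    · have hxb : b < x := by
        by_contra h
        exact hx ⟨not_lt.1 hxa, not_lt.1 h⟩
      have h1 : P x = (∫ t in (0 : ℝ)..1, θ t) + ∫ t in (1 : ℝ)..x, θ t :=
        (intervalIntegral.integral_add_adjacent_intervals
          (hθ.continuous.intervalIntegrable _ _) (hθ.continuous.intervalIntegrable _ _)).symm
      rw [h1, h0, zero_add]
      refine intervalIntegral.integral_zero_ae (ae_of_all _ fun t ht => hz t fun h => ?_)
      have h1 := ht.1
      have h2 : b < min 1 x := lt_min hb hxb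
      linarith [h.2]
  have hsupp : tsupport (fun x => (P x : ℂ)) ⊆ Icc a b := by
    refine closure_minimal ?_ isClosed_Icc
    intro x hx
    by_contra h
    exact hx (by simp [hP0 x h])
  refine ⟨fun x => (P x : ℂ), Complex.ofRealCLM.contDiff.comp hPs,
    isCompact_Icc.of_isClosed_subset (isClosed_tsupport _) hsupp, hsupp.trans ?_,
    fun x => (hPd x).ofReal_comp.deriv⟩
  intro x hx
  exact ⟨ha.trans_le hx.1, hx.2.trans_lt hb⟩

/-- The lemma of du Bois-Reymond: a function with an integrable weak derivative is, up to a
constant, the primitive of that derivative. -/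
theorem IsWeakDeriv.ae_eq_primitive {f g : ℝ → ℂ} (h : IsWeakDeriv f g)
    (hf : IntervalIntegrable f volume 0 1) (hg : IntervalIntegrable g volume 0 1) :
    ∃ c : ℂ, f =ᵐ[volume.restrict (Ioo (0 : ℝ) 1)] fun x => c + ∫ t in (0 : ℝ)..x, g t := by
  have hfi : IntegrableOn f (Ioo (0 : ℝ) 1) :=
    (intervalIntegrable_iff_integrableOn_Ioo_of_le zero_le_one).1 hf
  have hgi : IntegrableOn g (Icc (0 : ℝ) 1) :=
    (intervalIntegrable_iff_integrableOn_Icc_of_le zero_le_one).1 hg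
  set F : ℝ → ℂ := fun x => ∫ t in (0 : ℝ)..x, g t with hF
  have hFc : ContinuousOn F (Icc 0 1) := intervalIntegral.continuousOn_primitive_interval
    (by rwa [uIcc_of_le zero_le_one]) |>.mono (by rw [uIcc_of_le zero_le_one])
  have hFi : IntegrableOn F (Ioo (0 : ℝ) 1) :=
    hFc.integrableOn_Icc.mono_set Ioo_subset_Icc_self
  set H : ℝ → ℂ := fun x => f x - F x with hH
  have hHi : IntegrableOn H (Ioo (0 : ℝ) 1) := hfi.sub hFi
  have hmul : ∀ {k : ℝ → ℂ} {φ : ℝ → ℂ}, IntegrableOn k (Ioo (0 : ℝ) 1) → Continuous φ →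
      IntegrableOn (fun x => k x * φ x) (Ioo (0 : ℝ) 1) := by
    intro k φ hk hφ
    rw [← intervalIntegrable_iff_integrableOn_Ioo_of_le zero_le_one] at hk ⊢
    exact hk.mul_continuousOn hφ.continuousOn
  -- `H` is orthogonal to all derivatives of test functions
  have horth : ∀ φ : ℝ → ℂ, ContDiff ℝ ((⊤ : ℕ∞) : WithTop ℕ∞) φ → HasCompactSupport φ →
      tsupport φ ⊆ Ioo (0 : ℝ) 1 → ∫ x in Ioo (0 : ℝ) 1, H x * deriv φ x = 0 := by
    intro φ hφ hc hs
    have h1 := h φ hφ hc hs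
    have h2 := isWeakDeriv_primitive hg 0 φ hφ hc hs
    simp only [zero_add] at h2
    have hdc : Continuous (deriv φ) := hφ.continuous_deriv (by simp)
    simp only [hH, sub_mul]
    rw [integral_sub (hmul hfi hdc) (hmul hFi hdc), h1, h2, sub_self]
  -- a fixed weight of mass one
  let B : ContDiffBump (1 / 2 : ℝ) := ⟨1 / 8, 1 / 4, by norm_num, by norm_num⟩
  set w : ℝ → ℝ := B.normed volume with hw
  have hws : tsupport w ⊆ Ioo (0 : ℝ) 1 := by
    rw [hw, B.tsupport_normed_eq, Real.closedBall_eq_Icc]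
    intro x hx
    have h1 := hx.1
    have h2 := hx.2
    simp only [B] at h1 h2
    constructor <;> linarith
  have hwd : ContDiff ℝ ((⊤ : ℕ∞) : WithTop ℕ∞) w := B.contDiff_normed
  have hwc : HasCompactSupport w := B.hasCompactSupport_normed
  have hw1 : ∫ x in (0 : ℝ)..1, w x = 1 := by
    rw [intervalIntegral.integral_eq_integral_of_support_subset, B.integral_normed]
    exact (subset_tsupport _).trans (hws.trans Ioo_subset_Ioc_self)
  set c : ℂ := ∫ x in Ioo (0 : ℝ) 1, H x * w x with hc
  refine ⟨c, ?_⟩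
  have hcont : ∀ {ψ : ℝ → ℝ}, Continuous ψ → Continuous fun x => (ψ x : ℂ) := fun hψ =>
    Complex.continuous_ofReal.comp hψ
  have hloc : LocallyIntegrableOn (fun x => H x - c) (Ioo (0 : ℝ) 1) :=
    (hHi.sub (integrableOn_const (by simp))).locallyIntegrableOn
  have hzero := isOpen_Ioo.ae_eq_zero_of_integral_contDiff_smul_eq_zero hloc (by
    intro ψ hψ hψc hψs
    set m : ℝ := ∫ x in (0 : ℝ)..1, ψ x with hm
    have hθs : tsupport (fun x => ψ x - m * w x) ⊆ Ioo (0 : ℝ) 1 := by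
      refine (closure_minimal (t := tsupport ψ ∪ tsupport w) ?_
        ((isClosed_tsupport _).union (isClosed_tsupport _))).trans (union_subset hψs hws)
      intro x hx
      by_contra hcon
      rw [mem_union, not_or] at hcon
      refine hx ?_
      simp [image_eq_zero_of_notMem_tsupport hcon.1, image_eq_zero_of_notMem_tsupport hcon.2]
    obtain ⟨φ, hφ, hφc, hφs, hφd⟩ := exists_primitive_compactSupport (θ := fun x => ψ x - m * w x)
      (hψ.sub (contDiff_const.mul hwd)) (hψc.sub hwc.mul_left) hθs (by
        rw [intervalIntegral.integral_sub (hψ.continuous.intervalIntegrable _ _)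
          ((hwd.continuous.intervalIntegrable _ _).const_mul m),
          intervalIntegral.integral_const_mul, hw1, mul_one, sub_self])
    have h1 := horth φ hφ hφc hφs
    simp_rw [hφd] at h1
    have hψi := hmul hHi (hcont hψ.continuous)
    have hwi := hmul hHi (hcont hwd.continuous)
    have e1 : ∀ x, H x * ((ψ x - m * w x : ℝ) : ℂ) = H x * ψ x - m * (H x * w x) := by
      intro x; push_cast; ring
    simp_rw [e1] at h1
    rw [integral_sub hψi (hwi.const_mul _), integral_const_mul, ← hc, sub_eq_zero] at h1
    have e2 : ∫ x, ψ x • (H x - c) = ∫ x in Ioo (0 : ℝ) 1, ψ x • (H x - c) := by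
      refine (setIntegral_eq_integral_of_forall_compl_eq_zero fun x hx => ?_).symm
      rw [image_eq_zero_of_notMem_tsupport fun h => hx (hψs h), zero_smul]
    have e3 : ∀ x, ψ x • (H x - c) = H x * ψ x - c * ψ x := by
      intro x; rw [Complex.real_smul]; ring
    have hψ1 : IntegrableOn (fun x => (ψ x : ℂ)) (Ioo (0 : ℝ) 1) :=
      (hcont hψ.continuous).integrableOn_Icc.mono_set Ioo_subset_Icc_self
    have e4 : ∫ x in Ioo (0 : ℝ) 1, (ψ x : ℂ) = m := by
      rw [hm, ← integral_Ioc_eq_integral_Ioo, ← intervalIntegral.integral_of_le zero_le_one,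
        intervalIntegral.integral_ofReal]
    rw [e2]
    simp_rw [e3]
    rw [integral_sub hψi (hψ1.const_mul _), integral_const_mul, h1, e4]
    ring)
  rw [Filter.EventuallyEq, ae_restrict_iff' measurableSet_Ioo]
  filter_upwards [hzero] with x hx hxm
  have := hx hxm
  simp only [hH] at this
  linear_combination this

end

section

open Filter Topology

/-! ### The spaces `W^α_2` for `0 < α ≤ 1` -/

lemma memW_iff_of_lt_one {α : ℝ} (h0 : 0 < α) (h1 : α < 1) {f : ℝ → ℂ} :
    MemW α f ↔ MemLp f 2 (volume.restrict (Ioo (0 : ℝ) 1)) ∧ FiniteSlobodeckij α f := by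
  have hfl : ⌊α⌋₊ = 0 := Nat.floor_eq_zero.2 h1
  have hfr : Int.fract α = α := Int.fract_eq_self.2 ⟨h0.le, h1⟩
  constructor
  · rintro ⟨D, rfl, h2, _, h4⟩
    rw [hfl, hfr] at *
    exact ⟨h2 0 le_rfl, h4 h0⟩
  · rintro ⟨h2, h3⟩
    refine ⟨fun _ => f, rfl, fun _ _ => h2, fun k hk => ?_, fun _ => ?_⟩
    · rw [hfl] at hk; omega
    · rwa [hfr]

lemma memW_one_iff {f : ℝ → ℂ} :
    MemW 1 f ↔ MemLp f 2 (volume.restrict (Ioo (0 : ℝ) 1)) ∧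
      ∃ g, MemLp g 2 (volume.restrict (Ioo (0 : ℝ) 1)) ∧ IsWeakDeriv f g := by
  have hfl : ⌊(1 : ℝ)⌋₊ = 1 := Nat.floor_one
  have hfr : Int.fract (1 : ℝ) = 0 := Int.fract_one
  constructor
  · rintro ⟨D, rfl, h2, h3, _⟩
    rw [hfl] at *
    exact ⟨h2 0 zero_le_one, D 1, h2 1 le_rfl, h3 0 zero_lt_one⟩
  · rintro ⟨h2, g, h3, h4⟩
    refine ⟨fun k => if k = 0 then f else g, rfl, fun k _ => ?_, fun k hk => ?_, fun h => ?_⟩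
    · by_cases hk : k = 0 <;> simp [hk, h2, h3]
    · rw [hfl] at hk
      obtain rfl : k = 0 := by omega
      simpa using h4
    · rw [hfr] at h; exact absurd h (lt_irrefl _)

lemma MemW.memLp {α : ℝ} {f : ℝ → ℂ} (hf : MemW α f) :
    MemLp f 2 (volume.restrict (Ioo (0 : ℝ) 1)) := by
  obtain ⟨D, rfl, h, _⟩ := hf
  exact h 0 (Nat.zero_le _)

lemma intervalIntegrable_of_memLp {f : ℝ → ℂ} (hf : MemLp f 2 (volume.restrict (Ioo (0 : ℝ) 1))) :
    IntervalIntegrable f volume 0 1 :=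
  (intervalIntegrable_iff_integrableOn_Ioo_of_le zero_le_one).2 (hf.integrable one_le_two)

lemma integrableOn_mul_continuous {k φ : ℝ → ℂ} (hk : IntegrableOn k (Ioo (0 : ℝ) 1))
    (hφ : Continuous φ) : IntegrableOn (fun x => k x * φ x) (Ioo (0 : ℝ) 1) := by
  rw [← intervalIntegrable_iff_integrableOn_Ioo_of_le zero_le_one] at hk ⊢
  exact hk.mul_continuousOn hφ.continuousOn

lemma MemW.add {α : ℝ} (h0 : 0 < α) (h1 : α ≤ 1) {f g : ℝ → ℂ} (hf : MemW α f) (hg : MemW α g) :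
    MemW α fun x => f x + g x := by
  rcases h1.lt_or_eq with h1 | rfl
  · rw [memW_iff_of_lt_one h0 h1] at *
    exact ⟨hf.1.add hg.1, hf.2.add hg.2 hf.1.1 hg.1.1⟩
  · rw [memW_one_iff] at *
    obtain ⟨hf1, f', hf2, hf3⟩ := hf
    obtain ⟨hg1, g', hg2, hg3⟩ := hg
    refine ⟨hf1.add hg1, fun x => f' x + g' x, hf2.add hg2, fun φ hφ hc hs => ?_⟩
    have hdc : Continuous (deriv φ) := hφ.continuous_deriv (by simp)
    have hi : ∀ {k : ℝ → ℂ} {ψ : ℝ → ℂ}, MemLp k 2 (volume.restrict (Ioo (0 : ℝ) 1)) →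
        Continuous ψ → IntegrableOn (fun x => k x * ψ x) (Ioo (0 : ℝ) 1) := fun hk hψ =>
      integrableOn_mul_continuous (hk.integrable one_le_two) hψ
    simp_rw [add_mul]
    rw [integral_add (hi hf1 hdc) (hi hg1 hdc),
      integral_add (hi hf2 hφ.continuous) (hi hg2 hφ.continuous), hf3 φ hφ hc hs, hg3 φ hφ hc hs]
    ring

lemma lintegral_abs_rpow_lt_top {p : ℝ} (hp : -1 < p) :
    ∫⁻ t in Ioo (-1 : ℝ) 1, ENNReal.ofReal (|t| ^ p) < ⊤ := by
  have h1 : ∫⁻ t in Ioc (0 : ℝ) 1, ENNReal.ofReal (|t| ^ p) < ⊤ := by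
    have h2 : IntegrableOn (fun t : ℝ => t ^ p) (Ioc 0 1) :=
      (intervalIntegrable_iff_integrableOn_Ioc_of_le zero_le_one).1
        (intervalIntegral.intervalIntegrable_rpow' hp)
    refine lt_of_eq_of_lt ?_ h2.lintegral_lt_top
    refine setLIntegral_congr_fun measurableSet_Ioc fun t ht => ?_
    simp only [abs_of_pos ht.1]
  have h2 : ∫⁻ t in Ico (-1 : ℝ) 0, ENNReal.ofReal (|t| ^ p)
      = ∫⁻ t in Ioc (0 : ℝ) 1, ENNReal.ofReal (|t| ^ p) := by
    rw [← lintegral_indicator measurableSet_Ico, ← lintegral_indicator measurableSet_Ioc,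
      ← lintegral_neg_eq_self]
    refine lintegral_congr fun x => ?_
    have h3 : -x ∈ Ico (-1 : ℝ) 0 ↔ x ∈ Ioc (0 : ℝ) 1 := by
      simp only [mem_Ico, mem_Ioc]
      constructor <;> rintro ⟨a, b⟩ <;> constructor <;> linarith
    by_cases hx : x ∈ Ioc (0 : ℝ) 1
    · rw [indicator_of_mem hx, indicator_of_mem (h3.2 hx), abs_neg]
    · rw [indicator_of_notMem hx, indicator_of_notMem fun h => hx (h3.1 h)]
  have h3 : Ioo (-1 : ℝ) 1 ⊆ (Ico (-1 : ℝ) 0 ∪ {0}) ∪ Ioc (0 : ℝ) 1 := by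
    intro x hx
    rcases lt_trichotomy x 0 with h | h | h
    · exact Or.inl (Or.inl ⟨hx.1.le, h⟩)
    · exact Or.inl (Or.inr h)
    · exact Or.inr ⟨h, hx.2.le⟩
  refine (lintegral_mono_set h3).trans_lt ((lintegral_union_le _ _ _).trans_lt
    (ENNReal.add_lt_top.2 ⟨(lintegral_union_le _ _ _).trans_lt ?_, h1⟩))
  rw [h2, setLIntegral_measure_zero ({0} : Set ℝ) _ (by simp), add_zero]
  exact h1

/-- The product rule for increments leaves the error `|f x|² |x - y|^{1 - 2α}`, which is integrable
because `α < 1`. -/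
lemma FiniteSlobodeckij.V {α : ℝ} (h1 : α < 1) {f : ℝ → ℂ}
    (hf : FiniteSlobodeckij α f) (hL : MemLp f 2 (volume.restrict (Ioo (0 : ℝ) 1))) :
    FiniteSlobodeckij α (V f) := by
  set c := ∫⁻ t in Ioo (-1 : ℝ) 1, ENNReal.ofReal (|t| ^ (1 - 2 * α)) with hc
  have hct : c < ⊤ := lintegral_abs_rpow_lt_top (by linarith)
  refine hf.of_le hL.1 (C := 2) (r := fun x y =>
    ENNReal.ofReal (8 * ‖f x‖ ^ 2) * ENNReal.ofReal (|x - y| ^ (1 - 2 * α))) ?_ ?_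
  · have hin : ∀ x ∈ Ioo (0 : ℝ) 1, ∫⁻ y in Ioo (0 : ℝ) 1,
        ENNReal.ofReal (8 * ‖f x‖ ^ 2) * ENNReal.ofReal (|x - y| ^ (1 - 2 * α))
        ≤ ENNReal.ofReal (8 * ‖f x‖ ^ 2) * c := by
      intro x hx
      rw [lintegral_const_mul' _ _ ENNReal.ofReal_ne_top]
      gcongr
      rw [hc, ← lintegral_indicator measurableSet_Ioo, ← lintegral_indicator measurableSet_Ioo,
        ← lintegral_sub_left_eq_self _ x]
      refine lintegral_mono fun y => ?_
      by_cases hy : x - y ∈ Ioo (0 : ℝ) 1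
      · rw [indicator_of_mem hy, indicator_of_mem, sub_sub_cancel]
        constructor <;> linarith [hx.1, hx.2, hy.1, hy.2]
      · rw [indicator_of_notMem hy]; exact zero_le
    refine (setLIntegral_mono' measurableSet_Ioo hin).trans_lt ?_
    rw [lintegral_mul_const' _ _ hct.ne]
    refine ENNReal.mul_lt_top ?_ hct
    have := (hL.integrable_norm_pow (by norm_num)).const_mul 8
    exact this.lintegral_lt_top
  · intro x hx y hy
    rw [← ENNReal.ofReal_mul (by norm_num), ← ENNReal.ofReal_mul (by positivity),
      ← ENNReal.ofReal_add (by positivity) (by positivity)]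
    apply ENNReal.ofReal_le_ofReal
    rcases eq_or_ne x y with rfl | hxy
    · rw [sub_self, norm_zero, zero_pow two_ne_zero, zero_div]; positivity
    have hd : 0 < |x - y| := abs_pos.2 (sub_ne_zero.2 hxy)
    set d := |x - y|
    have hp : 0 < d ^ (1 + 2 * α) := Real.rpow_pos_of_pos hd _
    have hpd : d ^ (1 - 2 * α) = d ^ 2 / d ^ (1 + 2 * α) := by
      rw [← Real.rpow_natCast, ← Real.rpow_sub hd]
      congr 1
      push_cast; ring
    rw [hpd, mul_div_assoc', mul_div_assoc', ← add_div]
    gcongr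
    have e : SobolevZeros.V f x - SobolevZeros.V f y
        = (1 - 2 * (y : ℂ)) * (f x - f y) + (-2 * ((x - y : ℝ) : ℂ)) * f x := by
      simp only [SobolevZeros.V]; push_cast; ring
    have e2 : ‖(1 - 2 * (y : ℂ))‖ ≤ 1 := by
      have : (1 - 2 * (y : ℂ)) = ((1 - 2 * y : ℝ) : ℂ) := by push_cast; ring
      rw [this, Complex.norm_real, Real.norm_eq_abs, abs_le]
      constructor <;> linarith [hy.1, hy.2]
    have e3 : ‖SobolevZeros.V f x - SobolevZeros.V f y‖ ≤ ‖f x - f y‖ + 2 * d * ‖f x‖ := by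
      rw [e]
      refine (norm_add_le _ _).trans (add_le_add ?_ (le_of_eq ?_))
      · rw [norm_mul]
        exact mul_le_of_le_one_left (norm_nonneg _) e2
      · rw [norm_mul, norm_mul, norm_neg, Complex.norm_ofNat, Complex.norm_real, Real.norm_eq_abs]
    calc _ ≤ (‖f x - f y‖ + 2 * d * ‖f x‖) ^ 2 := by gcongr
      _ ≤ _ := by nlinarith [sq_nonneg (‖f x - f y‖ - 2 * d * ‖f x‖)]

lemma memLp_V {f : ℝ → ℂ} (hL : MemLp f 2 (volume.restrict (Ioo (0 : ℝ) 1))) :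
    MemLp (V f) 2 (volume.restrict (Ioo (0 : ℝ) 1)) := by
  refine hL.of_le (AEStronglyMeasurable.mul
    (Continuous.aestronglyMeasurable (by fun_prop)) hL.1) ?_
  filter_upwards [ae_restrict_mem measurableSet_Ioo] with x hx
  rw [SobolevZeros.V, norm_mul]
  refine mul_le_of_le_one_left (norm_nonneg _) ?_
  have : (1 - 2 * (x : ℂ)) = ((1 - 2 * x : ℝ) : ℂ) := by push_cast; ring
  rw [this, Complex.norm_real, Real.norm_eq_abs, abs_le]
  constructor <;> linarith [hx.1, hx.2]

lemma MemW.V {α : ℝ} (h0 : 0 < α) (h1 : α ≤ 1) {f : ℝ → ℂ} (hf : MemW α f) : MemW α (V f) := by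
  rcases h1.lt_or_eq with h1 | rfl
  · rw [memW_iff_of_lt_one h0 h1] at *
    exact ⟨memLp_V hf.1, hf.2.V h1 hf.1⟩
  · rw [memW_one_iff] at *
    obtain ⟨hf1, f', hf2, hf3⟩ := hf
    refine ⟨memLp_V hf1, fun x => SobolevZeros.V f' x - 2 * f x,
      (memLp_V hf2).sub (hf1.const_mul 2), fun φ hφ hc hs => ?_⟩
    -- the product rule, tested with `V φ`
    have hVd : ∀ x, HasDerivAt (SobolevZeros.V φ)
        (-2 * φ x + (1 - 2 * (x : ℂ)) * deriv φ x) x := by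
      intro x
      have h4 : HasDerivAt (fun y : ℝ => (y : ℂ)) 1 x := Complex.ofRealCLM.hasDerivAt
      have h5 := ((h4.const_mul 2).const_sub 1).mul
        (hφ.differentiable (by simp) x).hasDerivAt
      refine h5.congr_deriv ?_
      ring
    have hVs : ContDiff ℝ ((⊤ : ℕ∞) : WithTop ℕ∞) (SobolevZeros.V φ) :=
      (contDiff_const.sub (contDiff_const.mul Complex.ofRealCLM.contDiff)).mul hφ
    have h6 := hf3 (SobolevZeros.V φ) hVs hc.mul_left ((tsupport_mul_subset_right).trans hs)
    simp_rw [(hVd _).deriv] at h6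
    have hi : ∀ {k : ℝ → ℂ} {ψ : ℝ → ℂ}, MemLp k 2 (volume.restrict (Ioo (0 : ℝ) 1)) →
        Continuous ψ → IntegrableOn (fun x => k x * ψ x) (Ioo (0 : ℝ) 1) := fun hk hψ =>
      integrableOn_mul_continuous (hk.integrable one_le_two) hψ
    have hdc : Continuous (deriv φ) := hφ.continuous_deriv (by simp)
    have e1 : ∀ x, f x * (-2 * φ x + (1 - 2 * (x : ℂ)) * deriv φ x)
        = SobolevZeros.V f x * deriv φ x - 2 * (f x * φ x) := by
      intro x; simp only [SobolevZeros.V]; ring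
    have e2 : ∀ x, f' x * SobolevZeros.V φ x = SobolevZeros.V f' x * φ x := by
      intro x; simp only [SobolevZeros.V]; ring
    have e3 : ∀ x, (SobolevZeros.V f' x - 2 * f x) * φ x
        = SobolevZeros.V f' x * φ x - 2 * (f x * φ x) := by
      intro x; ring
    simp_rw [e1, e2] at h6
    simp_rw [e3]
    rw [integral_sub (hi (memLp_V hf1) hdc) ((hi hf1 hφ.continuous).const_mul 2)] at h6
    rw [integral_sub (hi (memLp_V hf2) hφ.continuous) ((hi hf1 hφ.continuous).const_mul 2)]
    linear_combination h6

/-! ### Coefficients of functions of class `W^α_2` -/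

lemma expCoeff_congr {f g : ℝ → ℂ} (h : f =ᵐ[volume.restrict (Ioo (0 : ℝ) 1)] g) (n : ℤ) :
    expCoeff n f = expCoeff n g := by
  rw [expCoeff, expCoeff, intervalIntegral.integral_of_le zero_le_one,
    intervalIntegral.integral_of_le zero_le_one, integral_Ioc_eq_integral_Ioo,
    integral_Ioc_eq_integral_Ioo]
  refine integral_congr_ae ?_
  filter_upwards [h] with x hx
  rw [hx]

/-- Bessel's inequality: `g` is extended by zero to an interval of length two, on which the
exponentials `e^{iπnx}` are orthogonal. -/
lemma summable_sq_expCoeff {g : ℝ → ℂ} (hg : MemLp g 2 (volume.restrict (Ioo (0 : ℝ) 1))) :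
    Summable fun n : ℤ => ‖expCoeff (-n) g‖ ^ 2 := by
  set G : ℝ → ℂ := (Ioo (0 : ℝ) 1).indicator g with hG
  have hGm : MemLp G 2 (volume.restrict (Ioc 0 2)) :=
    ((memLp_indicator_iff_restrict measurableSet_Ioo).2 hg).restrict _
  have h := (hasSum_sq_fourierCoeffOn (zero_lt_two (α := ℝ)) hGm).summable.mul_left 4
  refine h.congr fun n => ?_
  rw [fourierCoeffOn_two _ (by norm_num), norm_mul, mul_pow, expCoeff,
    intervalIntegral.integral_of_le zero_le_two, intervalIntegral.integral_of_le zero_le_one,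
    integral_Ioc_eq_integral_Ioo (x := 0) (y := 1)]
  have e1 : ∀ x, G x * Complex.exp (Real.pi * (-n : ℤ) * x * Complex.I)
      = (Ioo (0 : ℝ) 1).indicator
        (fun x => g x * Complex.exp (Real.pi * (-n : ℤ) * x * Complex.I)) x := by
    intro x
    by_cases hx : x ∈ Ioo (0 : ℝ) 1
    · simp only [hG, indicator_of_mem hx]
    · simp only [hG, indicator_of_notMem hx, zero_mul]
  simp_rw [e1]
  rw [setIntegral_indicator measurableSet_Ioo, inter_eq_self_of_subset_right]
  · norm_num
    ring
  · intro x hx; exact ⟨hx.1, by linarith [hx.2]⟩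

/-- Integration by parts; the boundary terms give the constant `C`. -/
lemma exists_expCoeff_bound_of_weakDeriv {f g : ℝ → ℂ}
    (hf : MemLp f 2 (volume.restrict (Ioo (0 : ℝ) 1)))
    (hg : MemLp g 2 (volume.restrict (Ioo (0 : ℝ) 1))) (h : IsWeakDeriv f g) :
    ∃ C : ℝ, ∀ n : ℤ, n ≠ 0 →
      ‖expCoeff (-n) f‖ ≤ (C + ‖expCoeff (-n) g‖) * |(n : ℝ)|⁻¹ := by
  have hgi := intervalIntegrable_of_memLp hg
  obtain ⟨c, hc⟩ := h.ae_eq_primitive (intervalIntegrable_of_memLp hf) hgi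
  set I := ∫ x in (0 : ℝ)..1, g x
  refine ⟨2 * ‖c‖ + ‖I‖, fun n hn => ?_⟩
  set e : ℝ → ℂ := fun x => Complex.exp (Real.pi * (-n : ℤ) * x * Complex.I) with he
  have hec : Continuous e := by fun_prop
  have hn' : (n : ℂ) ≠ 0 := by exact_mod_cast hn
  have hpi : (Real.pi : ℂ) ≠ 0 := by exact_mod_cast Real.pi_ne_zero
  set k : ℂ := (Real.pi * (-n : ℤ) * Complex.I)⁻¹ with hk
  have hd : ∀ x : ℝ, HasDerivAt (fun x : ℝ => k * e x) (e x) x := by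
    intro x
    have h3 : HasDerivAt (fun y : ℝ => (Real.pi : ℂ) * (-n : ℤ) * (y : ℂ) * Complex.I)
        ((Real.pi : ℂ) * (-n : ℤ) * 1 * Complex.I) x := by
      have h4 : HasDerivAt (fun y : ℝ => (y : ℂ)) 1 x := Complex.ofRealCLM.hasDerivAt
      exact (h4.const_mul _).mul_const _
    refine ((h3.cexp).const_mul k).congr_deriv ?_
    rw [hk]
    change _ * (e x * _) = e x
    have : ((-n : ℤ) : ℂ) ≠ 0 := by push_cast; exact neg_ne_zero.2 hn'
    have hI := Complex.I_ne_zero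
    field_simp
  have hkn : ‖k‖ ≤ |(n : ℝ)|⁻¹ := by
    rw [hk, norm_inv, norm_mul, norm_mul, Complex.norm_I, mul_one, Complex.norm_real,
      Complex.norm_intCast, Real.norm_eq_abs, abs_of_pos Real.pi_pos]
    push_cast
    rw [abs_neg]
    have h1 : 0 < |(n : ℝ)| := abs_pos.2 (by exact_mod_cast hn)
    apply inv_anti₀ h1
    have := Real.pi_gt_three
    nlinarith
  have hval : expCoeff (-n) f = k * (c * (e 1 - e 0) + I * e 1 - expCoeff (-n) g) := by
    rw [expCoeff_congr hc, expCoeff]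
    change ∫ x in (0 : ℝ)..1, (c + ∫ t in (0 : ℝ)..x, g t) * e x = _
    simp_rw [add_mul]
    have hpc : ContinuousOn (fun x => ∫ t in (0 : ℝ)..x, g t) (uIcc 0 1) :=
      intervalIntegral.continuousOn_primitive_interval
        (by rw [uIcc_of_le zero_le_one]
            exact (intervalIntegrable_iff_integrableOn_Icc_of_le zero_le_one).1 hgi)
    have hpi2 : IntervalIntegrable (fun x => (∫ t in (0 : ℝ)..x, g t) * e x) volume 0 1 :=
      (hpc.mul hec.continuousOn).intervalIntegrable
    rw [intervalIntegral.integral_add ((hec.intervalIntegrable _ _).const_mul c) hpi2, integral_primitive_mul_deriv hgi hd hec,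
      intervalIntegral.integral_const_mul,
      intervalIntegral.integral_eq_sub_of_hasDerivAt (fun x _ => hd x) (hec.intervalIntegrable _ _)]
    have e1 : ∫ x in (0 : ℝ)..1, g x * (k * e x) = k * expCoeff (-n) g := by
      rw [expCoeff, ← intervalIntegral.integral_const_mul]
      congr 1; ext x; simp only [he]; ring
    rw [e1]; ring
  have hen : ∀ x, ‖e x‖ = 1 := norm_exp_pi_mul_I (-n)
  rw [hval, norm_mul, mul_comm]
  gcongr
  calc _ ≤ ‖c * (e 1 - e 0)‖ + ‖I * e 1‖ + ‖expCoeff (-n) g‖ :=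
        (norm_sub_le _ _).trans (by gcongr; exact norm_add_le _ _)
    _ ≤ _ := by
        rw [norm_mul, norm_mul, hen, mul_one]
        have := norm_sub_le (e 1) (e 0)
        rw [hen, hen] at this
        nlinarith [norm_nonneg c]

/-- The direct estimate: the square of a coefficient of `f ∈ W^α_2` is the sum of a term summable
with the weight `|n|^{2α}` and of a term `O(|n|^{-(1+α)})` due to the end points. -/
theorem MemW.exists_expCoeff_bound {α : ℝ} (h0 : 0 < α) (h1 : α ≤ 1) {f : ℝ → ℂ}
    (hf : MemW α f) :
    ∃ (A : ℤ → ℝ) (C : ℝ), (∀ n, 0 ≤ A n) ∧ Summable (fun n : ℤ => |(n : ℝ)| ^ (2 * α) * A n) ∧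
      ∀ n ≠ 0, ‖expCoeff (-n) f‖ ^ 2 ≤ A n + C * |(n : ℝ)| ^ (-(1 + α)) := by
  rcases h1.lt_or_eq with h1 | rfl
  · rw [memW_iff_of_lt_one h0 h1] at hf
    obtain ⟨hL, hS⟩ := hf
    -- pass to a measurable representative vanishing outside `(0, 1)`
    set f₀ := hL.1.mk f with hf₀
    set f₁ : ℝ → ℂ := (Ioo (0 : ℝ) 1).indicator f₀ with hf₁
    have hm : Measurable f₁ := hL.1.stronglyMeasurable_mk.measurable.indicator measurableSet_Ioo
    have hff : f =ᵐ[volume.restrict (Ioo (0 : ℝ) 1)] f₁ := by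
      filter_upwards [hL.1.ae_eq_mk, ae_restrict_mem measurableSet_Ioo] with x hx hxm
      rw [hx, hf₁, indicator_of_mem hxm]
    have hL0 : MemLp f₀ 2 (volume.restrict (Ioo (0 : ℝ) 1)) := hL.ae_eq hL.1.ae_eq_mk
    have hL1 : MemLp f₁ 2 := (memLp_indicator_iff_restrict measurableSet_Ioo).2 hL0
    have hi1 : Integrable f₁ := (integrable_indicator_iff measurableSet_Ioo).2
      (hL0.integrable one_le_two)
    obtain ⟨A, C, hA, hs, hb⟩ := exists_expCoeff_bound_aux h0 h1 hm (hS.congr hff) hL1 hi1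
    exact ⟨A, C, hA, hs, fun n hn => by rw [expCoeff_congr hff]; exact hb n hn⟩
  · rw [memW_one_iff] at hf
    obtain ⟨hL, g, hg, hw⟩ := hf
    obtain ⟨C, hC⟩ := exists_expCoeff_bound_of_weakDeriv hL hg hw
    refine ⟨fun n => 2 * ‖expCoeff (-n) g‖ ^ 2 * (|(n : ℝ)| ^ 2)⁻¹, 2 * C ^ 2,
      fun n => by positivity, ?_, fun n hn => ?_⟩
    · refine Summable.of_nonneg_of_le (fun n => by positivity) (fun n => ?_)
        ((summable_sq_expCoeff hg).mul_left 2)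
      rw [mul_one, Real.rpow_two, mul_comm, mul_assoc]
      refine mul_le_of_le_one_right (by positivity) ?_
      exact inv_mul_le_one
    · have h2 := hC n hn
      have h3 : |(n : ℝ)| ^ (-(1 + 1 : ℝ)) = (|(n : ℝ)| ^ 2)⁻¹ := by
        rw [Real.rpow_neg (abs_nonneg _), one_add_one_eq_two, Real.rpow_two]
      rw [h3]
      calc _ ≤ ((C + ‖expCoeff (-n) g‖) * |(n : ℝ)|⁻¹) ^ 2 := by gcongr
        _ = (C + ‖expCoeff (-n) g‖) ^ 2 * (|(n : ℝ)| ^ 2)⁻¹ := by rw [mul_pow, inv_pow]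
        _ ≤ (2 * C ^ 2 + 2 * ‖expCoeff (-n) g‖ ^ 2) * (|(n : ℝ)| ^ 2)⁻¹ := by
            gcongr
            nlinarith [sq_nonneg (C - ‖expCoeff (-n) g‖)]
        _ = _ := by ring

end

section

open Filter Topology

/-! ### Weighted summability of products of Fourier coefficients -/

/-- The decay of the Fourier coefficients of a function of class `W^α_2`: the square is the sum of
a term summable with the weight `n^{2α}` and of a term `O(n^{-(1+α)})`. The second term comes from
the end points of the interval, where no boundary condition is imposed. -/
def Decays (α : ℝ) (q : ℕ → ℝ) : Prop :=
  ∃ (A : ℕ → ℝ) (C : ℝ), 0 ≤ C ∧ (∀ n, 0 ≤ A n) ∧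
    Summable (fun n : ℕ => (n : ℝ) ^ (2 * α) * A n) ∧
    ∀ n, 1 ≤ n → q n ^ 2 ≤ A n + C * (n : ℝ) ^ (-(1 + α))

lemma Decays.of_le {α : ℝ} {p q : ℕ → ℝ} (hq : Decays α q) (h0 : ∀ n, 0 ≤ p n)
    (h : ∀ n, p n ≤ q n) : Decays α p := by
  obtain ⟨A, C, hC, hA, hs, hb⟩ := hq
  exact ⟨A, C, hC, hA, hs, fun n hn => le_trans (by have := h0 n; have := h n; gcongr) (hb n hn)⟩

lemma Decays.add {α : ℝ} {p q : ℕ → ℝ} (hp : Decays α p) (hq : Decays α q) :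
    Decays α (fun n => p n + q n) := by
  obtain ⟨A, C, hC, hA, hs, hb⟩ := hp
  obtain ⟨A', C', hC', hA', hs', hb'⟩ := hq
  refine ⟨fun n => 2 * A n + 2 * A' n, 2 * C + 2 * C', by positivity,
    fun n => by have := hA n; have := hA' n; positivity, ?_, fun n hn => ?_⟩
  · refine ((hs.mul_left 2).add (hs'.mul_left 2)).congr fun n => ?_
    ring
  · have h1 := hb n hn
    have h2 := hb' n hn
    nlinarith [sq_nonneg (p n - q n)]

lemma summable_pow_of_nonneg {x : ℕ → ℝ} (h0 : ∀ n, 0 ≤ x n) (hx : Summable x) {k : ℕ}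
    (hk : k ≠ 0) : Summable fun n => x n ^ k := by
  refine Summable.of_norm_bounded_eventually_nat hx ?_
  filter_upwards [hx.tendsto_atTop_zero.eventually_le_const one_pos] with n hn
  rw [Real.norm_of_nonneg (pow_nonneg (h0 n) k)]
  exact pow_le_of_le_one (h0 n) hn hk

/-- The cubes of both parts of `q n ^ 2` are summable with the weight `n^{2γ}`: the first because
`γ ≤ 3α`, the second because `2γ - 3 - 3α < -1`. -/
lemma Decays.summable_pow_six {α γ : ℝ} (h0 : 0 < α) (h1 : γ ≤ 3 * α) (h2 : γ ≤ 1 + α)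
    {q : ℕ → ℝ} (hq : Decays α q) : Summable fun n : ℕ => (n : ℝ) ^ (2 * γ) * q n ^ 6 := by
  obtain ⟨A, C, hC, hA, hs, hb⟩ := hq
  have hs3 : Summable fun n : ℕ => ((n : ℝ) ^ (2 * α) * A n) ^ 3 :=
    summable_pow_of_nonneg (fun n => mul_nonneg (by positivity) (hA n)) hs (by norm_num)
  have hp : Summable fun n : ℕ => (n : ℝ) ^ (2 * γ - 3 - 3 * α) :=
    Real.summable_nat_rpow.2 (by linarith)
  refine Summable.of_norm_bounded_eventually_nat
    ((hs3.mul_left 4).add (hp.mul_left (4 * C ^ 3))) ?_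
  filter_upwards [eventually_ge_atTop 1] with n hn
  have hn1 : (1 : ℝ) ≤ n := by exact_mod_cast hn
  have hn0 : (0 : ℝ) < n := by linarith
  rw [Real.norm_of_nonneg (by positivity)]
  have ha := hA n
  have hB : 0 ≤ C * (n : ℝ) ^ (-(1 + α)) := by positivity
  have hAB : ∀ a b : ℝ, 0 ≤ a → 0 ≤ b → (a + b) ^ 3 ≤ 4 * (a ^ 3 + b ^ 3) := by
    intro a b ha hb
    nlinarith [mul_nonneg (add_nonneg ha hb) (sq_nonneg (a - b))]
  have e1 : (n : ℝ) ^ (2 * γ) ≤ ((n : ℝ) ^ (2 * α)) ^ 3 := by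
    rw [← Real.rpow_natCast, ← Real.rpow_mul hn0.le]
    exact Real.rpow_le_rpow_of_exponent_le hn1 (by push_cast; linarith)
  have e2 : (n : ℝ) ^ (2 * γ) * ((n : ℝ) ^ (-(1 + α))) ^ 3 = (n : ℝ) ^ (2 * γ - 3 - 3 * α) := by
    rw [← Real.rpow_natCast, ← Real.rpow_mul hn0.le, ← Real.rpow_add hn0]
    congr 1; push_cast; ring
  calc (n : ℝ) ^ (2 * γ) * q n ^ 6 = (n : ℝ) ^ (2 * γ) * (q n ^ 2) ^ 3 := by ring
    _ ≤ (n : ℝ) ^ (2 * γ) * (A n + C * (n : ℝ) ^ (-(1 + α))) ^ 3 := by gcongr; exact hb n hn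
    _ ≤ (n : ℝ) ^ (2 * γ) * (4 * (A n ^ 3 + (C * (n : ℝ) ^ (-(1 + α))) ^ 3)) := by
        gcongr; exact hAB _ _ ha hB
    _ = 4 * ((n : ℝ) ^ (2 * γ) * A n ^ 3)
        + 4 * C ^ 3 * ((n : ℝ) ^ (2 * γ) * ((n : ℝ) ^ (-(1 + α))) ^ 3) := by ring
    _ ≤ 4 * (((n : ℝ) ^ (2 * α)) ^ 3 * A n ^ 3) + 4 * C ^ 3 * (n : ℝ) ^ (2 * γ - 3 - 3 * α) := by
        rw [e2]; gcongr
    _ = _ := by ring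

lemma Decays.summable_pow_four {α : ℝ} (h0 : 0 < α) {q : ℕ → ℝ} (hq : Decays α q) :
    Summable fun n : ℕ => (n : ℝ) ^ (2 * α) * q n ^ 4 := by
  obtain ⟨A, C, hC, hA, hs, hb⟩ := hq
  have hs2 : Summable fun n : ℕ => ((n : ℝ) ^ (2 * α) * A n) ^ 2 :=
    summable_pow_of_nonneg (fun n => mul_nonneg (by positivity) (hA n)) hs (by norm_num)
  have hp : Summable fun n : ℕ => (n : ℝ) ^ (-2 : ℝ) := Real.summable_nat_rpow.2 (by norm_num)
  refine Summable.of_norm_bounded_eventually_nat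
    ((hs2.mul_left 2).add (hp.mul_left (2 * C ^ 2))) ?_
  filter_upwards [eventually_ge_atTop 1] with n hn
  have hn1 : (1 : ℝ) ≤ n := by exact_mod_cast hn
  have hn0 : (0 : ℝ) < n := by linarith
  rw [Real.norm_of_nonneg (by positivity)]
  have hAB : ∀ a b : ℝ, (a + b) ^ 2 ≤ 2 * (a ^ 2 + b ^ 2) := fun a b => by
    nlinarith [sq_nonneg (a - b)]
  have e1 : (n : ℝ) ^ (2 * α) ≤ ((n : ℝ) ^ (2 * α)) ^ 2 :=
    le_self_pow₀ (Real.one_le_rpow hn1 (by linarith)) (by norm_num)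
  have e2 : (n : ℝ) ^ (2 * α) * ((n : ℝ) ^ (-(1 + α))) ^ 2 = (n : ℝ) ^ (-2 : ℝ) := by
    rw [← Real.rpow_natCast, ← Real.rpow_mul hn0.le, ← Real.rpow_add hn0]
    congr 1; push_cast; ring
  calc (n : ℝ) ^ (2 * α) * q n ^ 4 = (n : ℝ) ^ (2 * α) * (q n ^ 2) ^ 2 := by ring
    _ ≤ (n : ℝ) ^ (2 * α) * (A n + C * (n : ℝ) ^ (-(1 + α))) ^ 2 := by gcongr; exact hb n hn
    _ ≤ (n : ℝ) ^ (2 * α) * (2 * (A n ^ 2 + (C * (n : ℝ) ^ (-(1 + α))) ^ 2)) := by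
        gcongr; exact hAB _ _
    _ = 2 * ((n : ℝ) ^ (2 * α) * A n ^ 2)
        + 2 * C ^ 2 * ((n : ℝ) ^ (2 * α) * ((n : ℝ) ^ (-(1 + α))) ^ 2) := by ring
    _ ≤ 2 * (((n : ℝ) ^ (2 * α)) ^ 2 * A n ^ 2) + 2 * C ^ 2 * (n : ℝ) ^ (-2 : ℝ) := by
        rw [e2]; gcongr
    _ = _ := by ring

lemma MemW.decays_expCoeff {α : ℝ} (h0 : 0 < α) (h1 : α ≤ 1) {f : ℝ → ℂ} (hf : MemW α f) :
    Decays α fun n => ‖expCoeff n f‖ + ‖expCoeff (-n) f‖ := by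
  obtain ⟨A, C, hA, hs, hb⟩ := hf.exists_expCoeff_bound h0 h1
  have hs1 := hs.comp_injective (Nat.cast_injective (R := ℤ))
  have hs2 := hs.comp_injective (neg_injective.comp (Nat.cast_injective (R := ℤ)))
  have hd1 : Decays α fun n => ‖expCoeff n f‖ := by
    refine ⟨fun n => A (-n), |C|, abs_nonneg _, fun n => hA _, ?_, fun n hn => ?_⟩
    · refine hs2.congr fun n => ?_
      simp
    · have := hb (-n) (by omega)
      rw [neg_neg] at this
      refine this.trans ?_
      push_cast
      rw [abs_neg, Nat.abs_cast]
      gcongr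
      exact le_abs_self _
  have hd2 : Decays α fun n => ‖expCoeff (-n) f‖ := by
    refine ⟨fun n => A n, |C|, abs_nonneg _, fun n => hA _, ?_, fun n hn => ?_⟩
    · refine hs1.congr fun n => ?_
      simp
    · refine (hb n (by omega)).trans ?_
      push_cast
      rw [Nat.abs_cast]
      gcongr
      exact le_abs_self _
  exact hd1.add hd2

lemma intervalIntegrable_mul_continuous {f φ : ℝ → ℂ} (hf : IntervalIntegrable f volume 0 1)
    (hφ : Continuous φ) : IntervalIntegrable (fun x => f x * φ x) volume 0 1 :=
  hf.mul_continuousOn hφ.continuousOn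

lemma sinCoeff_eq_expCoeff {f : ℝ → ℂ} (hf : IntervalIntegrable f volume 0 1) (n : ℕ) :
    sinCoeff n f = (expCoeff n f - expCoeff (-n) f) * (-Complex.I / 2) := by
  rw [sinCoeff, expCoeff, expCoeff, ← intervalIntegral.integral_sub
    (intervalIntegrable_mul_continuous hf (by fun_prop))
    (intervalIntegrable_mul_continuous hf (by fun_prop)), ← intervalIntegral.integral_mul_const]
  refine intervalIntegral.integral_congr fun x _ => ?_
  rw [Complex.ofReal_sin, Complex.sin]
  push_cast
  ring_nf

lemma cosCoeff_eq_expCoeff {f : ℝ → ℂ} (hf : IntervalIntegrable f volume 0 1) (n : ℕ) :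
    cosCoeff n f = (expCoeff n f + expCoeff (-n) f) / 2 := by
  rw [cosCoeff, expCoeff, expCoeff, ← intervalIntegral.integral_add
    (intervalIntegrable_mul_continuous hf (by fun_prop))
    (intervalIntegrable_mul_continuous hf (by fun_prop)), ← intervalIntegral.integral_div]
  refine intervalIntegral.integral_congr fun x _ => ?_
  rw [Complex.ofReal_cos, Complex.cos]
  push_cast
  ring_nf

lemma MemW.intervalIntegrable {α : ℝ} {f : ℝ → ℂ} (hf : MemW α f) :
    IntervalIntegrable f volume 0 1 := intervalIntegrable_of_memLp hf.memLp

lemma MemW.decays_sinCoeff {α : ℝ} (h0 : 0 < α) (h1 : α ≤ 1) {f : ℝ → ℂ} (hf : MemW α f) :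
    Decays α fun n => ‖sinCoeff n f‖ := by
  refine (hf.decays_expCoeff h0 h1).of_le (fun n => norm_nonneg _) fun n => ?_
  rw [sinCoeff_eq_expCoeff hf.intervalIntegrable, norm_mul, norm_div, norm_neg, Complex.norm_I]
  have := norm_sub_le (expCoeff n f) (expCoeff (-n) f)
  have := norm_nonneg (expCoeff n f - expCoeff (-n) f)
  norm_num
  linarith

lemma MemW.decays_cosCoeff {α : ℝ} (h0 : 0 < α) (h1 : α ≤ 1) {f : ℝ → ℂ} (hf : MemW α f) :
    Decays α fun n => ‖cosCoeff n f‖ := by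
  refine (hf.decays_expCoeff h0 h1).of_le (fun n => norm_nonneg _) fun n => ?_
  rw [cosCoeff_eq_expCoeff hf.intervalIntegrable, norm_div]
  have := norm_add_le (expCoeff n f) (expCoeff (-n) f)
  have := norm_nonneg (expCoeff n f + expCoeff (-n) f)
  norm_num
  linarith

end

section

open Filter Topology ENNReal AddCircle

/-! ### Functions with prescribed Fourier coefficients: the periodic case -/

instance fact_zero_lt_two : Fact ((0 : ℝ) < 2) := ⟨two_pos⟩

/-- The theorem of Riesz and Fischer on the circle of length two. -/
lemma exists_fourierCoeff_eq {a : ℤ → ℂ} (ha : Summable fun n => ‖a n‖ ^ 2) :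
    ∃ P : AddCircle (2 : ℝ) → ℂ, Measurable P ∧ MemLp P 2 haarAddCircle ∧
      ∀ n, fourierCoeff P n = a n := by
  have hm : Memℓp a 2 := by
    rw [memℓp_gen_iff (by norm_num)]
    simpa using ha
  set F : Lp ℂ 2 (haarAddCircle (T := (2 : ℝ))) := fourierBasis.repr.symm ⟨a, hm⟩ with hF
  have hL := Lp.memLp F
  refine ⟨hL.1.mk F, hL.1.stronglyMeasurable_mk.measurable, hL.ae_eq hL.1.ae_eq_mk, fun n => ?_⟩
  rw [← fourierCoeff_congr_ae hL.1.ae_eq_mk, ← fourierBasis_repr, hF,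
    LinearIsometryEquiv.apply_symm_apply]

lemma tsum_ofReal_sq_fourierCoeff {P : AddCircle (2 : ℝ) → ℂ} (hP : MemLp P 2 haarAddCircle) :
    ∑' n : ℤ, ENNReal.ofReal (‖fourierCoeff P n‖ ^ 2)
      = ∫⁻ x, ENNReal.ofReal (‖P x‖ ^ 2) ∂haarAddCircle := by
  have h := hasSum_sq_fourierCoeff (hP.toLp P)
  rw [fourierCoeff_congr_ae hP.coeFn_toLp] at h
  have e : ∫ t, ‖hP.toLp P t‖ ^ 2 ∂haarAddCircle = ∫ t, ‖P t‖ ^ 2 ∂haarAddCircle := by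
    refine integral_congr_ae ?_
    filter_upwards [hP.coeFn_toLp] with x hx
    rw [hx]
  rw [e] at h
  rw [← ENNReal.ofReal_tsum_of_nonneg (fun _ => by positivity) h.summable, h.tsum_eq,
    ofReal_integral_eq_lintegral_ofReal hP.integrable_norm_pow' (ae_of_all _ fun _ => by positivity)]

lemma lintegral_Ioc_eq_haar (F : AddCircle (2 : ℝ) → ℝ≥0∞) :
    ∫⁻ x in Ioc (-1 : ℝ) 1, F x = 2 * ∫⁻ x, F x ∂haarAddCircle := by
  have h := AddCircle.lintegral_preimage (2 : ℝ) (-1) F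
  rw [show (-1 : ℝ) + 2 = 1 by norm_num] at h
  rw [h, volume_eq_smul_haarAddCircle, lintegral_smul_measure]
  norm_num

/-- Translations act on the Fourier coefficients by characters. -/
lemma fourierCoeff_increment {P : AddCircle (2 : ℝ) → ℂ} (hP : Integrable P haarAddCircle)
    (h : AddCircle (2 : ℝ)) (n : ℤ) :
    fourierCoeff (fun x => P (x + h) - P x) n = (fourier n h - 1) * fourierCoeff P n := by
  have h1 : ∫ x, fourier (-n) x * P (x + h) ∂haarAddCircle = fourier n h * fourierCoeff P n := by
    rw [fourierCoeff, ← integral_const_mul,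
      ← integral_add_right_eq_self (fun x => fourier n h * (fourier (-n) x • P x)) h]
    refine integral_congr_ae (ae_of_all _ fun x => ?_)
    have e : (fourier n h : ℂ) * fourier (-n) h = 1 := by
      rw [← fourier_add, add_neg_cancel, fourier_zero]
    simp only [smul_eq_mul]
    have e2 : (fourier (-n) (x + h) : ℂ) = fourier (-n) x * fourier (-n) h := by
      simp only [fourier_apply, smul_add, toCircle_add, Circle.coe_mul]
    rw [e2]
    linear_combination (-(fourier (-n) x : ℂ) * P (x + h)) * e
  have hi1 : Integrable (fun x => fourier (-n) x * P (x + h)) haarAddCircle :=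
    (hP.comp_add_right h).fourier_smul (-n)
  have hi2 : Integrable (fun x => fourier (-n) x * P x) haarAddCircle := hP.fourier_smul (-n)
  rw [fourierCoeff]
  simp only [smul_eq_mul, mul_sub]
  rw [integral_sub hi1 hi2, h1, sub_mul, one_mul, fourierCoeff]
  simp only [smul_eq_mul]

lemma norm_fourier_sub_one_le (n : ℤ) (h : ℝ) :
    ‖fourier n (h : AddCircle (2 : ℝ)) - 1‖ ^ 2 ≤ min 4 ((Real.pi * (|(n : ℝ)| * h)) ^ 2) := by
  have e : (fourier n (h : AddCircle (2 : ℝ)) : ℂ)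
      = Complex.exp (Complex.I * ((Real.pi * (n * h) : ℝ) : ℂ)) := by
    rw [fourier_coe_apply]
    congr 1
    push_cast
    ring
  have h1 := Real.norm_exp_I_mul_ofReal_sub_one_le (x := Real.pi * (n * h))
  rw [← e] at h1
  refine le_min ?_ ?_
  · have h2 : ‖fourier n (h : AddCircle (2 : ℝ)) - 1‖ ≤ 2 := by
      refine (norm_sub_le _ _).trans ?_
      rw [fourier_apply, Circle.norm_coe, norm_one]
      norm_num
    nlinarith [norm_nonneg (fourier n (h : AddCircle (2 : ℝ)) - 1)]
  · refine (pow_le_pow_left₀ (norm_nonneg _) h1 2).trans (le_of_eq ?_)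
    rw [Real.norm_eq_abs, sq_abs, mul_pow, mul_pow, mul_pow, mul_pow, sq_abs]

lemma lintegral_kernel_lt_top {σ : ℝ} (h0 : 0 < σ) (h1 : σ < 1) :
    ∫⁻ t : ℝ, ENNReal.ofReal (min 4 ((Real.pi * t) ^ 2) / |t| ^ (1 + 2 * σ)) < ⊤ := by
  set K : ℝ := 4 * 2 ^ (1 + 2 * σ) with hK
  have hI : Integrable fun t : ℝ => K * (1 + ‖t‖) ^ (-(1 + 2 * σ)) :=
    (integrable_one_add_norm (by simp; linarith)).const_mul _
  rw [← lintegral_add_compl _ (measurableSet_Ioo (a := (-1 : ℝ)) (b := 1))]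
  refine ENNReal.add_lt_top.2 ⟨?_, ?_⟩
  · have hfin : ∫⁻ t in Ioo (-1 : ℝ) 1, ENNReal.ofReal (Real.pi ^ 2) *
        ENNReal.ofReal (|t| ^ (1 - 2 * σ)) < ⊤ := by
      rw [lintegral_const_mul' _ _ ENNReal.ofReal_ne_top]
      exact ENNReal.mul_lt_top ENNReal.ofReal_lt_top (lintegral_abs_rpow_lt_top (by linarith))
    refine lt_of_le_of_lt (lintegral_mono fun t => ?_) hfin
    rw [← ENNReal.ofReal_mul (by positivity)]
    apply ENNReal.ofReal_le_ofReal
    rcases eq_or_ne t 0 with rfl | ht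
    · simp only [abs_zero]
      rw [Real.zero_rpow (by linarith), _root_.div_zero]
      positivity
    · have ht' : 0 < |t| := abs_pos.2 ht
      rw [div_le_iff₀ (by positivity), mul_assoc, ← Real.rpow_add ht']
      refine (min_le_right _ _).trans (le_of_eq ?_)
      rw [show 1 - 2 * σ + (1 + 2 * σ) = (2 : ℕ) by push_cast; ring, Real.rpow_natCast, sq_abs,
        mul_pow]
  · refine lt_of_le_of_lt ((setLIntegral_mono' measurableSet_Ioo.compl fun t ht => ?_).trans
      (setLIntegral_le_lintegral _ _)) hI.lintegral_lt_top
    apply ENNReal.ofReal_le_ofReal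
    have ht1 : 1 ≤ |t| := by
      by_contra hlt
      exact ht (abs_lt.1 (not_le.1 hlt))
    have ht0 : 0 < |t| := by linarith
    rw [Real.norm_eq_abs, Real.rpow_neg (by positivity), div_le_iff₀ (by positivity), mul_assoc,
      mul_comm _ (|t| ^ _), ← div_eq_mul_inv, hK, mul_assoc, ← mul_div_assoc,
      ← Real.mul_rpow (by norm_num) ht0.le]
    refine (min_le_left _ _).trans (le_mul_of_one_le_right (by norm_num) ?_)
    rw [one_le_div (by positivity)]
    exact Real.rpow_le_rpow (by positivity) (by linarith) (by linarith)

/-- The scaling of the kernel that turns the Slobodeckij seminorm into the weight `|n|^{2σ}`. -/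
lemma lintegral_kernel_scaled {σ : ℝ} {r : ℝ} (hr : 0 < r) :
    ∫⁻ h : ℝ, ENNReal.ofReal (min 4 ((Real.pi * (r * h)) ^ 2) / |h| ^ (1 + 2 * σ))
      = ENNReal.ofReal (r ^ (2 * σ)) *
        ∫⁻ t : ℝ, ENNReal.ofReal (min 4 ((Real.pi * t) ^ 2) / |t| ^ (1 + 2 * σ)) := by
  have hm : Measurable fun t : ℝ =>
    ENNReal.ofReal (min 4 ((Real.pi * t) ^ 2) / |t| ^ (1 + 2 * σ)) := by fun_prop
  have h1 : ∫⁻ t : ℝ, ENNReal.ofReal (min 4 ((Real.pi * t) ^ 2) / |t| ^ (1 + 2 * σ))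
      = ENNReal.ofReal r * ∫⁻ h : ℝ,
        ENNReal.ofReal (min 4 ((Real.pi * (r * h)) ^ 2) / |r * h| ^ (1 + 2 * σ)) := by
    conv_lhs => rw [← Real.smul_map_volume_mul_left hr.ne', abs_of_pos hr]
    rw [lintegral_smul_measure, lintegral_map hm (by fun_prop), smul_eq_mul]
  rw [h1, ← mul_assoc, ← ENNReal.ofReal_mul (by positivity),
    ← lintegral_const_mul' _ _ ENNReal.ofReal_ne_top]
  refine lintegral_congr fun h => ?_
  rw [← ENNReal.ofReal_mul (by positivity), abs_mul, abs_of_pos hr,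
    Real.mul_rpow hr.le (abs_nonneg _), Real.rpow_add hr, Real.rpow_one]
  congr 1
  field_simp

/-- A periodic function whose Fourier coefficients are square summable with the weight `|n|^{2σ}`
has a finite Slobodeckij seminorm. -/
lemma finiteSlobodeckij_of_fourierCoeff {σ : ℝ} (h0 : 0 < σ) (h1 : σ < 1)
    {P : AddCircle (2 : ℝ) → ℂ} (hPm : Measurable P) (hP : MemLp P 2 haarAddCircle)
    (hs : Summable fun n : ℤ => |(n : ℝ)| ^ (2 * σ) * ‖fourierCoeff P n‖ ^ 2) :
    FiniteSlobodeckij σ fun x : ℝ => P x := by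
  have hpm : Measurable fun x : ℝ => P x := hPm.comp AddCircle.measurable_mk'
  rw [FiniteSlobodeckij, slobodeckij_eq_increments σ hpm]
  set c := ∫⁻ t : ℝ, ENNReal.ofReal (min 4 ((Real.pi * t) ^ 2) / |t| ^ (1 + 2 * σ)) with hc
  have hinc : ∀ h : ℝ, ∫⁻ x in Ioc (-1 : ℝ) 1,
      ENNReal.ofReal (‖P ((x + h : ℝ) : AddCircle (2 : ℝ)) - P x‖ ^ 2) = 2 * ∑' n : ℤ,
        ENNReal.ofReal (‖fourier n (h : AddCircle (2 : ℝ)) - 1‖ ^ 2 * ‖fourierCoeff P n‖ ^ 2) := by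
    intro h
    have hm2 : MemLp (fun x => P (x + h) - P x) 2 haarAddCircle :=
      (hP.comp_measurePreserving (measurePreserving_add_right haarAddCircle
        (h : AddCircle (2 : ℝ)))).sub hP
    have := tsum_ofReal_sq_fourierCoeff hm2
    simp_rw [fourierCoeff_increment (hP.integrable one_le_two), norm_mul, mul_pow] at this
    rw [this, ← lintegral_Ioc_eq_haar]
    rfl
  calc _ ≤ ∫⁻ h : ℝ, ∑' n : ℤ, 2 * (ENNReal.ofReal (‖fourierCoeff P n‖ ^ 2) *
        ENNReal.ofReal (min 4 ((Real.pi * (|(n : ℝ)| * h)) ^ 2) / |h| ^ (1 + 2 * σ))) := by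
        refine lintegral_mono fun h => ?_
        calc _ ≤ ∫⁻ x in Ioc (-1 : ℝ) 1, ENNReal.ofReal (|h| ^ (1 + 2 * σ))⁻¹ *
              ENNReal.ofReal (‖P ((x + h : ℝ) : AddCircle (2 : ℝ)) - P x‖ ^ 2) := by
              refine (lintegral_mono_set ?_).trans (lintegral_mono fun x => ?_)
              · intro x hx
                exact ⟨by linarith [hx.1.1], hx.1.2.le⟩
              · rw [← ENNReal.ofReal_mul (by positivity), div_eq_inv_mul]
          _ = ENNReal.ofReal (|h| ^ (1 + 2 * σ))⁻¹ * (2 * ∑' n : ℤ, ENNReal.ofReal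
                (‖fourier n (h : AddCircle (2 : ℝ)) - 1‖ ^ 2 * ‖fourierCoeff P n‖ ^ 2)) := by
              rw [lintegral_const_mul' _ _ ENNReal.ofReal_ne_top, hinc]
          _ = ∑' n : ℤ, 2 * (ENNReal.ofReal (|h| ^ (1 + 2 * σ))⁻¹ * ENNReal.ofReal
                (‖fourier n (h : AddCircle (2 : ℝ)) - 1‖ ^ 2 * ‖fourierCoeff P n‖ ^ 2)) := by
              rw [ENNReal.tsum_mul_left, ENNReal.tsum_mul_left, mul_left_comm]
          _ ≤ _ := by
              refine ENNReal.tsum_le_tsum fun n => ?_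
              rw [← ENNReal.ofReal_mul (by positivity), ← ENNReal.ofReal_mul (by positivity)]
              gcongr 2 * ENNReal.ofReal ?_
              have := norm_fourier_sub_one_le n h
              calc _ ≤ (|h| ^ (1 + 2 * σ))⁻¹ * (min 4 ((Real.pi * (|(n : ℝ)| * h)) ^ 2) *
                    ‖fourierCoeff P n‖ ^ 2) := by gcongr
                _ = _ := by ring
    _ = ∑' n : ℤ, 2 * (ENNReal.ofReal (‖fourierCoeff P n‖ ^ 2) * ∫⁻ h : ℝ,
        ENNReal.ofReal (min 4 ((Real.pi * (|(n : ℝ)| * h)) ^ 2) / |h| ^ (1 + 2 * σ))) := by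
        rw [lintegral_tsum fun n => by fun_prop]
        refine tsum_congr fun n => ?_
        rw [lintegral_const_mul' _ _ (by norm_num), lintegral_const_mul' _ _ ENNReal.ofReal_ne_top]
    _ ≤ ∑' n : ℤ, 2 * c * ENNReal.ofReal (|(n : ℝ)| ^ (2 * σ) * ‖fourierCoeff P n‖ ^ 2) := by
        refine ENNReal.tsum_le_tsum fun n => ?_
        rcases eq_or_ne n 0 with rfl | hn
        · have e : ∀ h : ℝ, min (4 : ℝ) ((Real.pi * (|((0 : ℤ) : ℝ)| * h)) ^ 2) = 0 := by
            intro h; simp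
          simp only [e, zero_div, ENNReal.ofReal_zero, lintegral_zero, mul_zero]
          exact zero_le
        · rw [lintegral_kernel_scaled (abs_pos.2 (by exact_mod_cast hn)),
            ENNReal.ofReal_mul (by positivity)]
          apply le_of_eq
          ring
    _ < ⊤ := by
        rw [ENNReal.tsum_mul_left]
        refine ENNReal.mul_lt_top (ENNReal.mul_lt_top (by norm_num)
          (lintegral_kernel_lt_top h0 h1)) ?_
        rw [← ENNReal.ofReal_tsum_of_nonneg (fun _ => by positivity) hs]
        exact ENNReal.ofReal_lt_top

end

section

open Filter Topology AddCircle

/-! ### Functions with prescribed sine coefficients -/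

lemma integral_circle_mul_exp (P : AddCircle (2 : ℝ) → ℂ) (k : ℤ) :
    ∫ x in (-1 : ℝ)..1, P x * Complex.exp (Real.pi * k * x * Complex.I)
      = 2 * fourierCoeff P (-k) := by
  have h := fourierCoeff_eq_intervalIntegral P (-k) (-1)
  rw [show (-1 : ℝ) + 2 = 1 by norm_num, neg_neg] at h
  rw [h, Complex.real_smul]
  push_cast
  rw [← mul_assoc, show (2 : ℂ) * (1 / 2) = 1 by norm_num, one_mul]
  refine intervalIntegral.integral_congr fun x _ => ?_
  simp only [smul_eq_mul]
  rw [fourier_coe_apply, mul_comm]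
  congr 2
  push_cast
  ring

lemma fourierCoeff_comp_neg (P : AddCircle (2 : ℝ) → ℂ) (k : ℤ) :
    fourierCoeff (fun x => P (-x)) k = fourierCoeff P (-k) := by
  rw [fourierCoeff, fourierCoeff,
    ← integral_neg_eq_self (fun x => (fourier (- -k) x : ℂ) • P x)]
  refine integral_congr_ae (ae_of_all _ fun x => ?_)
  simp only [fourier_apply, neg_neg, smul_neg, neg_smul]

lemma memLp_circle_restrict {P : AddCircle (2 : ℝ) → ℂ} (hP : MemLp P 2 haarAddCircle) :
    MemLp (fun x : ℝ => P x) 2 (volume.restrict (Ioc (-1 : ℝ) 1)) := by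
  have h := (memLp_haarAddCircle_iff.1 hP).comp_measurePreserving
    (AddCircle.measurePreserving_mk (2 : ℝ) (-1))
  rw [show (-1 : ℝ) + 2 = 1 by norm_num] at h
  exact h

/-- The restrictions to `(0,1)` of a periodic function, with the Fourier coefficients `b n` for
positive and `0` for nonpositive frequencies, and of its reflection. -/
lemma exists_restrictions {b : ℕ → ℂ} (hb : Summable fun n => ‖b n‖ ^ 2) :
    ∃ p q : ℝ → ℂ, MemLp p 2 (volume.restrict (Ioo (0 : ℝ) 1)) ∧
      MemLp q 2 (volume.restrict (Ioo (0 : ℝ) 1)) ∧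
      (∀ k : ℤ, 0 ≤ k → expCoeff k p + expCoeff (-k) q = 0) ∧
      (∀ k : ℕ, 1 ≤ k → expCoeff (-k) p + expCoeff k q = 2 * b k) ∧
      ∀ σ : ℝ, 0 < σ → σ < 1 → Summable (fun n : ℕ => (n : ℝ) ^ (2 * σ) * ‖b n‖ ^ 2) →
        FiniteSlobodeckij σ p ∧ FiniteSlobodeckij σ q := by
  set a : ℤ → ℂ := fun n => if 0 < n then b n.toNat else 0 with ha
  have hsum : ∀ u : ℤ → ℝ, Summable (fun n : ℕ => u n * ‖b n‖ ^ 2) →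
      Summable fun n : ℤ => u n * ‖a n‖ ^ 2 := by
    intro u hu
    refine Summable.of_nat_of_neg ?_ ?_
    · rw [← summable_nat_add_iff 1] at hu ⊢
      refine hu.congr fun n => ?_
      have : (0 : ℤ) < ((n + 1 : ℕ) : ℤ) := by positivity
      simp only [ha, if_pos this, Int.toNat_natCast]
    · refine summable_zero.congr fun n => ?_
      have : ¬ (0 : ℤ) < -(n : ℤ) := by omega
      simp [ha, if_neg this]
  have ha2 : Summable fun n => ‖a n‖ ^ 2 := by
    simpa using hsum (fun _ => 1) (by simpa using hb)
  obtain ⟨P, hPm, hP, hPa⟩ := exists_fourierCoeff_eq ha2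
  have hQm : Measurable fun x => P (-x) := hPm.comp measurable_neg
  have hQ : MemLp (fun x => P (-x)) 2 haarAddCircle :=
    hP.comp_measurePreserving (Measure.measurePreserving_neg _)
  have hp := memLp_circle_restrict hP
  have hsub : Ioo (0 : ℝ) 1 ⊆ Ioc (-1) 1 := fun x hx => ⟨by linarith [hx.1], hx.2.le⟩
  have hcoe : ∀ k : ℤ, expCoeff k (fun x : ℝ => P x) + expCoeff (-k) (fun x : ℝ => P (-x))
      = 2 * a (-k) := by
    intro k
    rw [← hPa, ← integral_circle_mul_exp, expCoeff, expCoeff, add_comm]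
    have hi : IntervalIntegrable (fun x : ℝ => P x * Complex.exp (Real.pi * k * x * Complex.I))
        volume (-1) 1 := by
      refine IntervalIntegrable.mul_continuousOn ?_ (by fun_prop)
      rw [intervalIntegrable_iff_integrableOn_Ioc_of_le (by norm_num)]
      exact hp.integrable one_le_two
    rw [← intervalIntegral.integral_add_adjacent_intervals (a := -1) (b := 0) (c := 1)
      (hi.mono_set (by rw [uIcc_of_le (by norm_num), uIcc_of_le (by norm_num)]
                       exact Icc_subset_Icc le_rfl zero_le_one))
      (hi.mono_set (by rw [uIcc_of_le (by norm_num), uIcc_of_le (by norm_num)]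
                       exact Icc_subset_Icc (by norm_num) le_rfl))]
    congr 1
    have h := intervalIntegral.integral_comp_neg (a := (0 : ℝ)) (b := 1)
      (fun x : ℝ => P x * Complex.exp (Real.pi * k * x * Complex.I))
    rw [neg_zero] at h
    rw [← h]
    refine intervalIntegral.integral_congr fun x _ => ?_
    push_cast
    congr 2
    ring
  refine ⟨fun x => P x, fun x => P (-x), hp.mono_measure (Measure.restrict_mono hsub le_rfl),
    (memLp_circle_restrict hQ).mono_measure (Measure.restrict_mono hsub le_rfl), ?_, ?_, ?_⟩
  · intro k hk
    have : ¬ 0 < -k := by omega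
    rw [hcoe, ha]
    simp only [if_neg this, mul_zero]
  · intro k hk
    have h := hcoe (-k)
    have : (0 : ℤ) < (k : ℤ) := by omega
    rw [neg_neg] at h
    rw [h, ha]
    simp only [if_pos this, Int.toNat_natCast]
  · intro σ h0 h1 hs
    have hs' := hsum (fun n => |(n : ℝ)| ^ (2 * σ)) (by simpa using hs)
    refine ⟨finiteSlobodeckij_of_fourierCoeff h0 h1 hPm hP (by simpa only [hPa] using hs'),
      finiteSlobodeckij_of_fourierCoeff (P := fun x => P (-x)) h0 h1 hQm hQ ?_⟩
    simp only [fourierCoeff_comp_neg, hPa]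
    refine (hs'.comp_injective neg_injective).congr fun n => ?_
    simp

lemma expCoeff_add_mul {p q : ℝ → ℂ} (hp : IntervalIntegrable p volume 0 1)
    (hq : IntervalIntegrable q volume 0 1) (c d : ℂ) (k : ℤ) :
    expCoeff k (fun x => c * p x + d * q x) = c * expCoeff k p + d * expCoeff k q := by
  simp only [expCoeff]
  rw [← intervalIntegral.integral_const_mul, ← intervalIntegral.integral_const_mul,
    ← intervalIntegral.integral_add
      ((intervalIntegrable_mul_continuous hp (by fun_prop)).const_mul _)
      ((intervalIntegrable_mul_continuous hq (by fun_prop)).const_mul _)]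
  refine intervalIntegral.integral_congr fun x _ => ?_
  ring

/-- The function is the odd combination of the restrictions, so that the positive frequencies survive
in the sine coefficients. -/
lemma exists_sinCoeff_eq {b : ℕ → ℂ} (hb : Summable fun n => ‖b n‖ ^ 2) :
    ∃ u : ℝ → ℂ, MemLp u 2 (volume.restrict (Ioo (0 : ℝ) 1)) ∧
      (∀ n, 1 ≤ n → sinCoeff n u = b n) ∧
      ∀ σ : ℝ, 0 < σ → σ < 1 → Summable (fun n : ℕ => (n : ℝ) ^ (2 * σ) * ‖b n‖ ^ 2) →
        FiniteSlobodeckij σ u := by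
  obtain ⟨p, q, hp, hq, h1, h2, h3⟩ := exists_restrictions hb
  have hpi := intervalIntegrable_of_memLp hp
  have hqi := intervalIntegrable_of_memLp hq
  refine ⟨fun x => -Complex.I * p x + Complex.I * q x, (hp.const_mul _).add (hq.const_mul _),
    fun n hn => ?_, fun σ h0 hσ1 hs => ?_⟩
  · rw [sinCoeff_eq_expCoeff ((hpi.const_mul _).add (hqi.const_mul _)),
      expCoeff_add_mul hpi hqi, expCoeff_add_mul hpi hqi]
    have e1 := h1 n (by positivity)
    have e2 := h2 n hn
    linear_combination (-Complex.I ^ 2 / 2) * (e2 - e1) + (-b n) * Complex.I_sq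
  · obtain ⟨hs1, hs2⟩ := h3 σ h0 hσ1 hs
    exact (hs1.const_mul _ hp.1).add (hs2.const_mul _ hq.1) (hp.const_mul _).1 (hq.const_mul _).1

/-- The even counterpart; the mean value vanishes because the frequency `0` does not occur. -/
lemma exists_cosCoeff_eq {b : ℕ → ℂ} (hb : Summable fun n => ‖b n‖ ^ 2) :
    ∃ u : ℝ → ℂ, MemLp u 2 (volume.restrict (Ioo (0 : ℝ) 1)) ∧
      (∀ n, 1 ≤ n → cosCoeff n u = b n) ∧ (∫ x in (0 : ℝ)..1, u x = 0) ∧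
      ∀ σ : ℝ, 0 < σ → σ < 1 → Summable (fun n : ℕ => (n : ℝ) ^ (2 * σ) * ‖b n‖ ^ 2) →
        FiniteSlobodeckij σ u := by
  obtain ⟨p, q, hp, hq, h1, h2, h3⟩ := exists_restrictions hb
  have hpi := intervalIntegrable_of_memLp hp
  have hqi := intervalIntegrable_of_memLp hq
  refine ⟨fun x => 1 * p x + 1 * q x, (hp.const_mul _).add (hq.const_mul _),
    fun n hn => ?_, ?_, fun σ h0 hσ1 hs => ?_⟩
  · rw [cosCoeff_eq_expCoeff ((hpi.const_mul _).add (hqi.const_mul _)),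
      expCoeff_add_mul hpi hqi, expCoeff_add_mul hpi hqi]
    have e1 := h1 n (by positivity)
    have e2 := h2 n hn
    linear_combination (e1 + e2) / 2
  · have e1 := h1 0 le_rfl
    have e2 := expCoeff_add_mul hpi hqi 1 1 0
    rw [neg_zero] at e1
    rw [one_mul, one_mul, e1, expCoeff] at e2
    simpa using e2
  · obtain ⟨hs1, hs2⟩ := h3 σ h0 hσ1 hs
    exact (hs1.const_mul _ hp.1).add (hs2.const_mul _ hq.1) (hp.const_mul _).1 (hq.const_mul _).1

lemma memLp_primitive {v : ℝ → ℂ} (hv : IntervalIntegrable v volume 0 1) (c : ℂ) :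
    MemLp (fun x => c + ∫ t in (0 : ℝ)..x, v t) 2 (volume.restrict (Ioo (0 : ℝ) 1)) := by
  have hc : ContinuousOn (fun x => c + ∫ t in (0 : ℝ)..x, v t) (Icc 0 1) := by
    refine continuousOn_const.add ?_
    rw [← uIcc_of_le zero_le_one]
    refine intervalIntegral.continuousOn_primitive_interval ?_
    rw [uIcc_of_le zero_le_one]
    exact (intervalIntegrable_iff_integrableOn_Icc_of_le zero_le_one).1 hv
  obtain ⟨M, hM⟩ := isCompact_Icc.exists_bound_of_continuousOn hc
  refine MemLp.of_bound ((hc.mono Ioo_subset_Icc_self).aestronglyMeasurable measurableSet_Ioo) M ?_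
  filter_upwards [ae_restrict_mem measurableSet_Ioo] with x hx
  exact hM x (Ioo_subset_Icc_self hx)

lemma hasDerivAt_cos_mul (n : ℕ) (x : ℝ) (hn : n ≠ 0) :
    HasDerivAt (fun x : ℝ => -((Real.cos (Real.pi * n * x) / (Real.pi * n) : ℝ) : ℂ))
      (Real.sin (Real.pi * n * x) : ℂ) x := by
  have hpi := Real.pi_ne_zero
  have hn' : (n : ℝ) ≠ 0 := by exact_mod_cast hn
  have h1 : HasDerivAt (fun x : ℝ => Real.pi * n * x) (Real.pi * n) x := by
    simpa using (hasDerivAt_id x).const_mul (Real.pi * n)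
  have h2 := ((h1.cos).div_const (Real.pi * n)).neg.ofReal_comp
  convert h2 using 1
  · ext y; simp
  · congr 1; field_simp

lemma hasDerivAt_sin_mul (n : ℕ) (x : ℝ) (hn : n ≠ 0) :
    HasDerivAt (fun x : ℝ => ((Real.sin (Real.pi * n * x) / (Real.pi * n) : ℝ) : ℂ))
      (Real.cos (Real.pi * n * x) : ℂ) x := by
  have hpi := Real.pi_ne_zero
  have hn' : (n : ℝ) ≠ 0 := by exact_mod_cast hn
  have h1 : HasDerivAt (fun x : ℝ => Real.pi * n * x) (Real.pi * n) x := by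
    simpa using (hasDerivAt_id x).const_mul (Real.pi * n)
  have h2 := ((h1.sin).div_const (Real.pi * n)).ofReal_comp
  convert h2 using 1
  congr 1; field_simp

lemma sinCoeff_primitive {v : ℝ → ℂ} (hv : IntervalIntegrable v volume 0 1)
    (h0 : ∫ x in (0 : ℝ)..1, v x = 0) {n : ℕ} (hn : n ≠ 0) :
    sinCoeff n (fun x => ∫ t in (0 : ℝ)..x, v t) = cosCoeff n v / (Real.pi * n) := by
  rw [sinCoeff, integral_primitive_mul_deriv hv (hasDerivAt_cos_mul n · hn) (by fun_prop), h0,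
    zero_mul, zero_sub, cosCoeff, ← intervalIntegral.integral_neg,
    ← intervalIntegral.integral_div]
  refine intervalIntegral.integral_congr fun x _ => ?_
  push_cast
  ring

lemma cosCoeff_primitive {v : ℝ → ℂ} (hv : IntervalIntegrable v volume 0 1) (c : ℂ)
    {n : ℕ} (hn : n ≠ 0) :
    cosCoeff n (fun x => c + ∫ t in (0 : ℝ)..x, v t) = -(sinCoeff n v / (Real.pi * n)) := by
  have hcc : Continuous fun x : ℝ => (Real.cos (Real.pi * n * x) : ℂ) := by fun_prop
  have hi2 : IntervalIntegrable (fun x : ℝ => (∫ t in (0 : ℝ)..x, v t) *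
      (Real.cos (Real.pi * n * x) : ℂ)) volume 0 1 := by
    have := intervalIntegrable_mul_continuous (intervalIntegrable_of_memLp (memLp_primitive hv 0)) hcc
    simpa using this
  have hs1 : Real.sin (Real.pi * n * 1) = 0 := by
    rw [mul_one, mul_comm]; exact Real.sin_nat_mul_pi n
  rw [cosCoeff]
  simp_rw [add_mul]
  rw [intervalIntegral.integral_add ((hcc.intervalIntegrable _ _).const_mul c) hi2,
    intervalIntegral.integral_const_mul,
    intervalIntegral.integral_eq_sub_of_hasDerivAt (fun x _ => hasDerivAt_sin_mul n x hn)
      (hcc.intervalIntegrable _ _),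
    integral_primitive_mul_deriv hv (hasDerivAt_sin_mul n · hn) hcc, hs1, sinCoeff,
    ← intervalIntegral.integral_div]
  have e : ∫ x in (0 : ℝ)..1, v x * ((Real.sin (Real.pi * n * x) / (Real.pi * n) : ℝ) : ℂ)
      = ∫ x in (0 : ℝ)..1, v x * (Real.sin (Real.pi * n * x) : ℂ) / (Real.pi * n) := by
    refine intervalIntegral.integral_congr fun x _ => ?_
    push_cast
    ring
  rw [e]
  simp

/-- Any sequence that is square summable with the weight `n^{2s}`, `0 < s ≤ 2`, is the sequence of
the sine coefficients of a function of class `W^s_2`. -/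
theorem exists_memW_sinCoeff_eq {s : ℝ} (h0 : 0 < s) (h2 : s ≤ 2) {b : ℕ → ℂ}
    (hb : Summable fun n : ℕ => (n : ℝ) ^ (2 * s) * ‖b n‖ ^ 2) :
    ∃ g : ℝ → ℂ, MemW s g ∧ ∀ n : ℕ, 1 ≤ n → sinCoeff n g = b n := by
  have hlow : ∀ t : ℝ, t ≤ s → Summable fun n : ℕ => (n : ℝ) ^ (2 * t) * ‖b n‖ ^ 2 := by
    intro t hts
    refine Summable.of_norm_bounded_eventually_nat hb ?_
    filter_upwards [eventually_ge_atTop 1] with n hn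
    rw [Real.norm_of_nonneg (by positivity)]
    have : (1 : ℝ) ≤ n := by exact_mod_cast hn
    gcongr
  -- `s < 1`: an odd function; `1 ≤ s < 2`: the primitive of an even one; `s = 2`: two primitives
  rcases lt_or_ge s 1 with h1 | h1
  · obtain ⟨u, hu, hun, hus⟩ := exists_sinCoeff_eq (b := b) (by simpa using hlow 0 h0.le)
    exact ⟨u, (memW_iff_of_lt_one h0 h1).2 ⟨hu, hus s h0 h1 hb⟩, hun⟩
  rcases h2.lt_or_eq with h2 | rfl
  · have hfl : ⌊s⌋₊ = 1 := by
      rw [Nat.floor_eq_iff h0.le]; constructor <;> norm_num <;> linarith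
    have hfr : Int.fract s = s - 1 := by
      rw [Int.fract_eq_iff]
      exact ⟨by linarith, by linarith, 1, by push_cast; ring⟩
    have hw : ∀ t : ℝ, t + 1 ≤ s → Summable fun n : ℕ =>
        (n : ℝ) ^ (2 * t) * ‖(Real.pi : ℂ) * n * b n‖ ^ 2 := by
      intro t ht
      refine (((hlow (t + 1) ht).mul_left (Real.pi ^ 2))).of_norm_bounded_eventually_nat ?_
      filter_upwards [eventually_ge_atTop 1] with n hn
      have hn0 : (0 : ℝ) < n := by exact_mod_cast hn
      rw [Real.norm_of_nonneg (by positivity), norm_mul, norm_mul, Complex.norm_real,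
        Complex.norm_natCast, Real.norm_of_nonneg Real.pi_pos.le, mul_add, Real.rpow_add hn0]
      apply le_of_eq
      rw [show (n : ℝ) ^ ((2 : ℝ) * 1) = (n : ℝ) ^ 2 by
        rw [mul_one, ← Real.rpow_natCast]; norm_num]
      ring
    obtain ⟨v, hv, hvn, hv0, hvs⟩ := exists_cosCoeff_eq
      (b := fun n => (Real.pi : ℂ) * n * b n) (by simpa using hw 0 (by linarith))
    have hvi := intervalIntegrable_of_memLp hv
    refine ⟨fun x => 0 + ∫ t in (0 : ℝ)..x, v t, ?_, fun n hn => ?_⟩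
    · refine ⟨fun k => if k = 0 then fun x => 0 + ∫ t in (0 : ℝ)..x, v t else v, rfl, ?_, ?_, ?_⟩
      · intro k hk
        by_cases hk0 : k = 0
        · simp only [if_pos hk0]; exact memLp_primitive hvi 0
        · simp only [if_neg hk0]; exact hv
      · intro k hk
        obtain rfl : k = 0 := by omega
        exact isWeakDeriv_primitive hvi 0
      · rw [hfr, hfl]
        intro hs
        exact hvs _ hs (by linarith) (hw _ (by linarith))
    · simp only [zero_add]
      have hpi : (Real.pi : ℂ) ≠ 0 := by exact_mod_cast Real.pi_ne_zero
      have hn' : (n : ℂ) ≠ 0 := by exact_mod_cast (by omega : n ≠ 0)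
      rw [sinCoeff_primitive hvi hv0 (by omega), hvn n hn]
      field_simp
  · have hw : Summable fun n : ℕ => ‖-((Real.pi : ℂ) * n) ^ 2 * b n‖ ^ 2 := by
      refine (hb.mul_left (Real.pi ^ 4)).congr fun n => ?_
      rw [norm_mul, norm_neg, norm_pow, norm_mul, Complex.norm_real,
        Complex.norm_natCast, Real.norm_of_nonneg Real.pi_pos.le,
        show (2 : ℝ) * 2 = (4 : ℕ) by norm_num, Real.rpow_natCast]
      ring
    obtain ⟨w, hw, hwn, -⟩ := exists_sinCoeff_eq (b := fun n => -((Real.pi : ℂ) * n) ^ 2 * b n) hw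
    have hwi := intervalIntegrable_of_memLp hw
    set c : ℂ := -∫ x in (0 : ℝ)..1, ∫ t in (0 : ℝ)..x, w t with hc
    set v : ℝ → ℂ := fun x => c + ∫ t in (0 : ℝ)..x, w t with hv
    have hvL : MemLp v 2 (volume.restrict (Ioo (0 : ℝ) 1)) := memLp_primitive hwi c
    have hvi := intervalIntegrable_of_memLp hvL
    have hv0 : ∫ x in (0 : ℝ)..1, v x = 0 := by
      have hi := intervalIntegrable_of_memLp (memLp_primitive hwi 0)
      simp only [zero_add] at hi
      rw [hv, intervalIntegral.integral_add intervalIntegrable_const hi]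
      simp [hc]
    have hfl : ⌊(2 : ℝ)⌋₊ = 2 := by norm_num
    refine ⟨fun x => 0 + ∫ t in (0 : ℝ)..x, v t, ?_, fun n hn => ?_⟩
    · refine ⟨fun k => if k = 0 then fun x => 0 + ∫ t in (0 : ℝ)..x, v t else
        if k = 1 then v else w, rfl, ?_, ?_, ?_⟩
      · intro k hk
        by_cases hk0 : k = 0
        · simp only [if_pos hk0]; exact memLp_primitive hvi 0
        · by_cases hk1 : k = 1
          · simp only [if_neg hk0, if_pos hk1]; exact hvL
          · simp only [if_neg hk0, if_neg hk1]; exact hw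
      · intro k hk
        rw [hfl] at hk
        interval_cases k
        · exact isWeakDeriv_primitive hvi 0
        · exact isWeakDeriv_primitive hwi c
      · intro hs
        exfalso
        rw [show Int.fract (2 : ℝ) = 0 from Int.fract_ofNat 2] at hs
        exact lt_irrefl _ hs
    · simp only [zero_add]
      have hpi : (Real.pi : ℂ) ≠ 0 := by exact_mod_cast Real.pi_ne_zero
      have hn' : (n : ℂ) ≠ 0 := by exact_mod_cast (by omega : n ≠ 0)
      rw [sinCoeff_primitive hvi hv0 (by omega), hv, cosCoeff_primitive hwi c (by omega), hwn n hn]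
      field_simp

end

section

open Filter Topology

/-! ### Asymptotics of the zeros -/

lemma norm_exp_sub_le {w : ℂ} (hw : ‖w‖ ≤ 1) : ‖Complex.exp w - (1 + w + w ^ 2 / 2)‖ ≤ ‖w‖ ^ 3 := by
  have h := Complex.exp_bound hw (n := 3) (by norm_num)
  simp only [Finset.sum_range_succ, Finset.sum_range_zero, Nat.factorial] at h
  norm_num at h
  refine h.trans ?_
  have : 0 ≤ ‖w‖ ^ 3 := by positivity
  linarith

lemma norm_sin_sub_le {w : ℂ} (hw : ‖w‖ ≤ 1) : ‖Complex.sin w - w‖ ≤ ‖w‖ ^ 3 := by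
  have h1 := norm_exp_sub_le (w := w * Complex.I) (by simpa using hw)
  have h2 := norm_exp_sub_le (w := -w * Complex.I) (by simpa using hw)
  have e : Complex.sin w - w = ((Complex.exp (-w * Complex.I) - (1 + -w * Complex.I
      + (-w * Complex.I) ^ 2 / 2)) - (Complex.exp (w * Complex.I) - (1 + w * Complex.I
      + (w * Complex.I) ^ 2 / 2))) * (Complex.I / 2) := by
    rw [Complex.sin]
    linear_combination (-w) * Complex.I_sq
  rw [norm_mul, Complex.norm_I, mul_one] at h1 h2
  rw [norm_neg] at h2
  rw [e, norm_mul, norm_div, Complex.norm_I, Complex.norm_ofNat]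
  have := norm_sub_le (Complex.exp (-w * Complex.I) - (1 + -w * Complex.I
      + (-w * Complex.I) ^ 2 / 2)) (Complex.exp (w * Complex.I) - (1 + w * Complex.I
      + (w * Complex.I) ^ 2 / 2))
  linarith

lemma norm_cos_sub_le {w : ℂ} (hw : ‖w‖ ≤ 1) : ‖Complex.cos w - 1 + w ^ 2 / 2‖ ≤ ‖w‖ ^ 3 := by
  have h1 := norm_exp_sub_le (w := w * Complex.I) (by simpa using hw)
  have h2 := norm_exp_sub_le (w := -w * Complex.I) (by simpa using hw)
  have e : Complex.cos w - 1 + w ^ 2 / 2 = ((Complex.exp (-w * Complex.I) - (1 + -w * Complex.I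
      + (-w * Complex.I) ^ 2 / 2)) + (Complex.exp (w * Complex.I) - (1 + w * Complex.I
      + (w * Complex.I) ^ 2 / 2))) / 2 := by
    rw [Complex.cos]
    linear_combination (w ^ 2 / 2) * Complex.I_sq
  rw [norm_mul, Complex.norm_I, mul_one] at h1 h2
  rw [norm_neg] at h2
  rw [e, norm_div, Complex.norm_ofNat]
  have := norm_add_le (Complex.exp (-w * Complex.I) - (1 + -w * Complex.I
      + (-w * Complex.I) ^ 2 / 2)) (Complex.exp (w * Complex.I) - (1 + w * Complex.I
      + (w * Complex.I) ^ 2 / 2))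
  linarith

/-- The equation satisfied by the displacement `t` of the `n`-th zero. -/
lemma IsZeroNumbering.sin_eq {f : ℝ → ℂ} (hf : IntervalIntegrable f volume 0 1) {ξ : ℕ → ℂ}
    (hξ : IsZeroNumbering f ξ) {n : ℕ} (hn : 1 ≤ n) {t : ℂ} (ht : ξ n = Real.pi * n / 2 + t) :
    Complex.sin t = ∫ x in (0 : ℝ)..1,
      f x * Complex.sin (Real.pi * n * x - t * (1 - 2 * (x : ℂ))) := by
  obtain ⟨-, hc, hs⟩ := hξ.tendsto hf
  have harg : ∀ x : ℝ, (Real.pi * n / 2 + t) * (1 - 2 * (x : ℂ))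
      = Real.pi * n / 2 - (Real.pi * n * x - t * (1 - 2 * (x : ℂ))) := fun x => by ring
  rcases Nat.even_or_odd' n with ⟨k, rfl | rfl⟩
  · obtain ⟨m, rfl⟩ : ∃ m, k = m + 1 := ⟨k - 1, by omega⟩
    have h := hs m
    rw [show 2 * m + 2 = 2 * (m + 1) by ring, ht, lamFs] at h
    have hs0 : Complex.sin ((Real.pi : ℂ) * (2 * (m + 1) : ℕ) / 2) = 0 := by
      rw [Complex.sin_eq_zero_iff]
      exact ⟨m + 1, by push_cast; ring⟩
    have hc0 : Complex.cos ((Real.pi : ℂ) * (2 * (m + 1) : ℕ) / 2) ≠ 0 := by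
      intro h0
      have := Complex.sin_sq_add_cos_sq ((Real.pi : ℂ) * (2 * (m + 1) : ℕ) / 2)
      rw [h0, hs0] at this
      norm_num at this
    simp_rw [harg] at h
    rw [Complex.sin_add, hs0] at h
    simp_rw [Complex.sin_sub ((Real.pi : ℂ) * (2 * (m + 1) : ℕ) / 2), hs0, zero_mul, zero_sub,
      zero_add, mul_neg, mul_left_comm (f _)] at h
    rw [intervalIntegral.integral_neg, intervalIntegral.integral_const_mul, ← sub_eq_add_neg,
      ← mul_sub] at h
    exact sub_eq_zero.1 ((mul_eq_zero.1 h).resolve_left hc0)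
  · have h := hc k
    rw [ht, Fc] at h
    have hc0 : Complex.cos ((Real.pi : ℂ) * (2 * k + 1 : ℕ) / 2) = 0 := by
      rw [Complex.cos_eq_zero_iff]
      exact ⟨k, by push_cast; ring⟩
    have hs0 : Complex.sin ((Real.pi : ℂ) * (2 * k + 1 : ℕ) / 2) ≠ 0 := by
      intro h0
      have := Complex.sin_sq_add_cos_sq ((Real.pi : ℂ) * (2 * k + 1 : ℕ) / 2)
      rw [h0, hc0] at this
      norm_num at this
    simp_rw [harg] at h
    rw [Complex.cos_add, hc0] at h
    simp_rw [Complex.cos_sub ((Real.pi : ℂ) * (2 * k + 1 : ℕ) / 2), hc0, zero_mul, zero_sub,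
      zero_add, mul_left_comm (f _)] at h
    rw [intervalIntegral.integral_const_mul, ← mul_neg, ← mul_add] at h
    exact neg_add_eq_zero.1 ((mul_eq_zero.1 h).resolve_left hs0)

lemma intervalIntegrable_V {f : ℝ → ℂ} (hf : IntervalIntegrable f volume 0 1) :
    IntervalIntegrable (V f) volume 0 1 :=
  hf.continuousOn_mul (g := fun x : ℝ => 1 - 2 * (x : ℂ)) (by fun_prop)

/-- Expansion of the right-hand side of `IsZeroNumbering.sin_eq` to second order in `t`. -/
lemma norm_integral_sin_sub_le {f : ℝ → ℂ} (hf : IntervalIntegrable f volume 0 1) (n : ℕ) {t : ℂ}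
    (ht : ‖t‖ ≤ 1) :
    ‖(∫ x in (0 : ℝ)..1, f x * Complex.sin (Real.pi * n * x - t * (1 - 2 * (x : ℂ))))
      - (sinCoeff n f - t * cosCoeff n (V f) - t ^ 2 / 2 * sinCoeff n (V (V f)))‖
      ≤ (2 * ∫ x in (0 : ℝ)..1, ‖f x‖) * ‖t‖ ^ 3 := by
  have hV := intervalIntegrable_V hf
  have hVV := intervalIntegrable_V hV
  rw [sinCoeff, cosCoeff, sinCoeff, ← intervalIntegral.integral_const_mul,
    ← intervalIntegral.integral_const_mul,
    ← intervalIntegral.integral_sub (intervalIntegrable_mul_continuous hf (by fun_prop))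
      ((intervalIntegrable_mul_continuous hV (by fun_prop)).const_mul _),
    ← intervalIntegral.integral_sub
      ((intervalIntegrable_mul_continuous hf (by fun_prop)).sub
        ((intervalIntegrable_mul_continuous hV (by fun_prop)).const_mul _))
      ((intervalIntegrable_mul_continuous hVV (by fun_prop)).const_mul _),
    ← intervalIntegral.integral_sub (intervalIntegrable_mul_continuous hf (by fun_prop))
      (((intervalIntegrable_mul_continuous hf (by fun_prop)).sub
        ((intervalIntegrable_mul_continuous hV (by fun_prop)).const_mul _)).sub
      ((intervalIntegrable_mul_continuous hVV (by fun_prop)).const_mul _)),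
    mul_comm 2, mul_assoc, ← intervalIntegral.integral_mul_const]
  refine intervalIntegral.norm_integral_le_of_norm_le zero_le_one (ae_of_all _ fun x hx => ?_)
    (hf.norm.mul_const _)
  set w : ℂ := t * (1 - 2 * (x : ℂ)) with hw
  set S : ℝ := Real.sin (Real.pi * n * x) with hS
  set C : ℝ := Real.cos (Real.pi * n * x) with hC
  have hwt : ‖w‖ ≤ ‖t‖ := by
    rw [hw, norm_mul]
    refine mul_le_of_le_one_right (norm_nonneg _) ?_
    have e : (1 - 2 * (x : ℂ)) = ((1 - 2 * x : ℝ) : ℂ) := by push_cast; ring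
    rw [e, Complex.norm_real, Real.norm_eq_abs, abs_le]
    constructor <;> linarith [hx.1, hx.2]
  have hsin : Complex.sin (Real.pi * n * x - w) = S * Complex.cos w - C * Complex.sin w := by
    rw [Complex.sin_sub, hS, hC]
    push_cast
    rfl
  have e : f x * Complex.sin (Real.pi * n * x - w) - (f x * S - t * (V f x * C)
      - t ^ 2 / 2 * (V (V f) x * S))
      = f x * (S * (Complex.cos w - 1 + w ^ 2 / 2) - C * (Complex.sin w - w)) := by
    rw [hsin, V, V, V, hw]
    ring
  rw [e, norm_mul]
  gcongr
  have h1 := norm_cos_sub_le (hwt.trans ht)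
  have h2 := norm_sin_sub_le (hwt.trans ht)
  have h3 : ‖w‖ ^ 3 ≤ ‖t‖ ^ 3 := by gcongr
  have h4 : ‖(S : ℂ)‖ ≤ 1 := by
    rw [Complex.norm_real]; exact Real.abs_sin_le_one _
  have h5 : ‖(C : ℂ)‖ ≤ 1 := by
    rw [Complex.norm_real]; exact Real.abs_cos_le_one _
  refine (norm_sub_le _ _).trans ?_
  rw [norm_mul, norm_mul]
  have h6 := mul_le_mul h4 h1 (norm_nonneg _) zero_le_one
  have h7 := mul_le_mul h5 h2 (norm_nonneg _) zero_le_one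
  linarith

/-- The remainder in the asymptotics is cubic in the Fourier coefficients. -/
lemma norm_remainder_le {t s c d e : ℂ} {K : ℝ} (hK : 0 ≤ K) (ht : ‖t‖ ≤ 1)
    (htK : K * ‖t‖ ^ 2 ≤ 1 / 2) (h : t = s - t * c - t ^ 2 / 2 * d + e) (he : ‖e‖ ≤ K * ‖t‖ ^ 3) :
    ‖t - (s - s * c)‖ ≤ (8 + 12 * K) * (‖s‖ + ‖c‖ + ‖d‖) ^ 3 := by
  set q := ‖s‖ + ‖c‖ + ‖d‖ with hq
  have hs := norm_nonneg s
  have hc := norm_nonneg c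
  have hd := norm_nonneg d
  have ht0 := norm_nonneg t
  have hq0 : 0 ≤ q := by positivity
  have hcq : ‖c‖ ≤ q := by linarith
  have hdq : ‖d‖ ≤ q := by linarith
  have htq : ‖t‖ ≤ 2 * q := by
    have h1 : ‖t‖ ≤ ‖s‖ + ‖t‖ * ‖c‖ + ‖t‖ ^ 2 / 2 * ‖d‖ + ‖e‖ := by
      calc ‖t‖ = ‖s - t * c - t ^ 2 / 2 * d + e‖ := by rw [← h]
        _ ≤ ‖s‖ + ‖t * c‖ + ‖t ^ 2 / 2 * d‖ + ‖e‖ :=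
          (norm_add_le _ _).trans (by
            gcongr; exact (norm_sub_le _ _).trans (by gcongr; exact norm_sub_le _ _))
        _ = _ := by simp
    have h2 : ‖t‖ * ‖c‖ ≤ 1 * ‖c‖ := by gcongr
    have h3 : ‖t‖ ^ 2 / 2 * ‖d‖ ≤ 1 ^ 2 / 1 * ‖d‖ := by gcongr; norm_num
    have h4 : K * ‖t‖ ^ 3 ≤ 1 / 2 * ‖t‖ := by
      calc K * ‖t‖ ^ 3 = K * ‖t‖ ^ 2 * ‖t‖ := by ring
        _ ≤ _ := by gcongr
    linarith
  have hid : t - (s - s * c) = c * (t * c) + c * (t ^ 2 / 2 * d) - c * e - t ^ 2 / 2 * d + e := by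
    linear_combination (1 - c) * h
  have hn : ‖t - (s - s * c)‖ ≤ ‖c‖ * (‖t‖ * ‖c‖) + ‖c‖ * (‖t‖ ^ 2 / 2 * ‖d‖) + ‖c‖ * ‖e‖
      + ‖t‖ ^ 2 / 2 * ‖d‖ + ‖e‖ := by
    rw [hid]
    calc _ ≤ ‖c * (t * c)‖ + ‖c * (t ^ 2 / 2 * d)‖ + ‖c * e‖ + ‖t ^ 2 / 2 * d‖ + ‖e‖ :=
          (norm_add_le _ _).trans (by
            gcongr; exact (norm_sub_le _ _).trans (by
              gcongr; exact (norm_sub_le _ _).trans (by gcongr; exact norm_add_le _ _)))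
      _ = _ := by simp
  have htt : ‖t‖ ^ 2 ≤ (2 * q) ^ 2 := by gcongr
  have ht1 : ‖t‖ ^ 2 ≤ 1 * ‖t‖ := by rw [sq]; gcongr
  have ht2 : ‖t‖ ^ 3 ≤ 1 * ‖t‖ ^ 2 := by rw [pow_succ, mul_comm]; gcongr
  have b1 : ‖c‖ * (‖t‖ * ‖c‖) ≤ q * (2 * q * q) := by gcongr
  have b2 : ‖c‖ * (‖t‖ ^ 2 / 2 * ‖d‖) ≤ q * (2 * q / 2 * q) := by
    have : ‖t‖ ^ 2 ≤ 2 * q := by linarith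
    gcongr
  have b3 : ‖c‖ * ‖e‖ ≤ q * (K * (2 * q) ^ 2) := by
    have : ‖e‖ ≤ K * (2 * q) ^ 2 := he.trans (by gcongr; linarith)
    gcongr
  have b4 : ‖t‖ ^ 2 / 2 * ‖d‖ ≤ (2 * q) ^ 2 / 2 * q := by gcongr
  have b5 : ‖e‖ ≤ K * (2 * q) ^ 3 := he.trans (by gcongr)
  have hq3 : 0 ≤ q ^ 3 := by positivity
  nlinarith

/-- The asymptotics of the zeros, up to a cubic remainder. -/
lemma IsZeroNumbering.exists_remainder_le {f : ℝ → ℂ} (hf : IntervalIntegrable f volume 0 1)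
    {ξ : ℕ → ℂ} (hξ : IsZeroNumbering f ξ) :
    ∃ K : ℝ, 0 ≤ K ∧ ∀ᶠ n : ℕ in atTop, ‖(ξ n - (Real.pi : ℂ) * n / 2)
      - (sinCoeff n f - sinCoeff n f * cosCoeff n (V f))‖
      ≤ K * (‖sinCoeff n f‖ + ‖cosCoeff n (V f)‖ + ‖sinCoeff n (V (V f))‖) ^ 3 := by
  have hI : 0 ≤ ∫ x in (0 : ℝ)..1, ‖f x‖ :=
    intervalIntegral.integral_nonneg zero_le_one fun _ _ => norm_nonneg _
  set K : ℝ := (2 * ∫ x in (0 : ℝ)..1, ‖f x‖) + 1 with hK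
  have hK0 : 0 ≤ K := by positivity
  refine ⟨8 + 12 * K, by positivity, ?_⟩
  have h0 := (hξ.tendsto hf).1.norm
  rw [norm_zero] at h0
  have h2 := (h0.pow 2).const_mul K
  rw [zero_pow two_ne_zero, mul_zero] at h2
  filter_upwards [h0.eventually_le_const one_pos,
    h2.eventually_le_const (by norm_num : (0 : ℝ) < 1 / 2), eventually_ge_atTop 1] with n hn1 hn2 hn
  have hsin := hξ.sin_eq hf hn (t := ξ n - (Real.pi : ℂ) * n / 2) (by ring)
  set t := ξ n - (Real.pi : ℂ) * n / 2 with ht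
  have h3 := norm_integral_sin_sub_le hf n hn1
  rw [← hsin] at h3
  refine norm_remainder_le (e := (Complex.sin t - (sinCoeff n f - t * cosCoeff n (V f)
    - t ^ 2 / 2 * sinCoeff n (V (V f)))) - (Complex.sin t - t)) hK0 hn1 hn2 (by ring) ?_
  refine (norm_sub_le _ _).trans ?_
  have h4 := norm_sin_sub_le hn1
  rw [hK, add_mul, one_mul]
  exact add_le_add h3 h4

lemma sinCoeff_add {f g : ℝ → ℂ} (hf : IntervalIntegrable f volume 0 1)
    (hg : IntervalIntegrable g volume 0 1) (n : ℕ) :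
    sinCoeff n (fun x => f x + g x) = sinCoeff n f + sinCoeff n g := by
  simp only [sinCoeff, add_mul]
  exact intervalIntegral.integral_add (intervalIntegrable_mul_continuous hf (by fun_prop))
    (intervalIntegrable_mul_continuous hg (by fun_prop))

/-- The two representations of the displacements of the zeros by sine coefficients. -/
theorem IsZeroNumbering.exists_memW {α γ : ℝ} (hα0 : 0 < α) (hα1 : α ≤ 1)
    (hγ : γ = min (3 * α) (1 + α)) {f : ℝ → ℂ} (hf : MemW α f) {ξ : ℕ → ℂ}
    (hξ : IsZeroNumbering f ξ) :
    (∃ g : ℝ → ℂ, MemW γ g ∧ ∀ n : ℕ, 1 ≤ n →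
      ξ n - (Real.pi : ℂ) * n / 2 =
        sinCoeff n f - sinCoeff n f * cosCoeff n (V f) + sinCoeff n g) ∧
    (∃ h : ℝ → ℂ, MemW α h ∧ ∀ n : ℕ, 1 ≤ n →
      ξ n - (Real.pi : ℂ) * n / 2 = sinCoeff n h) := by
  have hγ1 : γ ≤ 3 * α := hγ ▸ min_le_left _ _
  have hγ2 : γ ≤ 1 + α := hγ ▸ min_le_right _ _
  have hαγ : α ≤ γ := hγ ▸ le_min (by linarith) (by linarith)
  have hfi := hf.intervalIntegrable
  set q : ℕ → ℝ := fun n => ‖sinCoeff n f‖ + ‖cosCoeff n (V f)‖ + ‖sinCoeff n (V (V f))‖ with hq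
  have hfV := hf.V hα0 hα1
  have hqd : Decays α q := ((hf.decays_sinCoeff hα0 hα1).add (hfV.decays_cosCoeff hα0 hα1)).add
    ((hfV.V hα0 hα1).decays_sinCoeff hα0 hα1)
  obtain ⟨K, hK, hrem⟩ := hξ.exists_remainder_le hfi
  set r : ℕ → ℂ := fun n => (ξ n - (Real.pi : ℂ) * n / 2)
    - (sinCoeff n f - sinCoeff n f * cosCoeff n (V f)) with hr
  have hrs : Summable fun n : ℕ => (n : ℝ) ^ (2 * γ) * ‖r n‖ ^ 2 := by
    refine ((hqd.summable_pow_six hα0 hγ1 hγ2).mul_left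
      (K ^ 2)).of_norm_bounded_eventually_nat ?_
    filter_upwards [hrem] with n hn
    rw [Real.norm_of_nonneg (by positivity)]
    calc (n : ℝ) ^ (2 * γ) * ‖r n‖ ^ 2 ≤ (n : ℝ) ^ (2 * γ) * (K * q n ^ 3) ^ 2 := by
          gcongr
      _ = _ := by ring
  obtain ⟨g, hg, hgn⟩ := exists_memW_sinCoeff_eq (by linarith) (by linarith) hrs
  refine ⟨⟨g, hg, fun n hn => ?_⟩, ?_⟩
  · rw [hgn n hn, hr]
    ring
  -- the quadratic term has the same smoothness as `f`
  have hps : Summable fun n : ℕ =>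
      (n : ℝ) ^ (2 * α) * ‖r n - sinCoeff n f * cosCoeff n (V f)‖ ^ 2 := by
    refine ((hrs.mul_left 2).add ((hqd.summable_pow_four hα0).mul_left
      2)).of_norm_bounded_eventually_nat ?_
    filter_upwards [eventually_ge_atTop 1] with n hn
    have hn1 : (1 : ℝ) ≤ n := by exact_mod_cast hn
    rw [Real.norm_of_nonneg (by positivity)]
    have h1 : ‖sinCoeff n f * cosCoeff n (V f)‖ ≤ q n ^ 2 := by
      rw [norm_mul, hq]
      nlinarith [norm_nonneg (sinCoeff n f), norm_nonneg (cosCoeff n (V f)),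
        norm_nonneg (sinCoeff n (V (V f)))]
    have h2 : ‖r n - sinCoeff n f * cosCoeff n (V f)‖ ≤ ‖r n‖ + q n ^ 2 :=
      (norm_sub_le _ _).trans (by gcongr)
    have h3 : (n : ℝ) ^ (2 * α) ≤ (n : ℝ) ^ (2 * γ) :=
      Real.rpow_le_rpow_of_exponent_le hn1 (by linarith)
    calc _ ≤ (n : ℝ) ^ (2 * α) * (‖r n‖ + q n ^ 2) ^ 2 := by gcongr
      _ ≤ (n : ℝ) ^ (2 * α) * (2 * ‖r n‖ ^ 2 + 2 * q n ^ 4) := by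
          gcongr
          nlinarith [sq_nonneg (‖r n‖ - q n ^ 2)]
      _ = 2 * ((n : ℝ) ^ (2 * α) * ‖r n‖ ^ 2) + 2 * ((n : ℝ) ^ (2 * α) * q n ^ 4) := by ring
      _ ≤ _ := by gcongr
  obtain ⟨k, hk, hkn⟩ := exists_memW_sinCoeff_eq hα0 (by linarith) hps
  refine ⟨fun x => f x + k x, hf.add hα0 hα1 hk, fun n hn => ?_⟩
  rw [sinCoeff_add hfi hk.intervalIntegrable, hkn n hn, hr]
  ring

end

end SobolevZeros

end

theorem theorem5p1 (α γ : ℝ) (hα0 : 0 < α) (hα1 : α ≤ 1) (hγ : γ = min (3 * α) (1 + α))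
    (f : ℝ → ℂ) (hf : SobolevZeros.MemW α f) :
    (∃ ξ : ℕ → ℂ, SobolevZeros.IsZeroNumbering f ξ) ∧
    ∀ ξ : ℕ → ℂ, SobolevZeros.IsZeroNumbering f ξ →
      (∃ g : ℝ → ℂ, SobolevZeros.MemW γ g ∧ ∀ n : ℕ, 1 ≤ n →
        ξ n - (Real.pi : ℂ) * n / 2 =
          SobolevZeros.sinCoeff n f
            - SobolevZeros.sinCoeff n f * SobolevZeros.cosCoeff n (SobolevZeros.V f)
            + SobolevZeros.sinCoeff n g) ∧
      (∃ h : ℝ → ℂ, SobolevZeros.MemW α h ∧ ∀ n : ℕ, 1 ≤ n →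
        ξ n - (Real.pi : ℂ) * n / 2 = SobolevZeros.sinCoeff n h) :=
  ⟨SobolevZeros.exists_isZeroNumbering hf.intervalIntegrable,
    fun _ hξ => hξ.exists_memW hα0 hα1 hγ hf⟩
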